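/- **Setting.** A mesh $\mathcal T$ is a finite set of non-degenerate compact triangles $T$ in $\mathbb R^d$ (planar domains: $d=2$; polyhedral surfaces: $d=3$) such that two distinct triangles are disjoint or meet exactly in a common node or a common edge. Each $T\in\mathcal T$ has a reference edge $E_T$ and a level $\mathrm{gen}(T)\in\mathbb N_0$. Let $\mathcal E$ be the set of edges of $\mathcal T$ and $\mathcal F(\mathcal T)=\{(T,E)\in\mathcal T\times\mathcal E: E\subset T\}$. The elements of the initial mesh have level $0$ and arbitrary reference edges. *Refinement.* Bisection of $T$ joins the midpoint $x_T$ of $E_T$ with the opposite node; the two sons have the edges opposite to $x_T$ as reference edges and the level $\mathrm{gen}(T)+1$. Red-refinement of $T$ joins the midpoints of its edges; the four sons have the edges parallel to $E_T$ as reference edges and the level $\mathrm{gen}(T)+2$. The two of them that meet $E_T$ in at most one point are the red-sons of $T$ (the upper one contains the node opposite to $E_T$, the lower one contains $x_T$); they share their reference edge. Given marked elements $\mathcal M\subseteq\mathcal T$ and marked edges $\mathcal M^{(0)}\subseteq\{E\in\mathcal E: E\subset T\text{ for some }T\in\mathcal M\}$, one repeatedly adds to the set of marked edges the reference edge of each element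 with a marked edge, until this set does not change any more. Then each element with a marked edge is bisected, and each of its two sons is bisected once more if its reference edge is marked (so all marked edges are halved; three marked edges give four sons, bisec(3)-refinement). The resulting mesh is $\mathtt{refineNVB3}(\mathcal T,\mathcal M,\mathcal M^{(0)})$. For $\mathtt{refineNVBred}(\mathcal T,\mathcal M,\mathcal M^{(0)})$, each element with three marked edges may be refined either by bisec(3)-refinement or by red-refinement, the choice being arbitrary. *Neighbours.* $T'\ne T$ is the reference neighbour of $T$, written $T'=N(T)$, if $E_T$ is an edge of $T'$. Two elements that share an edge $E=T\cap T'$ are compatibly divisible if $E_T=E=E_{T'}$ or $E_T\neq E\neq E_{T'}$. A successor of $T$ is an element obtained from $T$ by finitely many bisections and red-refinements. *Corresponding meshes.* Two refinements $\mathcal T,\tilde{\mathcal T}$ of an initial mesh $\mathcal T_0$ are corresponding, $\mathcal T\simeq\tilde{\mathcal T}$, if there is a bijection $\mathrm{corr}:\mathcal F(\mathcal T)\to\mathcal F(\tilde{\mathcal T})$ such that for all $(T,E),(T',E')\in\mathcal F(\mathcal T)$ with images $(\tilde T,\tilde E),(\tilde T',\tilde E')$: 1. $C^{-1}|T|\le|\tilde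 T|\le C|T|$ with an absolute constant $C>0$, and $\mathrm{gen}(T)=\mathrm{gen}(\tilde T)$; 2. $\tilde T\cap\tilde T'=\tilde E=\tilde E'$ if and only if $T\cap T'=E=E'$; 3. $\tilde E=E_{\tilde T}$ if and only if $E=E_T$; 4. $E=E'=E_T$ and $T'=N(T)$ if and only if $\tilde E=\tilde E'=E_{\tilde T}$ and $\tilde T'=N(\tilde T)$; 5. $\tilde T\cap\tilde T'=\tilde E=\tilde E'$ and $\tilde T,\tilde T'$ are compatibly divisible if and only if $T\cap T'=E=E'$ and $T,T'$ are compatibly divisible; 6. for each $\hat T\in\mathcal T_0$: $\tilde T\cap\tilde T'=\tilde E=\tilde E'$ and $\tilde T,\tilde T'$ are successors of $\hat T$ if and only if $T\cap T'=E=E'$ and $T,T'$ are successors of $\hat T$; 7. if $T'=T$ and $E'=E_T$, then $E_{\tilde T'}=\tilde E'=E_{\tilde T}$; if $\tilde T'=\tilde T$ and $\tilde E'=E_{\tilde T}$, then $E_{T'}=E'=E_T$. **Lemma 14.** Let $(\mathcal T_\ell)_{\ell\in\mathbb N_0}$ be a sequence with an initial mesh $\mathcal T_0$ and $\mathcal T_{\ell+1}=\mathtt{refineNVBred}(\mathcal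 T_\ell,\mathcal M_\ell,\mathcal M_\ell^{(0)})$ for all $\ell\in\mathbb N_0$, with $\mathcal M_\ell\subseteq\mathcal T_\ell$ and $\mathcal M_\ell^{(0)}\subseteq\{E\in\mathcal E_\ell:E\subset T\text{ for some }T\in\mathcal M_\ell\}$. Then there are meshes $(\tilde{\mathcal T}_\ell)_{\ell\in\mathbb N_0}$ with $\tilde{\mathcal T}_0=\mathcal T_0$, sets $\tilde{\mathcal M}_\ell\subseteq\tilde{\mathcal T}_\ell$ and $\tilde{\mathcal M}_\ell^{(0)}\subseteq\{\tilde E\in\tilde{\mathcal E}_\ell:\tilde E\subset\tilde T\text{ for some }\tilde T\in\tilde{\mathcal M}_\ell\}$, and maps $\mathrm{corr}_\ell$ such that, for all $\ell\in\mathbb N_0$, $\tilde{\mathcal T}_{\ell+1}=\mathtt{refineNVB3}(\tilde{\mathcal T}_\ell,\tilde{\mathcal M}_\ell,\tilde{\mathcal M}_\ell^{(0)})$, $\mathcal T_\ell\simeq\tilde{\mathcal T}_\ell$ by means of $\mathrm{corr}_\ell$, $\#\tilde{\mathcal T}_\ell=\#\mathcal T_\ell$, and $\#\tilde{\mathcal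 M}_\ell\le2\,\#\mathcal M_\ell$. Furthermore, $\mathrm{corr}_\ell$ acts on red-sons as follows. Suppose that $F\in\mathcal T_k$ with reference edge $ab$ and opposite node $c_F$ is red-refined in the step from $\mathcal T_k$ to $\mathcal T_{k+1}$. Let $K,Q,P$ be the midpoints of $ab$, $ac_F$, $bc_F$; let $U$ be the upper red-son (with nodes $c_F,Q,P$) and $L$ the lower one (with nodes $K,Q,P$). If $\ell>k$ and $\mathcal T_\ell$ contains $U$ or $L$, then it contains both, and there are triangles $X$ with nodes $c,m,q$ and $Y$ with nodes $c,m,p$ in $\tilde{\mathcal T}_\ell$ with the common reference edge $cm$ such that $$\mathrm{corr}_\ell(U,c_FQ)=(X,cq),\quad \mathrm{corr}_\ell(U,c_FP)=(Y,cp),\quad \mathrm{corr}_\ell(L,KQ)=(X,mq),\quad \mathrm{corr}_\ell(L,KP)=(Y,mp),$$ and $\mathrm{corr}_\ell$ maps $(U,QP),(L,QP)$ to $(X,cm),(Y,cm)$ in one of the two possible orders. If moreover all three pairs $(F,E)$ are mapped by $\mathrm{corr}_k$ to pairs with one and the same $G\in\tilde{\mathcal T}_k$, then for $\ell=k+1$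 the triangles $X$ and $Y$ are the two sons of the bisec(3)-refinement of $G$ that contain the node $c$ of $G$ opposite to $E_G$: here $m$ is the midpoint of $E_G$, and $q$ and $p$ are the midpoints of the edges of $G$ that correspond to $ac_F$ and $bc_F$. -/

import Mathlib

namespace NVB

/-- The ambient Euclidean space. Planar domains are `d = 2`, polyhedral surfaces are `d = 3`. -/
abbrev Pt (d : ℕ) := EuclideanSpace ℝ (Fin d)

/-- A triangle together with its reference edge and its level: `ref` is the reference edge (an
unordered pair of nodes), `apex` is the node opposite to it, and `gen` is the level. -/
@[ext]
structure Elem (d : ℕ) where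
  apex : Pt d
  ref : Sym2 (Pt d)
  gen : ℕ

/-- The midpoint of an edge. -/
noncomputable def mid {d : ℕ} (e : Sym2 (Pt d)) : Pt d :=
  Sym2.lift ⟨fun a b => midpoint ℝ a b, fun a b => midpoint_comm a b⟩ e

/-- An edge as a compact set: the segment between its two end points. -/
def edgeHull {d : ℕ} (e : Sym2 (Pt d)) : Set (Pt d) :=
  convexHull ℝ {x | x ∈ e}

namespace Elem

variable {d : ℕ}

/-- The three nodes of a triangle. -/
def verts (T : Elem d) : Set (Pt d) := insert T.apex {x | x ∈ T.ref}

/-- The three edges of a triangle. -/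
def edges (T : Elem d) : Set (Sym2 (Pt d)) := insert T.ref {e | ∃ x ∈ T.ref, e = s(x, T.apex)}

/-- The triangle as a compact set. -/
def hull (T : Elem d) : Set (Pt d) := convexHull ℝ T.verts

/-- The nodes are affinely independent. -/
def Nondegenerate (T : Elem d) : Prop :=
  ∃ a b : Pt d, T.ref = s(a, b) ∧ AffineIndependent ℝ ![a, b, T.apex]

/-- The area of a triangle, half the area of the parallelogram spanned by two of its sides. -/
noncomputable def area (T : Elem d) : ℝ :=
  Sym2.lift ⟨fun a b => 1 / 2 * Real.sqrt (‖a - T.apex‖ ^ 2 * ‖b - T.apex‖ ^ 2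
      - (inner ℝ (a - T.apex) (b - T.apex)) ^ 2),
    fun a b => by
      simp only [mul_comm (‖a - T.apex‖ ^ 2), real_inner_comm]⟩ T.ref

/-- The two sons of a bisection: the midpoint of the reference edge becomes the newest vertex of
both sons, and the reference edges of the sons are opposite to it. -/
def bisect (T : Elem d) : Set (Elem d) :=
  {S | ∃ x ∈ T.ref, S = ⟨mid T.ref, s(x, T.apex), T.gen + 1⟩}

/-- The common reference edge of the two red-sons; it joins the midpoints of the two edges other
than the reference edge. -/
noncomputable def redEdge (T : Elem d) : Sym2 (Pt d) :=
  T.ref.map fun x => midpoint ℝ x T.apex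

/-- The upper red-son. -/
noncomputable def upperRed (T : Elem d) : Elem d := ⟨T.apex, T.redEdge, T.gen + 2⟩

/-- The lower red-son. -/
noncomputable def lowerRed (T : Elem d) : Elem d := ⟨mid T.ref, T.redEdge, T.gen + 2⟩

/-- The four sons of a red-refinement. All their reference edges are parallel to that of the
father; two of the sons keep an end point of the reference edge of the father, the other two are
the red-sons. -/
def redSons (T : Elem d) : Set (Elem d) :=
  {T.upperRed, T.lowerRed} ∪
    {S | ∃ x ∈ T.ref, S = ⟨midpoint ℝ x T.apex, s(x, mid T.ref), T.gen + 2⟩}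

/-- The sons of `T` by (at most three) bisections if `N` is the set of marked edges: `T` is
bisected if its reference edge is marked, and a son is bisected again if its reference edge, which
is an edge of `T`, is marked. This gives 1, 2, 3 or 4 elements. -/
def nvbSons (N : Set (Sym2 (Pt d))) (T : Elem d) : Set (Elem d) :=
  {S | (T.ref ∉ N ∧ S = T) ∨
    (T.ref ∈ N ∧ ∃ S' ∈ T.bisect, (S'.ref ∉ N ∧ S = S') ∨ (S'.ref ∈ N ∧ S ∈ S'.bisect))}

/-- The elements into which `T` is refined if `N` is the set of marked edges and `R` is the set of
those elements for which red-refinement is preferred in case that all three edges are marked. -/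
def sons (N : Set (Sym2 (Pt d))) (R : Set (Elem d)) (T : Elem d) : Set (Elem d) :=
  {S | (T.edges ⊆ N ∧ T ∈ R ∧ S ∈ T.redSons) ∨ (¬ (T.edges ⊆ N ∧ T ∈ R) ∧ S ∈ T.nvbSons N)}

/-- `S` is obtained from `T` by one bisection or by one red-refinement. -/
def IsSon (T S : Elem d) : Prop := S ∈ T.bisect ∨ S ∈ T.redSons

/-- `S` is obtained from `T` by finitely many bisections and red-refinements. -/
def Successor (T S : Elem d) : Prop := Relation.ReflTransGen IsSon T S

end Elem

/-- A finite set of triangles (with reference edges and levels) is a mesh, that is, a regular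
triangulation of the union of its elements: the triangles are non-degenerate, and two distinct
ones are disjoint or meet in a common node or in a common edge. -/
def IsMesh {d : ℕ} (𝒯 : Finset (Elem d)) : Prop :=
  (∀ T ∈ 𝒯, T.Nondegenerate) ∧
  ∀ T₁ ∈ 𝒯, ∀ T₂ ∈ 𝒯, T₁ ≠ T₂ →
    T₁.hull ∩ T₂.hull = ∅ ∨
    (∃ v, v ∈ T₁.verts ∧ v ∈ T₂.verts ∧ T₁.hull ∩ T₂.hull = {v}) ∨
    (∃ e, e ∈ T₁.edges ∧ e ∈ T₂.edges ∧ T₁.hull ∩ T₂.hull = edgeHull e)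

/-- One pass of the closure loop: the reference edge of each element with a marked edge is
marked, too. -/
def markStep {d : ℕ} (𝒯 : Finset (Elem d)) (N : Set (Sym2 (Pt d))) : Set (Sym2 (Pt d)) :=
  N ∪ {e | ∃ T ∈ 𝒯, e = T.ref ∧ ∃ e' ∈ N, e' ∈ T.edges}

/-- `N` is the set of marked edges with which the closure loop, started with `N₀`, terminates. -/
def IsMarkClosure {d : ℕ} (𝒯 : Finset (Elem d)) (N₀ N : Set (Sym2 (Pt d))) : Prop :=
  ∃ k : ℕ, (markStep 𝒯)^[k] N₀ = N ∧ markStep 𝒯 N = N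

/-- `𝒯'` is generated from `𝒯`, the marked elements `M ⊆ 𝒯` and the initially marked edges `N₀`
(edges of marked elements), where the elements in `R` with three marked edges are red-refined and
all other elements are refined by bisections only. -/
def RefineWith {d : ℕ} (R : Set (Elem d)) (𝒯 M : Finset (Elem d)) (N₀ : Set (Sym2 (Pt d)))
    (𝒯' : Finset (Elem d)) : Prop :=
  M ⊆ 𝒯 ∧ (∀ e ∈ N₀, ∃ T ∈ M, e ∈ T.edges) ∧
  ∃ N : Set (Sym2 (Pt d)), IsMarkClosure 𝒯 N₀ N ∧ ∀ S, S ∈ 𝒯' ↔ ∃ T ∈ 𝒯, S ∈ T.sons N R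

/-- `𝒯' = refineNVB3(𝒯, M, N₀)`: bisections only. -/
def RefineNVB3 {d : ℕ} (𝒯 M : Finset (Elem d)) (N₀ : Set (Sym2 (Pt d)))
    (𝒯' : Finset (Elem d)) : Prop :=
  RefineWith ∅ 𝒯 M N₀ 𝒯'

/-- `𝒯' = refineNVBred(𝒯, M, N₀)`: each element with three marked edges is refined either by
three bisections or by red-refinement; the choice is arbitrary. -/
def RefineNVBred {d : ℕ} (𝒯 M : Finset (Elem d)) (N₀ : Set (Sym2 (Pt d)))
    (𝒯' : Finset (Elem d)) : Prop :=
  ∃ R : Set (Elem d), RefineWith R 𝒯 M N₀ 𝒯'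

/-- Pairs of an element and an edge. -/
abbrev Flag (d : ℕ) := Elem d × Sym2 (Pt d)

/-- The pairs of an element of the mesh and one of the edges of this element. -/
def flags {d : ℕ} (𝒯 : Finset (Elem d)) : Set (Flag d) := {φ | φ.1 ∈ 𝒯 ∧ φ.2 ∈ φ.1.edges}

/-- `(T, E)` and `(T', E')` with `E = E'` and `T ∩ T' = E`: the edge `E` is shared by the
neighbours `T` and `T'`. -/
def Linked {d : ℕ} (φ ψ : Flag d) : Prop :=
  φ.2 = ψ.2 ∧ φ.1.hull ∩ ψ.1.hull = edgeHull φ.2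

/-- `T'` is the reference neighbour of `T` in the mesh. -/
def IsRefNeighbour {d : ℕ} (𝒯 : Finset (Elem d)) (T T' : Elem d) : Prop :=
  T' ∈ 𝒯 ∧ T' ≠ T ∧ T.ref ∈ T'.edges

/-- The elements share an edge, which is the reference edge of both or of none. -/
def CompatiblyDivisible {d : ℕ} (T₁ T₂ : Elem d) : Prop :=
  ∃ e, e ∈ T₁.edges ∧ e ∈ T₂.edges ∧ T₁.hull ∩ T₂.hull = edgeHull e ∧
    ((T₁.ref = e ∧ T₂.ref = e) ∨ (T₁.ref ≠ e ∧ T₂.ref ≠ e))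

/-- `corr` exhibits the refinements `𝒯` and `𝒯'` of the initial mesh `𝒯₀` as corresponding
meshes, with constant `C` in the equivalence of the areas. -/
structure IsCorr {d : ℕ} (C : ℝ) (𝒯₀ 𝒯 𝒯' : Finset (Elem d)) (corr : Flag d → Flag d) :
    Prop where
  bijOn : Set.BijOn corr (flags 𝒯) (flags 𝒯')
  area_equiv : ∀ φ ∈ flags 𝒯,
    φ.1.area ≤ C * (corr φ).1.area ∧ (corr φ).1.area ≤ C * φ.1.area
  gen_eq : ∀ φ ∈ flags 𝒯, φ.1.gen = (corr φ).1.gen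
  neighbour : ∀ φ ∈ flags 𝒯, ∀ ψ ∈ flags 𝒯, Linked (corr φ) (corr ψ) ↔ Linked φ ψ
  ref_edge : ∀ φ ∈ flags 𝒯, (corr φ).2 = (corr φ).1.ref ↔ φ.2 = φ.1.ref
  ref_neighbour : ∀ φ ∈ flags 𝒯, ∀ ψ ∈ flags 𝒯,
    (φ.2 = ψ.2 ∧ ψ.2 = φ.1.ref ∧ IsRefNeighbour 𝒯 φ.1 ψ.1) ↔
    ((corr φ).2 = (corr ψ).2 ∧ (corr ψ).2 = (corr φ).1.ref ∧
      IsRefNeighbour 𝒯' (corr φ).1 (corr ψ).1)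
  compatible : ∀ φ ∈ flags 𝒯, ∀ ψ ∈ flags 𝒯,
    (Linked (corr φ) (corr ψ) ∧ CompatiblyDivisible (corr φ).1 (corr ψ).1) ↔
    (Linked φ ψ ∧ CompatiblyDivisible φ.1 ψ.1)
  ancestor : ∀ φ ∈ flags 𝒯, ∀ ψ ∈ flags 𝒯, ∀ A ∈ 𝒯₀,
    (Linked (corr φ) (corr ψ) ∧ A.Successor (corr φ).1 ∧ A.Successor (corr ψ).1) ↔
    (Linked φ ψ ∧ A.Successor φ.1 ∧ A.Successor ψ.1)
  ref_common : ∀ φ ∈ flags 𝒯, ∀ ψ ∈ flags 𝒯, ψ.1 = φ.1 → ψ.2 = φ.1.ref →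
    (corr ψ).1.ref = (corr ψ).2 ∧ (corr ψ).2 = (corr φ).1.ref
  ref_common_symm : ∀ φ ∈ flags 𝒯, ∀ ψ ∈ flags 𝒯,
    (corr ψ).1 = (corr φ).1 → (corr ψ).2 = (corr φ).1.ref →
    ψ.1.ref = ψ.2 ∧ ψ.2 = φ.1.ref

/-- The local rule for the two red-sons of `F`, whose reference edge is `ab`. Let `K` be the
midpoint of `ab`, and `Q` and `P` those of the other two edges, at `a` and at `b`. Then `corr`
maps the red-sons to the triangles `X = cmq` and `Y = cmp` with the common reference edge `cm`:
the four pairs with an edge at the apex of `F` or at `K` go to those with the respective edge at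
`c` or at `m`, and the two pairs with the reference edge `QP` go to those with the reference edge
`cm`, in one of the two possible orders. -/
def RedSonRule {d : ℕ} (corr : Flag d → Flag d) (F : Elem d) (a b c m q p : Pt d) : Prop :=
  let Q := midpoint ℝ a F.apex
  let P := midpoint ℝ b F.apex
  let K := mid F.ref
  let X : Elem d := ⟨q, s(c, m), F.gen + 2⟩
  let Y : Elem d := ⟨p, s(c, m), F.gen + 2⟩
  corr (F.upperRed, s(F.apex, Q)) = (X, s(c, q)) ∧
  corr (F.upperRed, s(F.apex, P)) = (Y, s(c, p)) ∧
  corr (F.lowerRed, s(K, Q)) = (X, s(m, q)) ∧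
  corr (F.lowerRed, s(K, P)) = (Y, s(m, p)) ∧
  ((corr (F.upperRed, s(Q, P)) = (X, s(c, m)) ∧ corr (F.lowerRed, s(Q, P)) = (Y, s(c, m))) ∨
   (corr (F.upperRed, s(Q, P)) = (Y, s(c, m)) ∧ corr (F.lowerRed, s(Q, P)) = (X, s(c, m))))

end NVB

/-! Let F have apex c, let K be the midpoint of its reference edge and Q, P those of the other two
edges. Then cQKP is a parallelogram. Red-refinement and three bisections of F agree outside it.
Inside, the red-sons arise from the diagonal QP, and two grandsons by bisection, the wings, from the
diagonal cK. All four triangles have the level of F plus two, and the reference edge of each is the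
diagonal that cuts it off. Exchanging the two diagonals is a flip.

The mesh with red-refinements differs from a mesh produced by bisections alone only by flips
(`IsFlip`); the set P collects the elements whose red-sons are still present. This is an invariant
of refinement (`IsFlip.step`). By the closure rule a red-son with a marked edge has its reference
edge QP marked, and QP belongs to both red-sons, so both are kept or both are bisected. If they are
bisected, the flip dissolves: the diagonals bisect each other, hence the red-sons and the wings have
the same four sons (`Elem.exists_reds_nvbSons_iff`). The edge map that sends each QP to cK and fixes
all other edges commutes with the closure of marked edges (`IsFlip.markStep_image`). A general step
is thus a refinement by bisections (`IsFlip.nvbSons`) followed by new flips for the elements refined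
red now (`IsMesh.isFlip_sons`), and old and new flips are merged by `IsFlip.comp`.

The correspondence moves a pair of a red-son and a side of the parallelogram to the wing with that
side, and a pair with the edge QP to a pair with cK. Edges and reference edges are transported by
the same injective edge map, which gives the combinatorial conditions at once
(`isCorr_of_edge_map`). Levels and ancestors agree, and area times 2 to the level is constant along
successors, so areas are equal and C = 1. The two sides of a red-son go to two different wings,
which explains the factor 2 for marked elements.

That all these families are meshes is shown with barycentric weights: non-degenerate triangles with
distinct node sets form a mesh if every point has the same weights in all triangles containing it
(`isMesh_of_weights`). A bisection of xy uses x + y = 2 · midpoint, a flip uses c + K = Q + P. In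
either case the smaller of two weights is moved along this relation, by a formula that does not
mention the son in which the point lies. -/

namespace NVB

open Finsupp (single)

variable {d : ℕ}

/-! ### Affine independence of three points by coefficients -/

/-- Three points are affinely independent, expressed by coefficients. -/
def Indep (a b c : Pt d) : Prop :=
  ∀ α β γ : ℝ, α + β + γ = 0 → α • a + β • b + γ • c = 0 → α = 0 ∧ β = 0 ∧ γ = 0

/-- In terms of coefficients, non-degeneracy of a son is linear algebra: a vanishing combination of
its nodes is rewritten as one of the nodes of the father. -/
theorem affineIndependent_iff_indep {a b c : Pt d} :
    AffineIndependent ℝ ![a, b, c] ↔ Indep a b c := by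
  rw [affineIndependent_iff_of_fintype]
  constructor
  · intro h α β γ h0 h1
    have := h ![α, β, γ] (by simpa [Fin.sum_univ_three] using h0) (by
      rw [Finset.weightedVSub_eq_weightedVSubOfPoint_of_sum_eq_zero _ _ _
        (by simpa [Fin.sum_univ_three] using h0) (0 : Pt d)]
      simpa [Finset.weightedVSubOfPoint_apply, Fin.sum_univ_three] using h1)
    exact ⟨this 0, this 1, this 2⟩
  · intro h w h0 h1
    rw [Finset.weightedVSub_eq_weightedVSubOfPoint_of_sum_eq_zero _ _ _ h0 (0 : Pt d)] at h1
    simp only [Finset.weightedVSubOfPoint_apply, Fin.sum_univ_three, vsub_eq_sub, sub_zero,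
      Matrix.cons_val_zero, Matrix.cons_val_one, Matrix.cons_val] at h1 h0
    obtain ⟨h2, h3, h4⟩ := h _ _ _ h0 h1
    intro i
    fin_cases i <;> assumption

theorem midpoint_eq (a b : Pt d) : midpoint ℝ a b = (1 / 2 : ℝ) • a + (1 / 2 : ℝ) • b := by
  rw [midpoint_eq_smul_add]; simp

@[simp] theorem mid_mk (a b : Pt d) : mid s(a, b) = midpoint ℝ a b := rfl

namespace Indep

variable {a b c : Pt d}

theorem swap (h : Indep a b c) : Indep b a c := fun α β γ h0 h1 => by
  obtain ⟨h2, h3, h4⟩ := h β α γ (by linarith) (by rw [← h1]; module)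
  exact ⟨h3, h2, h4⟩

theorem swap' (h : Indep a b c) : Indep a c b := fun α β γ h0 h1 => by
  obtain ⟨h2, h3, h4⟩ := h α γ β (by linarith) (by rw [← h1]; module)
  exact ⟨h2, h4, h3⟩

theorem ne (h : Indep a b c) : a ≠ b := by
  rintro rfl
  have := h 1 (-1) 0 (by norm_num) (by module)
  norm_num at this

theorem ne₁₃ (h : Indep a b c) : a ≠ c := h.swap'.ne

theorem ne₂₃ (h : Indep a b c) : b ≠ c := h.swap.swap'.ne

theorem mid_ne_left (h : Indep a b c) : midpoint ℝ a b ≠ a := by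
  simpa [midpoint_eq_left_iff] using h.ne

theorem mid_ne_right (h : Indep a b c) : midpoint ℝ a b ≠ b := by
  simpa [midpoint_eq_right_iff] using h.ne

theorem mid_ne (h : Indep a b c) : midpoint ℝ a b ≠ c := by
  intro he
  have := h (1 / 2) (1 / 2) (-1) (by norm_num) (by rw [← he, midpoint_eq]; module)
  norm_num at this

theorem mid_ne_mid (h : Indep a b c) : midpoint ℝ a b ≠ midpoint ℝ a c := by
  intro he
  have := h 0 (1 / 2) (-1 / 2) (by norm_num) (by
    rw [midpoint_eq, midpoint_eq, add_right_inj] at he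
    have : (1 / 2 : ℝ) • b - (1 / 2 : ℝ) • c = 0 := sub_eq_zero.2 he
    rw [← this]; module)
  norm_num at this

/-- A son of a bisection is non-degenerate. -/
theorem son (h : Indep a b c) : Indep a c (midpoint ℝ a b) := fun α β γ h0 h1 => by
  obtain ⟨h2, h3, h4⟩ := h (α + γ / 2) (γ / 2) β (by linarith)
    (by rw [← h1, midpoint_eq]; module)
  refine ⟨?_, ?_, ?_⟩ <;> linarith

theorem upper (h : Indep a b c) : Indep (midpoint ℝ a c) (midpoint ℝ b c) c :=
  fun α β γ h0 h1 => by
  obtain ⟨h2, h3, h4⟩ := h (α / 2) (β / 2) (α / 2 + β / 2 + γ) (by linarith)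
    (by rw [← h1, midpoint_eq, midpoint_eq]; module)
  refine ⟨?_, ?_, ?_⟩ <;> linarith

theorem lower (h : Indep a b c) :
    Indep (midpoint ℝ a c) (midpoint ℝ b c) (midpoint ℝ a b) :=
  fun α β γ h0 h1 => by
  obtain ⟨h2, h3, h4⟩ := h (α / 2 + γ / 2) (β / 2 + γ / 2) (α / 2 + β / 2) (by linarith)
    (by rw [← h1, midpoint_eq, midpoint_eq, midpoint_eq]; module)
  refine ⟨?_, ?_, ?_⟩ <;> linarith

end Indep

/-! ### Convex weights -/

/-- The sum of all coefficients. -/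
noncomputable def total : (Pt d →₀ ℝ) →ₗ[ℝ] ℝ := Finsupp.linearCombination ℝ fun _ => (1 : ℝ)

/-- The point with the given coefficients. -/
noncomputable def point : (Pt d →₀ ℝ) →ₗ[ℝ] Pt d := Finsupp.linearCombination ℝ id

@[simp] theorem total_single (v : Pt d) (r : ℝ) : total (single v r) = r := by simp [total]

@[simp] theorem point_single (v : Pt d) (r : ℝ) : point (single v r) = r • v := by simp [point]

/-- The coefficients of a convex combination of points of `s`. -/
structure IsWeight (s : Set (Pt d)) (w : Pt d →₀ ℝ) : Prop where
  nonneg : ∀ v, 0 ≤ w v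
  zero : ∀ v, v ∉ s → w v = 0
  total_eq : total w = 1

theorem IsWeight.mono {s t : Set (Pt d)} {w : Pt d →₀ ℝ} (h : IsWeight s w) (hst : s ⊆ t) :
    IsWeight t w :=
  ⟨h.nonneg, fun v hv => h.zero v fun hs => hv (hst hs), h.total_eq⟩

theorem isWeight_single {s : Set (Pt d)} {v : Pt d} (hv : v ∈ s) : IsWeight s (single v 1) where
  nonneg u := by classical rw [Finsupp.single_apply]; split_ifs <;> norm_num
  zero u hu := Finsupp.single_eq_of_ne (by rintro rfl; exact hu hv)
  total_eq := by simp

/-- The points that possess weights form a convex set containing `s`. Weights are functions on the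
whole space, not on the nodes of one triangle, so that weights from different triangles can be
compared by an equation. -/
theorem mem_convexHull_iff_weight {s : Set (Pt d)} {z : Pt d} :
    z ∈ convexHull ℝ s ↔ ∃ w, IsWeight s w ∧ point w = z := by
  constructor
  · intro hz
    have hsub : convexHull ℝ s ⊆ {z | ∃ w, IsWeight s w ∧ point w = z} := by
      refine convexHull_min (fun v hv => ⟨single v 1, isWeight_single hv, by simp⟩) ?_
      rintro _ ⟨w₁, h₁, rfl⟩ _ ⟨w₂, h₂, rfl⟩ α β hα hβ hαβ
      refine ⟨α • w₁ + β • w₂, ⟨fun v => ?_, fun v hv => ?_, ?_⟩, by simp⟩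
      · have := mul_nonneg hα (h₁.nonneg v)
        have := mul_nonneg hβ (h₂.nonneg v)
        simp only [Finsupp.coe_add, Finsupp.coe_smul, Pi.add_apply, Pi.smul_apply, smul_eq_mul]
        linarith
      · simp [h₁.zero v hv, h₂.zero v hv]
      · simp [h₁.total_eq, h₂.total_eq, hαβ]
    exact hsub hz
  · rintro ⟨w, h, rfl⟩
    rw [point, Finsupp.linearCombination_apply, Finsupp.sum]
    refine (convex_convexHull ℝ s).sum_mem (fun v _ => h.nonneg v) ?_ fun v hv => ?_
    · have := h.total_eq
      simpa [total, Finsupp.linearCombination_apply, Finsupp.sum] using this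
    · refine subset_convexHull ℝ s ?_
      by_contra hs
      exact (Finsupp.mem_support_iff.1 hv) (h.zero v hs)

theorem eq_of_zero_off {a b c : Pt d} (h : Indep a b c) {w : Pt d →₀ ℝ}
    (hw : ∀ v, v ∉ ({a, b, c} : Set (Pt d)) → w v = 0) :
    w = single a (w a) + single b (w b) + single c (w c) := by
  classical
  ext v
  simp only [Finsupp.coe_add, Pi.add_apply, Finsupp.single_apply]
  have := h.ne; have := h.ne₁₃; have := h.ne₂₃
  by_cases ha : a = v
  · subst ha; simp [*, Ne.symm]
  by_cases hb : b = v
  · subst hb; simp [*, Ne.symm]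
  by_cases hc : c = v
  · subst hc; simp [*, Ne.symm]
  simp only [ha, hb, hc, if_false, add_zero]
  exact hw v (by simp [Ne.symm ha, Ne.symm hb, Ne.symm hc])

theorem Indep.weight_unique {a b c : Pt d} (h : Indep a b c) {w₁ w₂ : Pt d →₀ ℝ}
    (h₁ : IsWeight {a, b, c} w₁) (h₂ : IsWeight {a, b, c} w₂) (hp : point w₁ = point w₂) :
    w₁ = w₂ := by
  have e := eq_of_zero_off h (w := w₁ - w₂) fun v hv => by simp [h₁.zero v hv, h₂.zero v hv]
  have t : total (w₁ - w₂) = 0 := by rw [map_sub, h₁.total_eq, h₂.total_eq, sub_self]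
  have p : point (w₁ - w₂) = 0 := by rw [map_sub, hp, sub_self]
  rw [e] at t p
  simp only [map_add, total_single, point_single] at t p
  obtain ⟨i, j, k⟩ := h _ _ _ t p
  rw [i, j, k] at e
  simpa [sub_eq_zero] using e

/-! ### Nodes and edges -/

namespace Elem

variable {T : Elem d} {a b : Pt d}

theorem verts_eq (h : T.ref = s(a, b)) : T.verts = {a, b, T.apex} := by
  ext v; simp [verts, h]; tauto

theorem edges_eq (h : T.ref = s(a, b)) :
    T.edges = {s(a, b), s(a, T.apex), s(b, T.apex)} := by
  ext v; simp [edges, h]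

theorem Nondegenerate.indep (h : T.Nondegenerate) (hr : T.ref = s(a, b)) :
    Indep a b T.apex := by
  obtain ⟨x, y, hxy, hi⟩ := h
  rw [affineIndependent_iff_indep] at hi
  rw [hr, Sym2.eq_iff] at hxy
  obtain ⟨rfl, rfl⟩ | ⟨rfl, rfl⟩ := hxy
  · exact hi
  · exact hi.swap

theorem nondegenerate_of_indep (hr : T.ref = s(a, b)) (h : Indep a b T.apex) :
    T.Nondegenerate :=
  ⟨a, b, hr, affineIndependent_iff_indep.2 h⟩

theorem exists_ref (T : Elem d) : ∃ a b, T.ref = s(a, b) :=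
  ⟨_, _, (Quot.out_eq T.ref).symm⟩

theorem exists_ref_of_mem {x : Pt d} (h : x ∈ T.ref) : ∃ y, T.ref = s(x, y) := h

theorem Nondegenerate.mem_edges_iff (h : T.Nondegenerate) {x y : Pt d} :
    s(x, y) ∈ T.edges ↔ x ∈ T.verts ∧ y ∈ T.verts ∧ x ≠ y := by
  obtain ⟨a, b, hr⟩ := T.exists_ref
  have hi := h.indep hr
  have := hi.ne; have := hi.ne₁₃; have := hi.ne₂₃
  rw [verts_eq hr, edges_eq hr]
  simp only [Set.mem_insert_iff, Set.mem_singleton_iff, Sym2.eq_iff]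
  constructor
  · rintro ((⟨rfl, rfl⟩ | ⟨rfl, rfl⟩) | (⟨rfl, rfl⟩ | ⟨rfl, rfl⟩) | (⟨rfl, rfl⟩ | ⟨rfl, rfl⟩)) <;>
      simp_all [Ne.symm]
  · rintro ⟨rfl | rfl | rfl, rfl | rfl | rfl, hne⟩ <;> simp_all

theorem ref_mem_edges (T : Elem d) : T.ref ∈ T.edges := Set.mem_insert _ _

theorem weight_unique (h : T.Nondegenerate) {w₁ w₂ : Pt d →₀ ℝ}
    (h₁ : IsWeight T.verts w₁) (h₂ : IsWeight T.verts w₂) (hp : point w₁ = point w₂) :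
    w₁ = w₂ := by
  obtain ⟨a, b, hr⟩ := T.exists_ref
  rw [verts_eq hr] at h₁ h₂
  exact (h.indep hr).weight_unique h₁ h₂ hp

theorem mem_hull_iff {z : Pt d} : z ∈ T.hull ↔ ∃ w, IsWeight T.verts w ∧ point w = z :=
  mem_convexHull_iff_weight

theorem verts_subset_hull (T : Elem d) : T.verts ⊆ T.hull := subset_convexHull ℝ _

theorem mem_verts_of_mem_edges {e : Sym2 (Pt d)} (he : e ∈ T.edges) {x : Pt d} (hx : x ∈ e) :
    x ∈ T.verts := by
  obtain ⟨a, b, hr⟩ := T.exists_ref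
  rw [edges_eq hr] at he
  rw [verts_eq hr]
  obtain rfl | rfl | rfl := he <;> simp at hx <;> obtain rfl | rfl := hx <;> simp

end Elem

theorem coe_sym2_mk (x y : Pt d) : {v | v ∈ s(x, y)} = ({x, y} : Set (Pt d)) := by
  ext; simp

theorem edgeHull_mk (x y : Pt d) : edgeHull s(x, y) = convexHull ℝ {x, y} := by
  rw [edgeHull, coe_sym2_mk]

theorem mid_mem_edgeHull (e : Sym2 (Pt d)) : mid e ∈ edgeHull e := by
  induction e with | _ x y
  rw [edgeHull_mk, convexHull_pair]
  exact midpoint_mem_segment x y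

theorem edgeHull_subset_hull {T : Elem d} {e : Sym2 (Pt d)} (he : e ∈ T.edges) :
    edgeHull e ⊆ T.hull :=
  convexHull_mono fun _ hx => Elem.mem_verts_of_mem_edges he hx

/-! ### Meshes and weights -/

/-- A common point of two elements has the same weights in both of them; if the elements are
distinct, then the weights live on a common node or on a common edge. -/
theorem IsMesh.weight_cases {𝒯 : Finset (Elem d)} (h : IsMesh 𝒯) {T₁ T₂ : Elem d}
    (h₁ : T₁ ∈ 𝒯) (h₂ : T₂ ∈ 𝒯) (hne : T₁ ≠ T₂) {w₁ w₂ : Pt d →₀ ℝ}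
    (hw₁ : IsWeight T₁.verts w₁) (hw₂ : IsWeight T₂.verts w₂) (hp : point w₁ = point w₂) :
    w₁ = w₂ ∧ ((∃ v, v ∈ T₁.verts ∧ v ∈ T₂.verts ∧ w₁ = single v 1) ∨
      ∃ x y, s(x, y) ∈ T₁.edges ∧ s(x, y) ∈ T₂.edges ∧ IsWeight {x, y} w₁) := by
  have hz : point w₁ ∈ T₁.hull ∩ T₂.hull :=
    ⟨Elem.mem_hull_iff.2 ⟨_, hw₁, rfl⟩, Elem.mem_hull_iff.2 ⟨_, hw₂, hp.symm⟩⟩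
  obtain he | ⟨v, hv₁, hv₂, he⟩ | ⟨e, he₁, he₂, he⟩ := h.2 T₁ h₁ T₂ h₂ hne
  · rw [he] at hz; exact hz.elim
  · rw [he, Set.mem_singleton_iff] at hz
    have i₁ := Elem.weight_unique (h.1 _ h₁) hw₁ (isWeight_single hv₁) (by simpa using hz)
    have i₂ := Elem.weight_unique (h.1 _ h₂) hw₂ (isWeight_single hv₂) (by simpa [← hp] using hz)
    exact ⟨i₁.trans i₂.symm, .inl ⟨v, hv₁, hv₂, i₁⟩⟩
  · induction e with | _ x y
    rw [he, edgeHull_mk, mem_convexHull_iff_weight] at hz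
    obtain ⟨w, hw, hwp⟩ := hz
    have hs : ∀ {T : Elem d}, s(x, y) ∈ T.edges → ({x, y} : Set (Pt d)) ⊆ T.verts := by
      intro T hT v hv
      exact Elem.mem_verts_of_mem_edges hT (by simpa using hv)
    have i₁ := Elem.weight_unique (h.1 _ h₁) hw₁ (hw.mono (hs he₁)) hwp.symm
    have i₂ := Elem.weight_unique (h.1 _ h₂) hw₂ (hw.mono (hs he₂)) (hp.symm.trans hwp.symm)
    exact ⟨i₁.trans i₂.symm, .inr ⟨x, y, he₁, he₂, i₁ ▸ hw⟩⟩

theorem IsMesh.weight_unique {𝒯 : Finset (Elem d)} (h : IsMesh 𝒯) {T₁ T₂ : Elem d}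
    (h₁ : T₁ ∈ 𝒯) (h₂ : T₂ ∈ 𝒯) {w₁ w₂ : Pt d →₀ ℝ}
    (hw₁ : IsWeight T₁.verts w₁) (hw₂ : IsWeight T₂.verts w₂) (hp : point w₁ = point w₂) :
    w₁ = w₂ := by
  by_cases hne : T₁ = T₂
  · subst hne; exact Elem.weight_unique (h.1 _ h₁) hw₁ hw₂ hp
  · exact (h.weight_cases h₁ h₂ hne hw₁ hw₂ hp).1

theorem Indep.not_subset_segment {a b c x y : Pt d} (h : Indep a b c)
    (hs : ({a, b, c} : Set (Pt d)) ⊆ convexHull ℝ {x, y}) : False := by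
  have key : ∀ v ∈ ({a, b, c} : Set (Pt d)), ∃ t : ℝ, v = x + t • (y - x) := by
    intro v hv
    have := hs hv
    rw [convexHull_pair, segment_eq_image'] at this
    obtain ⟨t, -, ht⟩ := this
    exact ⟨t, ht.symm⟩
  obtain ⟨s, hs⟩ := key a (by simp)
  obtain ⟨t, ht⟩ := key b (by simp)
  obtain ⟨u, hu⟩ := key c (by simp)
  -- This is the affine relation between three points with parameters s, t, u on one line; its last
  -- coefficient yields s = t.
  have := h (t - u) (u - s) (s - t) (by ring) (by rw [hs, ht, hu]; module)
  apply h.ne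
  rw [hs, ht, show s = t by linarith [this.2.2]]

/-- Two elements of a mesh that contain a common non-degenerate triangle are equal. -/
theorem IsMesh.eq_of_hull_subset {𝒯 : Finset (Elem d)} (h : IsMesh 𝒯) {T₁ T₂ S : Elem d}
    (h₁ : T₁ ∈ 𝒯) (h₂ : T₂ ∈ 𝒯) (hS : S.Nondegenerate) (hS₁ : S.hull ⊆ T₁.hull)
    (hS₂ : S.hull ⊆ T₂.hull) : T₁ = T₂ := by
  by_contra hne
  have hs := Set.subset_inter hS₁ hS₂
  obtain ⟨a, b, hr⟩ := S.exists_ref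
  have hi := hS.indep hr
  have hv := S.verts_subset_hull
  rw [Elem.verts_eq hr] at hv
  replace hv := hv.trans hs
  obtain he | ⟨v, hv₁, hv₂, he⟩ | ⟨e, he₁, he₂, he⟩ := h.2 T₁ h₁ T₂ h₂ hne
  · rw [he] at hv; exact hv (Set.mem_insert _ _)
  · rw [he] at hv
    exact hi.ne ((hv (by simp) : a = v).trans (hv (by simp) : b = v).symm)
  · rw [he] at hv
    induction e with | _ x y
    rw [edgeHull_mk] at hv
    exact hi.not_subset_segment hv

theorem IsMesh.eq_of_verts_eq {𝒯 : Finset (Elem d)} (h : IsMesh 𝒯) {T₁ T₂ : Elem d}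
    (h₁ : T₁ ∈ 𝒯) (h₂ : T₂ ∈ 𝒯) (hv : T₁.verts = T₂.verts) : T₁ = T₂ :=
  h.eq_of_hull_subset h₁ h₂ (h.1 _ h₁) subset_rfl (by rw [Elem.hull, hv, Elem.hull])

/-- Non-degenerate triangles form a mesh if each point has the same weights in all of them. -/
theorem isMesh_of_weights {𝒯 : Finset (Elem d)} (hn : ∀ T ∈ 𝒯, T.Nondegenerate)
    (hv : ∀ T₁ ∈ 𝒯, ∀ T₂ ∈ 𝒯, T₁.verts = T₂.verts → T₁ = T₂)
    (hw : ∀ T₁ ∈ 𝒯, ∀ T₂ ∈ 𝒯, ∀ w₁ w₂, IsWeight T₁.verts w₁ → IsWeight T₂.verts w₂ →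
      point w₁ = point w₂ → w₁ = w₂) : IsMesh 𝒯 := by
  refine ⟨hn, fun T₁ h₁ T₂ h₂ hne => ?_⟩
  -- A common point has one weight function, which vanishes off the nodes of either triangle and
  -- hence lives on the common nodes.
  have hI : T₁.hull ∩ T₂.hull = convexHull ℝ (T₁.verts ∩ T₂.verts) := by
    refine Set.Subset.antisymm ?_ ?_
    · rintro z ⟨hz₁, hz₂⟩
      obtain ⟨w₁, hw₁, rfl⟩ := Elem.mem_hull_iff.1 hz₁
      obtain ⟨w₂, hw₂, hp⟩ := Elem.mem_hull_iff.1 hz₂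
      obtain rfl := hw T₁ h₁ T₂ h₂ w₁ w₂ hw₁ hw₂ hp.symm
      refine mem_convexHull_iff_weight.2 ⟨w₁, ⟨hw₁.nonneg, fun v hv => ?_, hw₁.total_eq⟩, rfl⟩
      by_cases hv₁ : v ∈ T₁.verts
      · exact hw₂.zero v fun h => hv ⟨hv₁, h⟩
      · exact hw₁.zero v hv₁
    · exact Set.subset_inter (convexHull_mono Set.inter_subset_left)
        (convexHull_mono Set.inter_subset_right)
  have hcard : ∀ T ∈ 𝒯, T.verts.ncard = 3 := by
    intro T hT
    obtain ⟨a, b, hr⟩ := T.exists_ref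
    have hi := (hn T hT).indep hr
    rw [Elem.verts_eq hr, Set.ncard_eq_three]
    exact ⟨_, _, _, hi.ne, hi.ne₁₃, hi.ne₂₃, rfl⟩
  have hfin : ∀ T ∈ 𝒯, T.verts.Finite := fun T hT =>
    Set.finite_of_ncard_ne_zero (by rw [hcard T hT]; norm_num)
  -- Three common nodes would make the node sets, and thus the elements, equal. The remaining
  -- numbers 0, 1, 2 are the three alternatives in the definition of a mesh.
  have hlt : (T₁.verts ∩ T₂.verts).ncard < 3 := by
    rw [← hcard T₁ h₁]
    refine Set.ncard_lt_ncard ⟨Set.inter_subset_left, fun hs => hne ?_⟩ (hfin T₁ h₁)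
    exact hv T₁ h₁ T₂ h₂ (Set.eq_of_subset_of_ncard_le (fun v hv => (hs hv).2)
      (by rw [hcard T₁ h₁, hcard T₂ h₂]) (hfin T₂ h₂))
  have hfinI : (T₁.verts ∩ T₂.verts).Finite := (hfin T₁ h₁).subset Set.inter_subset_left
  generalize hk : (T₁.verts ∩ T₂.verts).ncard = n at hlt
  interval_cases n
  · left
    rw [Set.ncard_eq_zero hfinI] at hk
    rw [hI, hk, convexHull_empty]
  · right; left
    obtain ⟨v, hv⟩ := Set.ncard_eq_one.1 hk
    have : v ∈ T₁.verts ∩ T₂.verts := by rw [hv]; rfl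
    exact ⟨v, this.1, this.2, by rw [hI, hv, convexHull_singleton]⟩
  · right; right
    obtain ⟨x, y, hxy, hv⟩ := Set.ncard_eq_two.1 hk
    have hx : x ∈ T₁.verts ∩ T₂.verts := by rw [hv]; simp
    have hy : y ∈ T₁.verts ∩ T₂.verts := by rw [hv]; simp
    exact ⟨s(x, y), (hn T₁ h₁).mem_edges_iff.2 ⟨hx.1, hy.1, hxy⟩,
      (hn T₂ h₂).mem_edges_iff.2 ⟨hx.2, hy.2, hxy⟩, by rw [hI, hv, edgeHull_mk]⟩

/-! ### Edges of a mesh -/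

theorem isWeight_half (x y : Pt d) :
    IsWeight {x, y} (single x (1 / 2 : ℝ) + single y (1 / 2 : ℝ)) where
  nonneg v := by
    classical
    simp only [Finsupp.coe_add, Pi.add_apply, Finsupp.single_apply]
    split_ifs <;> norm_num
  zero v hv := by
    classical
    simp only [Set.mem_insert_iff, Set.mem_singleton_iff, not_or] at hv
    simp [Ne.symm hv.1, Ne.symm hv.2]
  total_eq := by simp only [map_add, total_single]; norm_num

theorem point_half (x y : Pt d) :
    point (single x (1 / 2 : ℝ) + single y (1 / 2 : ℝ)) = midpoint ℝ x y := by
  simp only [map_add, point_single, midpoint_eq]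

/-- Positivity at both ends allows an edge to be recovered from its midpoint: any set carrying the
weights of the midpoint contains both end points. -/
theorem half_apply_pos (x y : Pt d) {v : Pt d} (hv : v ∈ s(x, y)) :
    0 < (single x (1 / 2 : ℝ) + single y (1 / 2 : ℝ)) v := by
  classical
  rw [Sym2.mem_iff] at hv
  simp only [Finsupp.coe_add, Pi.add_apply, Finsupp.single_apply]
  obtain rfl | rfl := hv
  · simp only [if_true]; split_ifs <;> norm_num
  · simp only [if_true]; split_ifs <;> norm_num

theorem pair_subset_verts {T : Elem d} {x y : Pt d} (h : s(x, y) ∈ T.edges) :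
    ({x, y} : Set (Pt d)) ⊆ T.verts := fun _ hv =>
  Elem.mem_verts_of_mem_edges h (by simpa using hv)

/-- An edge of a mesh whose midpoint lies in an element is an edge of this element. -/
theorem IsMesh.mem_edges_of_mid_mem {𝒯 : Finset (Elem d)} (h : IsMesh 𝒯) {T₁ T₂ : Elem d}
    (h₁ : T₁ ∈ 𝒯) (h₂ : T₂ ∈ 𝒯) {e : Sym2 (Pt d)} (he : e ∈ T₁.edges) (hm : mid e ∈ T₂.hull) :
    e ∈ T₂.edges := by
  induction e with | _ x y
  obtain ⟨w, hw, hp⟩ := Elem.mem_hull_iff.1 hm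
  have hu := h.weight_unique h₁ h₂ ((isWeight_half x y).mono (pair_subset_verts he)) hw
    (by rw [hp, point_half, mid_mk])
  have hmem : ∀ v ∈ s(x, y), v ∈ T₂.verts := by
    intro v hv
    by_contra hn
    have := half_apply_pos x y hv
    rw [hu, hw.zero v hn] at this
    exact this.false
  have := ((h.1 _ h₁).mem_edges_iff.1 he).2.2
  exact (h.1 _ h₂).mem_edges_iff.2 ⟨hmem _ (by simp), hmem _ (by simp), this⟩

/-- In a mesh, an edge is determined by its midpoint. -/
theorem IsMesh.eq_of_mid_eq {𝒯 : Finset (Elem d)} (h : IsMesh 𝒯) {T₁ T₂ : Elem d}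
    (h₁ : T₁ ∈ 𝒯) (h₂ : T₂ ∈ 𝒯) {e₁ e₂ : Sym2 (Pt d)} (he₁ : e₁ ∈ T₁.edges)
    (he₂ : e₂ ∈ T₂.edges) (hm : mid e₁ = mid e₂) : e₁ = e₂ := by
  induction e₁ with | _ x y
  induction e₂ with | _ x' y'
  have hu := h.weight_unique h₁ h₂ ((isWeight_half x y).mono (pair_subset_verts he₁))
    ((isWeight_half x' y').mono (pair_subset_verts he₂)) (by rwa [point_half, point_half])
  have hmem : ∀ v ∈ s(x, y), v ∈ s(x', y') := by
    intro v hv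
    by_contra hn
    have := half_apply_pos x y hv
    rw [hu, (isWeight_half x' y').zero v (by simpa using hn)] at this
    exact this.false
  have hne := ((h.1 _ h₁).mem_edges_iff.1 he₁).2.2
  exact ((Sym2.mem_and_mem_iff hne).1 ⟨hmem x (by simp), hmem y (by simp)⟩).symm

theorem Elem.Nondegenerate.edge_eq {T : Elem d} (h : T.Nondegenerate) {e e' : Sym2 (Pt d)}
    (he : e ∈ T.edges) (he' : e' ∈ T.edges) (hm : mid e ∈ edgeHull e') : e = e' := by
  induction e with | _ x y
  induction e' with | _ x' y'
  rw [edgeHull_mk] at hm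
  obtain ⟨w, hw, hp⟩ := mem_convexHull_iff_weight.1 hm
  have hu := Elem.weight_unique h ((isWeight_half x y).mono (pair_subset_verts he))
    (hw.mono (pair_subset_verts he')) (by rw [hp, point_half, mid_mk])
  have hmem : ∀ v ∈ s(x, y), v ∈ s(x', y') := by
    intro v hv
    by_contra hn
    have := half_apply_pos x y hv
    rw [hu, hw.zero v (by simpa using hn)] at this
    exact this.false
  exact ((Sym2.mem_and_mem_iff (h.mem_edges_iff.1 he).2.2).1
    ⟨hmem x (by simp), hmem y (by simp)⟩).symm

/-- Distinct elements of a mesh which share an edge meet exactly in this edge. -/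
theorem IsMesh.inter_eq {𝒯 : Finset (Elem d)} (h : IsMesh 𝒯) {T₁ T₂ : Elem d}
    (h₁ : T₁ ∈ 𝒯) (h₂ : T₂ ∈ 𝒯) (hne : T₁ ≠ T₂) {e : Sym2 (Pt d)} (he₁ : e ∈ T₁.edges)
    (he₂ : e ∈ T₂.edges) : T₁.hull ∩ T₂.hull = edgeHull e := by
  have hsub := Set.subset_inter (edgeHull_subset_hull he₁) (edgeHull_subset_hull he₂)
  obtain hI | ⟨v, -, -, hI⟩ | ⟨e', he₁', he₂', hI⟩ := h.2 T₁ h₁ T₂ h₂ hne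
  · exact (hI ▸ hsub (mid_mem_edgeHull e)).elim
  · induction e with | _ x y
    rw [hI] at hsub
    have hx : x = v := hsub (subset_convexHull ℝ _ (by simp))
    have hy : y = v := hsub (subset_convexHull ℝ _ (by simp))
    exact (((h.1 _ h₁).mem_edges_iff.1 he₁).2.2 (hx.trans hy.symm)).elim
  · rw [hI, (h.1 _ h₁).edge_eq he₁ he₁' (hI ▸ hsub (mid_mem_edgeHull e))]

/-! ### Sons -/

namespace Elem

variable {T S : Elem d} {a b : Pt d}

theorem mem_bisect (hr : T.ref = s(a, b)) :
    S ∈ T.bisect ↔ S = ⟨midpoint ℝ a b, s(a, T.apex), T.gen + 1⟩ ∨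
      S = ⟨midpoint ℝ a b, s(b, T.apex), T.gen + 1⟩ := by
  simp [bisect, hr]

theorem redEdge_eq (hr : T.ref = s(a, b)) :
    T.redEdge = s(midpoint ℝ a T.apex, midpoint ℝ b T.apex) := by
  simp [redEdge, hr]

theorem mem_redSons (hr : T.ref = s(a, b)) :
    S ∈ T.redSons ↔ S = T.upperRed ∨ S = T.lowerRed ∨
      S = ⟨midpoint ℝ a T.apex, s(a, midpoint ℝ a b), T.gen + 2⟩ ∨
      S = ⟨midpoint ℝ b T.apex, s(b, midpoint ℝ a b), T.gen + 2⟩ := by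
  simp [redSons, hr, or_assoc]

theorem hull_subset_of_verts_subset (h : S.verts ⊆ T.hull) : S.hull ⊆ T.hull :=
  convexHull_min h (convex_convexHull ℝ _)

theorem midpoint_mem_hull {x y : Pt d} (hx : x ∈ T.hull) (hy : y ∈ T.hull) :
    midpoint ℝ x y ∈ T.hull := (convex_convexHull ℝ _).midpoint_mem hx hy

theorem hull_subset_of_bisect (h : S ∈ T.bisect) : S.hull ⊆ T.hull := by
  obtain ⟨a, b, hr⟩ := T.exists_ref
  have hv := T.verts_subset_hull
  rw [verts_eq hr] at hv
  have ha : a ∈ T.hull := hv (by simp)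
  have hb : b ∈ T.hull := hv (by simp)
  have hc : T.apex ∈ T.hull := hv (by simp)
  have hK := midpoint_mem_hull ha hb
  refine hull_subset_of_verts_subset ?_
  obtain rfl | rfl := (mem_bisect hr).1 h <;> rw [verts_eq rfl] <;>
    simp [Set.insert_subset_iff, *]

theorem hull_subset_of_redSons (h : S ∈ T.redSons) : S.hull ⊆ T.hull := by
  obtain ⟨a, b, hr⟩ := T.exists_ref
  have hv := T.verts_subset_hull
  rw [verts_eq hr] at hv
  have ha : a ∈ T.hull := hv (by simp)
  have hb : b ∈ T.hull := hv (by simp)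
  have hc : T.apex ∈ T.hull := hv (by simp)
  have hK := midpoint_mem_hull ha hb
  have hQ := midpoint_mem_hull ha hc
  have hP := midpoint_mem_hull hb hc
  refine hull_subset_of_verts_subset ?_
  obtain rfl | rfl | rfl | rfl := (mem_redSons hr).1 h
  · rw [verts_eq (redEdge_eq hr)]
    simp [Set.insert_subset_iff, upperRed, *]
  · rw [verts_eq (redEdge_eq hr)]
    simp [Set.insert_subset_iff, lowerRed, *]
  all_goals
    rw [verts_eq rfl]
    simp [Set.insert_subset_iff, *]

theorem Nondegenerate.of_bisect (hT : T.Nondegenerate) (h : S ∈ T.bisect) :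
    S.Nondegenerate := by
  obtain ⟨a, b, hr⟩ := T.exists_ref
  have hi := hT.indep hr
  obtain rfl | rfl := (mem_bisect hr).1 h
  · exact nondegenerate_of_indep rfl hi.son
  · exact nondegenerate_of_indep rfl (by have := hi.swap.son; rwa [midpoint_comm] at this)

theorem Nondegenerate.of_redSons (hT : T.Nondegenerate) (h : S ∈ T.redSons) :
    S.Nondegenerate := by
  obtain ⟨a, b, hr⟩ := T.exists_ref
  have hi := hT.indep hr
  obtain rfl | rfl | rfl | rfl := (mem_redSons hr).1 h
  · exact nondegenerate_of_indep (redEdge_eq hr) hi.upper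
  · refine nondegenerate_of_indep (redEdge_eq hr) ?_
    have := hi.lower
    simpa only [lowerRed, hr, mid_mk] using this
  · exact nondegenerate_of_indep rfl (by
      intro α β γ h0 h1
      obtain ⟨h2, h3, h4⟩ := hi (α + β / 2 + γ / 2) (β / 2) (γ / 2) (by linarith)
        (by rw [← h1, midpoint_eq, midpoint_eq]; module)
      refine ⟨?_, ?_, ?_⟩ <;> linarith)
  · exact nondegenerate_of_indep rfl (by
      intro α β γ h0 h1
      obtain ⟨h2, h3, h4⟩ := hi (β / 2) (α + β / 2 + γ / 2) (γ / 2) (by linarith)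
        (by rw [← h1, midpoint_eq, midpoint_eq]; module)
      refine ⟨?_, ?_, ?_⟩ <;> linarith)

theorem mem_nvbSons {N : Set (Sym2 (Pt d))} : S ∈ T.nvbSons N ↔ (T.ref ∉ N ∧ S = T) ∨
    (T.ref ∈ N ∧ ∃ S' ∈ T.bisect, (S'.ref ∉ N ∧ S = S') ∨ (S'.ref ∈ N ∧ S ∈ S'.bisect)) :=
  Iff.rfl

theorem hull_subset_of_nvbSons {N : Set (Sym2 (Pt d))} (h : S ∈ T.nvbSons N) :
    S.hull ⊆ T.hull := by
  obtain ⟨-, rfl⟩ | ⟨-, S', hS', ⟨-, rfl⟩ | ⟨-, hS⟩⟩ := h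
  · exact subset_rfl
  · exact hull_subset_of_bisect hS'
  · exact (hull_subset_of_bisect hS).trans (hull_subset_of_bisect hS')

theorem Nondegenerate.of_nvbSons {N : Set (Sym2 (Pt d))} (hT : T.Nondegenerate)
    (h : S ∈ T.nvbSons N) : S.Nondegenerate := by
  obtain ⟨-, rfl⟩ | ⟨-, S', hS', ⟨-, rfl⟩ | ⟨-, hS⟩⟩ := h
  · exact hT
  · exact hT.of_bisect hS'
  · exact (hT.of_bisect hS').of_bisect hS

/-- Two sons of an element by bisections with the same nodes are equal. -/
theorem nvbSons_eq_of_verts_eq {N : Set (Sym2 (Pt d))} (hT : T.Nondegenerate) {S₁ S₂ : Elem d}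
    (h₁ : S₁ ∈ T.nvbSons N) (h₂ : S₂ ∈ T.nvbSons N) (hv : S₁.verts = S₂.verts) : S₁ = S₂ := by
  have key : ∀ {T : Elem d}, T.Nondegenerate → ∀ {S₁ S₂}, S₁ ∈ T.bisect → S₂ ∈ T.bisect →
      S₁.verts = S₂.verts → S₁ = S₂ := by
    intro T hT S₁ S₂ h₁ h₂ hv
    obtain ⟨a, b, hr⟩ := T.exists_ref
    have hi := hT.indep hr
    have := hi.ne; have := hi.ne₁₃; have := hi.ne₂₃
    have := hi.mid_ne_left; have := hi.mid_ne_right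
    obtain rfl | rfl := (mem_bisect hr).1 h₁ <;> obtain rfl | rfl := (mem_bisect hr).1 h₂
    · rfl
    · rw [verts_eq rfl, verts_eq rfl] at hv
      have : a ∈ ({b, T.apex, midpoint ℝ a b} : Set (Pt d)) := hv ▸ (by simp)
      clear hv
      simp_all [Ne.symm]
    · rw [verts_eq rfl, verts_eq rfl] at hv
      have : a ∈ ({b, T.apex, midpoint ℝ a b} : Set (Pt d)) := hv.symm ▸ (by simp)
      clear hv
      simp_all [Ne.symm]
    · rfl
  obtain ⟨h0, rfl⟩ | ⟨h0, A₁, hA₁, hS₁⟩ := h₁ <;> obtain ⟨h0', rfl⟩ | ⟨h0', A₂, hA₂, hS₂⟩ := h₂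
  · rfl
  · exact (h0 h0').elim
  · exact (h0' h0).elim
  suffices hA : A₁ = A₂ by
    subst hA
    obtain ⟨h3, rfl⟩ | ⟨h3, h5⟩ := hS₁ <;> obtain ⟨h4, rfl⟩ | ⟨h4, h6⟩ := hS₂
    · rfl
    · exact (h3 h4).elim
    · exact (h4 h3).elim
    · exact key (hT.of_bisect hA₁) h5 h6 hv
  -- A son inside the half at a has the node a or the midpoint of the edge from a to the apex;
  -- neither is a node of any son inside the half at b.
  have aux : ∀ {a b : Pt d}, T.ref = s(a, b) → ∀ {A₁ A₂ S₁ S₂ : Elem d},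
      A₁ = ⟨midpoint ℝ a b, s(a, T.apex), T.gen + 1⟩ →
      A₂ = ⟨midpoint ℝ a b, s(b, T.apex), T.gen + 1⟩ →
      (A₁.ref ∉ N ∧ S₁ = A₁ ∨ A₁.ref ∈ N ∧ S₁ ∈ A₁.bisect) →
      (A₂.ref ∉ N ∧ S₂ = A₂ ∨ A₂.ref ∈ N ∧ S₂ ∈ A₂.bisect) → S₁.verts = S₂.verts → False := by
    intro a b hr A₁ A₂ S₁ S₂ e₁ e₂ hS₁ hS₂ hv
    have hi := hT.indep hr
    have := hi.ne; have := hi.ne₁₃; have := hi.ne₂₃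
    have := hi.mid_ne_left; have := hi.mid_ne_right
    have := hi.swap'.mid_ne_left; have := hi.swap'.mid_ne_right; have := hi.swap'.mid_ne
    have := hi.mid_ne_mid
    have h7 := hi.swap'.swap.mid_ne_mid
    have := hi.swap.swap'.mid_ne
    rw [midpoint_comm T.apex a, midpoint_comm T.apex b] at h7
    have hv₂ : S₂.verts ⊆ {b, T.apex, midpoint ℝ a b, midpoint ℝ b T.apex} := by
      subst e₂
      obtain ⟨-, rfl⟩ | ⟨-, hS₂⟩ := hS₂
      · rw [verts_eq rfl]; simp [Set.insert_subset_iff]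
      · obtain rfl | rfl := (mem_bisect rfl).1 hS₂ <;> rw [verts_eq rfl] <;>
          simp [Set.insert_subset_iff]
    rw [← hv] at hv₂
    subst e₁
    obtain ⟨-, rfl⟩ | ⟨-, hS₁⟩ := hS₁
    · have := @hv₂ a (by rw [verts_eq rfl]; simp)
      simp_all [Ne.symm]
    · have := @hv₂ (midpoint ℝ a T.apex) (by
        obtain rfl | rfl := (mem_bisect rfl).1 hS₁ <;> rw [verts_eq rfl] <;> simp)
      simp_all [Ne.symm]
  obtain ⟨a, b, hr⟩ := T.exists_ref
  obtain e₁ | e₁ := (mem_bisect hr).1 hA₁ <;> obtain e₂ | e₂ := (mem_bisect hr).1 hA₂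
  · rw [e₁, e₂]
  · exact (aux hr e₁ e₂ hS₁ hS₂ hv).elim
  · exact (aux hr e₂ e₁ hS₂ hS₁ hv.symm).elim
  · rw [e₁, e₂]

end Elem

/-! ### Refinement by bisections preserves meshes -/

/-- The weights after the bisection of the edge `xy`, in terms of those before. -/
noncomputable def split (x y : Pt d) (u : Pt d →₀ ℝ) : Pt d →₀ ℝ :=
  u + min (u x) (u y) • ((2 : ℝ) • single (midpoint ℝ x y) (1 : ℝ) - single x 1 - single y 1)

theorem split_comm (x y : Pt d) (u : Pt d →₀ ℝ) : split x y u = split y x u := by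
  rw [split, split, min_comm, midpoint_comm, sub_right_comm]

/-- Only points with positive weight at both ends of an edge notice its bisection. This makes most
factors in `refineWeight` trivial. -/
theorem split_eq_self_left {x y : Pt d} {u : Pt d →₀ ℝ} (hn : ∀ v, 0 ≤ u v) (h : u x = 0) :
    split x y u = u := by
  rw [split, h, min_eq_left (hn y), zero_smul, add_zero]

open Classical in
/-- `split` for marked edges. -/
noncomputable def splitIf (N : Set (Sym2 (Pt d))) (x y : Pt d) (u : Pt d →₀ ℝ) : Pt d →₀ ℝ :=
  if s(x, y) ∈ N then split x y u else u

theorem splitIf_comm (N : Set (Sym2 (Pt d))) (x y : Pt d) (u : Pt d →₀ ℝ) :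
    splitIf N x y u = splitIf N y x u := by
  rw [splitIf, splitIf, split_comm, Sym2.eq_swap]

theorem splitIf_eq_self_left {N : Set (Sym2 (Pt d))} {x y : Pt d} {u : Pt d →₀ ℝ}
    (hn : ∀ v, 0 ≤ u v) (h : u x = 0) : splitIf N x y u = u := by
  rw [splitIf, split_eq_self_left hn h, ite_self]

theorem splitIf_eq_self_right {N : Set (Sym2 (Pt d))} {x y : Pt d} {u : Pt d →₀ ℝ}
    (hn : ∀ v, 0 ≤ u v) (h : u y = 0) : splitIf N x y u = u := by
  rw [splitIf_comm, splitIf_eq_self_left hn h]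

theorem splitIf_nonneg {N : Set (Sym2 (Pt d))} {x y : Pt d} (hxy : x ≠ y) {u : Pt d →₀ ℝ}
    (hn : ∀ v, 0 ≤ u v) (v : Pt d) : 0 ≤ splitIf N x y u v := by
  classical
  rw [splitIf]
  split_ifs
  · have h1 := hn v
    have h2 : 0 ≤ min (u x) (u y) := le_min (hn x) (hn y)
    have h3 : x = v → min (u x) (u y) ≤ u v := by rintro rfl; exact min_le_left _ _
    have h4 : y = v → min (u x) (u y) ≤ u v := by rintro rfl; exact min_le_right _ _
    have h5 : ¬ (x = v ∧ y = v) := fun h => hxy (h.1.trans h.2.symm)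
    simp only [split, Finsupp.coe_add, Pi.add_apply, Finsupp.coe_smul, Pi.smul_apply,
      Finsupp.coe_sub, Pi.sub_apply, Finsupp.single_apply, smul_eq_mul]
    generalize min (u x) (u y) = μ at *
    by_cases hx : x = v
    · have hy : ¬ y = v := fun hy => h5 ⟨hx, hy⟩
      have := h3 hx
      simp only [hx, hy, if_true, if_false]
      split_ifs <;> linarith
    · by_cases hy : y = v
      · have := h4 hy
        simp only [hx, hy, if_true, if_false]
        split_ifs <;> linarith
      · simp only [hx, hy, if_false]
        split_ifs <;> linarith
  · exact hn v

theorem splitIf_apply_of_ne {N : Set (Sym2 (Pt d))} {x y v : Pt d} {u : Pt d →₀ ℝ}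
    (hx : x ≠ v) (hy : y ≠ v) (hm : midpoint ℝ x y ≠ v) : splitIf N x y u v = u v := by
  classical
  rw [splitIf]
  split_ifs
  · simp [split, hx, hy, hm]
  · rfl

/-- Weights in a son of a bisection come from weights in the father. -/
theorem Indep.exists_weight_father {a b c : Pt d} (h : Indep a b c) {w : Pt d →₀ ℝ}
    (hw : IsWeight {a, c, midpoint ℝ a b} w) :
    ∃ u, IsWeight {a, b, c} u ∧ point u = point w ∧ split a b u = w := by
  classical
  set K := midpoint ℝ a b with hK
  have hab := h.ne; have hac := h.ne₁₃; have hbc := h.ne₂₃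
  have hKa := h.mid_ne_left; have hKb := h.mid_ne_right; have hKc := h.mid_ne
  rw [← hK] at hKa hKb hKc
  have hb : w b = 0 := hw.zero b (by simp [hab.symm, hbc, hKb.symm])
  set u : Pt d →₀ ℝ := w + w K • (single a (1 / 2 : ℝ) + single b (1 / 2 : ℝ) - single K 1)
    with hu
  have ua : u a = w a + w K / 2 := by
    simp [hu, hab.symm, hKa, div_eq_mul_inv]
  have ub : u b = w K / 2 := by
    simp [hu, hab, hKb, hb, div_eq_mul_inv]
  have uK : u K = 0 := by
    simp [hu, hKa.symm, hKb.symm]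
  have uv : ∀ v, v ≠ a → v ≠ b → v ≠ K → u v = w v := fun v h1 h2 h3 => by
    simp [hu, h1.symm, h2.symm, h3.symm]
  refine ⟨u, ⟨fun v => ?_, fun v hv => ?_, ?_⟩, ?_, ?_⟩
  · have := hw.nonneg v; have := hw.nonneg K; have := hw.nonneg a
    by_cases h1 : v = a
    · rw [h1, ua]; positivity
    by_cases h2 : v = b
    · rw [h2, ub]; positivity
    by_cases h3 : v = K
    · rw [h3, uK]
    rwa [uv v h1 h2 h3]
  · simp only [Set.mem_insert_iff, Set.mem_singleton_iff, not_or] at hv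
    by_cases h3 : v = K
    · rw [h3, uK]
    rw [uv v hv.1 hv.2.1 h3]
    exact hw.zero v (by simp [hv, h3])
  · have : total (single a (1 / 2 : ℝ) + single b (1 / 2 : ℝ) - single K 1) = 0 := by
      simp only [map_add, map_sub, total_single]; norm_num
    rw [hu, map_add, map_smul, this, hw.total_eq]; simp
  · have : point (single a (1 / 2 : ℝ) + single b (1 / 2 : ℝ) - single K 1) = 0 := by
      simp only [map_add, map_sub, point_single, hK, midpoint_eq]; module
    rw [hu, map_add, map_smul, this]; simp
  · have hmin : min (u a) (u b) = w K / 2 := by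
      rw [ua, ub]; exact min_eq_right (by linarith [hw.nonneg a])
    have hs : ∀ v : Pt d, single v (1 / 2 : ℝ) = (1 / 2 : ℝ) • single v (1 : ℝ) := by simp
    rw [split, hmin, hu, hs a, hs b, ← hK]
    module

/-- The weights after the refinement by bisections of a triangle, in terms of those before. -/
noncomputable def refineWeight (N : Set (Sym2 (Pt d))) (a b c : Pt d) (u : Pt d →₀ ℝ) :
    Pt d →₀ ℝ :=
  splitIf N b c (splitIf N a c (splitIf N a b u))

/-- Splitting ab removes the whole weight of a or of b, so one of the two later splittings is
trivial and their order is irrelevant. Hence the formula does not depend on the order of the ends of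
the reference edge. -/
theorem Indep.refineWeight_swap {N : Set (Sym2 (Pt d))} {a b c : Pt d} (h : Indep a b c)
    {u : Pt d →₀ ℝ} (hu : IsWeight {a, b, c} u) (hab : s(a, b) ∈ N) :
    refineWeight N a b c u = refineWeight N b a c u := by
  classical
  have key : ∀ {a b : Pt d}, Indep a b c → IsWeight {a, b, c} u → u a ≤ u b →
      s(a, b) ∈ N → refineWeight N a b c u = splitIf N b c (splitIf N a b u) ∧
        refineWeight N b a c u = splitIf N b c (splitIf N a b u) := by
    intro a b h hu hle hab
    have hn := splitIf_nonneg (N := N) h.ne hu.nonneg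
    have h0 : splitIf N a b u a = 0 := by
      rw [splitIf, if_pos hab, split, min_eq_left hle]
      simp [h.mid_ne_left, h.ne.symm]
    constructor
    · rw [refineWeight, splitIf_eq_self_left hn h0]
    · rw [refineWeight, splitIf_comm N b a]
      refine splitIf_eq_self_left (splitIf_nonneg h.ne₂₃ hn) ?_
      rw [splitIf_apply_of_ne h.ne.symm h.ne₁₃.symm h.swap.swap'.mid_ne, h0]
  rcases le_total (u a) (u b) with hle | hle
  · obtain ⟨h1, h2⟩ := key h hu hle hab
    rw [h1, h2]
  · obtain ⟨h1, h2⟩ := key h.swap (by rwa [Set.insert_comm]) hle (by rwa [Sym2.eq_swap])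
    rw [h1, h2]

/-- The bisections are undone one at a time. The formula giving the new weights from the old ones is
the same for all sons, so uniqueness of weights passes from the fathers to the sons. -/
theorem exists_weight_of_nvbSons {N : Set (Sym2 (Pt d))} {T S : Elem d} {a b : Pt d}
    (hT : T.Nondegenerate) (hr : T.ref = s(a, b))
    (hN : ∀ e ∈ T.edges, e ∈ N → T.ref ∈ N) (hS : S ∈ T.nvbSons N) {w : Pt d →₀ ℝ}
    (hw : IsWeight S.verts w) :
    ∃ u, IsWeight T.verts u ∧ point u = point w ∧ refineWeight N a b T.apex u = w := by
  classical
  have main : ∀ {a b : Pt d}, T.ref = s(a, b) → ∀ {S'}, T.ref ∈ N →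
      S' = ⟨midpoint ℝ a b, s(a, T.apex), T.gen + 1⟩ →
      (S'.ref ∉ N ∧ S = S' ∨ S'.ref ∈ N ∧ S ∈ S'.bisect) →
      ∃ u, IsWeight T.verts u ∧ point u = point w ∧ refineWeight N a b T.apex u = w := by
    intro a b hr S' hm hS' hS
    have hi := hT.indep hr
    have hmab : s(a, b) ∈ N := hr ▸ hm
    rw [Elem.verts_eq hr]
    -- the father of the two grandsons
    have hw' : ∃ w', IsWeight S'.verts w' ∧ point w' = point w ∧
        splitIf N a T.apex w' = w ∧ w b = 0 := by
      subst hS'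
      obtain ⟨h0, rfl⟩ | ⟨h0, hS⟩ := hS
      · refine ⟨w, hw, rfl, by rw [splitIf, if_neg h0], hw.zero b ?_⟩
        rw [Elem.verts_eq rfl]
        simp [hi.ne.symm, hi.ne₂₃, hi.mid_ne_right.symm]
      · obtain rfl | rfl := (Elem.mem_bisect rfl).1 hS
        · rw [Elem.verts_eq rfl] at hw
          dsimp only at hw
          obtain ⟨u, hu, hp, hs⟩ := hi.son.exists_weight_father hw
          refine ⟨u, by rwa [Elem.verts_eq rfl], hp, by rw [splitIf, if_pos h0, hs],
            hw.zero b ?_⟩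
          simp [hi.ne.symm, hi.mid_ne_right.symm, hi.swap'.mid_ne.symm]
        · rw [Elem.verts_eq rfl] at hw
          dsimp only at hw
          rw [midpoint_comm a T.apex] at hw
          obtain ⟨u, hu, hp, hs⟩ := hi.son.swap.exists_weight_father hw
          refine ⟨u, by rwa [Elem.verts_eq rfl, Set.insert_comm], hp,
            by rw [splitIf, if_pos h0, split_comm, hs], hw.zero b ?_⟩
          have := hi.swap'.mid_ne.symm
          rw [midpoint_comm] at this
          simp [hi.ne₂₃, hi.mid_ne_right.symm, this]
    obtain ⟨w', hw', hp', hs', hb⟩ := hw'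
    rw [Elem.verts_eq (by rw [hS'])] at hw'
    obtain ⟨u, hu, hp, hs⟩ := hi.exists_weight_father (w := w') (by rwa [hS'] at hw')
    refine ⟨u, hu, hp.trans hp', ?_⟩
    have e : splitIf N a b u = w' := by rw [splitIf, if_pos hmab, hs]
    rw [refineWeight, e, hs']
    -- A son in the half at a gives no weight to b, so the splitting of the edge from b to the apex
    -- has no effect.
    exact splitIf_eq_self_left hw.nonneg hb
  obtain ⟨h0, rfl⟩ | ⟨h0, S', hS', hS⟩ := hS
  · refine ⟨w, hw, rfl, ?_⟩
    -- By closedness an unmarked reference edge means that no edge is marked, and all three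
    -- splittings are trivial.
    have hno : ∀ e ∈ S.edges, e ∉ N := fun e he hm => h0 (hN e he hm)
    rw [Elem.edges_eq hr] at hno
    rw [refineWeight, splitIf, splitIf, splitIf, if_neg (hno _ (by simp)),
      if_neg (hno _ (by simp)), if_neg (hno _ (by simp))]
  · obtain e | e := (Elem.mem_bisect hr).1 hS'
    · exact main hr h0 e hS
    · obtain ⟨u, hu, hp, hs⟩ := main (hr.trans Sym2.eq_swap) h0
        (by rw [e, midpoint_comm]) hS
      refine ⟨u, hu, hp, ?_⟩
      rw [(hT.indep hr).refineWeight_swap (by rwa [Elem.verts_eq hr] at hu) (hr ▸ h0), hs]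

theorem refineWeight_single {N : Set (Sym2 (Pt d))} {a b c v : Pt d} (h : Indep a b c) :
    refineWeight N a b c (single v 1) = single v 1 := by
  classical
  have key : ∀ {x y : Pt d}, x ≠ y → splitIf N x y (single v (1 : ℝ)) = single v 1 := by
    intro x y hxy
    have hn : ∀ u, 0 ≤ (single v (1 : ℝ)) u := (isWeight_single (Set.mem_singleton v)).nonneg
    by_cases hx : v = x
    · exact splitIf_eq_self_right hn (Finsupp.single_eq_of_ne (by rw [hx]; exact hxy.symm))
    · exact splitIf_eq_self_left hn (Finsupp.single_eq_of_ne (Ne.symm hx))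
  rw [refineWeight, key h.ne, key h.ne₁₃, key h.ne₂₃]

/-- Weights on one edge are changed only by the bisection of that edge. The result depends on the
edge alone, so two neighbours compute the same weights on their common edge. -/
theorem refineWeight_edge {N : Set (Sym2 (Pt d))} {T : Elem d} {a b x y : Pt d}
    (hT : T.Nondegenerate) (hr : T.ref = s(a, b)) (he : s(x, y) ∈ T.edges) {u : Pt d →₀ ℝ}
    (hu : IsWeight {x, y} u) : refineWeight N a b T.apex u = splitIf N x y u := by
  have hi := hT.indep hr
  have h12 := hi.ne; have h13 := hi.ne₁₃; have h23 := hi.ne₂₃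
  have hn := hu.nonneg
  have case₁ : IsWeight {a, b} u →
      refineWeight N a b T.apex u = splitIf N a b u := fun hu => by
    have hc : splitIf N a b u T.apex = 0 := by
      rw [splitIf_apply_of_ne h13 h23 hi.mid_ne]
      exact hu.zero _ (by simp [h13.symm, h23.symm])
    have hn' := splitIf_nonneg (N := N) h12 hn
    rw [refineWeight, splitIf_eq_self_right hn' hc, splitIf_eq_self_right hn' hc]
  have case₂ : IsWeight {a, T.apex} u →
      refineWeight N a b T.apex u = splitIf N a T.apex u := fun hu => by
    have hb : u b = 0 := hu.zero _ (by simp [h12.symm, h23])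
    rw [refineWeight, splitIf_eq_self_right hn hb]
    refine splitIf_eq_self_left (splitIf_nonneg h13 hn) ?_
    rw [splitIf_apply_of_ne h12 h23.symm hi.swap'.mid_ne, hb]
  have case₃ : IsWeight {b, T.apex} u →
      refineWeight N a b T.apex u = splitIf N b T.apex u := fun hu => by
    have ha : u a = 0 := hu.zero _ (by simp [h12, h13])
    rw [refineWeight, splitIf_eq_self_left hn ha, splitIf_eq_self_left hn ha]
  rw [Elem.edges_eq hr] at he
  have hp : ∀ {p q : Pt d}, s(x, y) = s(p, q) → IsWeight {p, q} u ∧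
      splitIf N x y u = splitIf N p q u := by
    intro p q h
    obtain ⟨rfl, rfl⟩ | ⟨rfl, rfl⟩ := Sym2.eq_iff.1 h
    · exact ⟨hu, rfl⟩
    · exact ⟨by rwa [Set.pair_comm], splitIf_comm ..⟩
  obtain h | h | h := he
  · rw [case₁ (hp h).1, (hp h).2]
  · rw [case₂ (hp h).1, (hp h).2]
  · rw [case₃ (hp h).1, (hp h).2]

/-- Refinement by bisections preserves meshes if the set of marked edges is closed. -/
theorem IsMesh.nvbSons {𝒯 𝒯' : Finset (Elem d)} {N : Set (Sym2 (Pt d))} (h : IsMesh 𝒯)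
    (hN : ∀ T ∈ 𝒯, ∀ e ∈ T.edges, e ∈ N → T.ref ∈ N)
    (h' : ∀ S, S ∈ 𝒯' ↔ ∃ T ∈ 𝒯, S ∈ T.nvbSons N) : IsMesh 𝒯' := by
  have hnd : ∀ S ∈ 𝒯', S.Nondegenerate := fun S hS => by
    obtain ⟨T, hT, hS⟩ := (h' S).1 hS
    exact (h.1 T hT).of_nvbSons hS
  refine isMesh_of_weights hnd ?_ ?_
  · intro S₁ hS₁ S₂ hS₂ hv
    have hn := hnd _ hS₁
    obtain ⟨T₁, hT₁, hS₁⟩ := (h' _).1 hS₁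
    obtain ⟨T₂, hT₂, hS₂⟩ := (h' _).1 hS₂
    obtain rfl := h.eq_of_hull_subset hT₁ hT₂ hn (Elem.hull_subset_of_nvbSons hS₁)
      (by rw [Elem.hull, hv]; exact Elem.hull_subset_of_nvbSons hS₂)
    exact Elem.nvbSons_eq_of_verts_eq (h.1 _ hT₁) hS₁ hS₂ hv
  · intro S₁ hS₁ S₂ hS₂ w₁ w₂ hw₁ hw₂ hp
    obtain ⟨T₁, hT₁, hS₁⟩ := (h' _).1 hS₁
    obtain ⟨T₂, hT₂, hS₂⟩ := (h' _).1 hS₂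
    obtain ⟨a₁, b₁, hr₁⟩ := T₁.exists_ref
    obtain ⟨u₁, hu₁, hp₁, rfl⟩ := exists_weight_of_nvbSons (h.1 _ hT₁) hr₁ (hN _ hT₁) hS₁ hw₁
    by_cases hne : T₁ = T₂
    · subst hne
      obtain ⟨u₂, hu₂, hp₂, rfl⟩ :=
        exists_weight_of_nvbSons (h.1 _ hT₁) hr₁ (hN _ hT₁) hS₂ hw₂
      rw [h.weight_unique hT₁ hT₁ hu₁ hu₂ (by rw [hp₁, hp, hp₂])]
    · obtain ⟨a₂, b₂, hr₂⟩ := T₂.exists_ref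
      obtain ⟨u₂, hu₂, hp₂, rfl⟩ :=
        exists_weight_of_nvbSons (h.1 _ hT₂) hr₂ (hN _ hT₂) hS₂ hw₂
      obtain ⟨rfl, ⟨v, -, -, rfl⟩ | ⟨x, y, he₁, he₂, hw⟩⟩ :=
        h.weight_cases hT₁ hT₂ hne hu₁ hu₂ (by rw [hp₁, hp, hp₂])
      · rw [refineWeight_single ((h.1 _ hT₁).indep hr₁),
          refineWeight_single ((h.1 _ hT₂).indep hr₂)]
      · rw [refineWeight_edge (h.1 _ hT₁) hr₁ he₁ hw, refineWeight_edge (h.1 _ hT₂) hr₂ he₂ hw]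

/-! ### Wings and red-sons: the two diagonals of a parallelogram -/

namespace Elem

/-- The edge from the apex to the midpoint of the reference edge. -/
noncomputable def diag (F : Elem d) : Sym2 (Pt d) := s(F.apex, mid F.ref)

/-- The grandson by bisections with the edge `diag` on the side of the node `x` of `ref`. -/
noncomputable def wing (F : Elem d) (x : Pt d) : Elem d :=
  ⟨midpoint ℝ x F.apex, F.diag, F.gen + 2⟩

/-- The two grandsons by bisections with the edge `diag`. -/
def wings (F : Elem d) : Set (Elem d) := {S | ∃ x ∈ F.ref, S = F.wing x}

/-- The two red-sons. -/
def reds (F : Elem d) : Set (Elem d) := {F.upperRed, F.lowerRed}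

variable {F T S : Elem d} {a b : Pt d}

theorem diag_eq (hr : F.ref = s(a, b)) : F.diag = s(F.apex, midpoint ℝ a b) := by
  rw [diag, hr, mid_mk]

theorem mem_wings (hr : F.ref = s(a, b)) : S ∈ F.wings ↔ S = F.wing a ∨ S = F.wing b := by
  simp [wings, hr]

theorem verts_wing (hr : F.ref = s(a, b)) (x : Pt d) :
    (F.wing x).verts = {F.apex, midpoint ℝ a b, midpoint ℝ x F.apex} :=
  verts_eq (diag_eq hr)

theorem ref_of_reds (h : T ∈ F.reds) : T.ref = F.redEdge := by
  obtain rfl | rfl := h <;> rfl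

theorem gen_of_reds (h : T ∈ F.reds) : T.gen = F.gen + 2 := by
  obtain rfl | rfl := h <;> rfl

theorem apex_of_reds (h : T ∈ F.reds) : T.apex = F.apex ∨ T.apex = mid F.ref := by
  obtain rfl | rfl := h
  · exact .inl rfl
  · exact .inr rfl

theorem reds_subset_redSons : F.reds ⊆ F.redSons := Set.subset_union_left

theorem verts_of_reds (hr : F.ref = s(a, b)) (h : T ∈ F.reds) :
    T.verts = {midpoint ℝ a F.apex, midpoint ℝ b F.apex, T.apex} :=
  verts_eq ((ref_of_reds h).trans (redEdge_eq hr))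

/-- The diagonals of a parallelogram bisect each other. This makes the sons of the red-sons equal to
those of the wings, and it keeps the two diagonals from being edges of one mesh. -/
theorem mid_redEdge (F : Elem d) : mid F.redEdge = mid F.diag := by
  obtain ⟨a, b, hr⟩ := F.exists_ref
  rw [redEdge_eq hr, diag_eq hr]
  simp only [mid_mk, midpoint_eq]
  module

/-- The four nodes of the parallelogram are distinct. -/
theorem Nondegenerate.quad_ne (h : F.Nondegenerate) (hr : F.ref = s(a, b)) :
    midpoint ℝ a b ≠ F.apex ∧ midpoint ℝ a F.apex ≠ F.apex ∧ midpoint ℝ b F.apex ≠ F.apex ∧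
      midpoint ℝ a F.apex ≠ midpoint ℝ a b ∧ midpoint ℝ b F.apex ≠ midpoint ℝ a b ∧
      midpoint ℝ a F.apex ≠ midpoint ℝ b F.apex := by
  have hi := h.indep hr
  have h1 := hi.swap.mid_ne_mid
  have h2 := hi.swap'.swap.mid_ne_mid
  rw [midpoint_comm b a] at h1
  rw [midpoint_comm F.apex a, midpoint_comm F.apex b] at h2
  exact ⟨hi.mid_ne, hi.swap'.mid_ne_right, hi.swap.swap'.mid_ne_right, hi.mid_ne_mid.symm,
    h1.symm, h2⟩

theorem Nondegenerate.diag_ne_redEdge (h : F.Nondegenerate) : F.redEdge ≠ F.diag := by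
  obtain ⟨a, b, hr⟩ := F.exists_ref
  obtain ⟨h1, h2, h3, h4, h5, h6⟩ := h.quad_ne hr
  rw [redEdge_eq hr, diag_eq hr]
  intro he
  obtain ⟨h, -⟩ | ⟨h, -⟩ := Sym2.eq_iff.1 he
  · exact h2 h
  · exact h4 h

theorem Nondegenerate.of_reds (h : F.Nondegenerate) (hT : T ∈ F.reds) : T.Nondegenerate :=
  h.of_redSons (reds_subset_redSons hT)

/-- An edge of a red-son other than the reference edge belongs to one of the wings. -/
theorem side_edge (hT : T ∈ F.reds) {e : Sym2 (Pt d)} (he : e ∈ T.edges)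
    (hne : e ≠ F.redEdge) : ∃ x ∈ F.ref, e = s(midpoint ℝ x F.apex, T.apex) := by
  obtain ⟨a, b, hr⟩ := F.exists_ref
  rw [edges_eq ((ref_of_reds hT).trans (redEdge_eq hr)), ← redEdge_eq hr] at he
  obtain rfl | rfl | rfl := he
  · exact (hne rfl).elim
  · exact ⟨a, by simp [hr], rfl⟩
  · exact ⟨b, by simp [hr], rfl⟩

theorem side_edge_mem_wing (hT : T ∈ F.reds) (x : Pt d) :
    s(midpoint ℝ x F.apex, T.apex) ∈ (F.wing x).edges := by
  rw [edges_eq (T := F.wing x) (a := F.apex) (b := mid F.ref) rfl]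
  obtain h | h := apex_of_reds hT <;> rw [h] <;> simp [wing, Sym2.eq_swap]

theorem diag_mem_edges_of_wings (h : T ∈ F.wings) : F.diag ∈ T.edges := by
  obtain ⟨x, -, rfl⟩ := h
  exact ref_mem_edges _

theorem redEdge_mem_edges_of_reds (h : T ∈ F.reds) : F.redEdge ∈ T.edges :=
  ref_of_reds h ▸ ref_mem_edges _

end Elem

/-- `𝒯` is obtained from the mesh `𝒯'` by the replacement of the wings of each element of `P` by
its red-sons. -/
structure IsFlip (𝒯 𝒯' : Finset (Elem d)) (P : Set (Elem d)) : Prop where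
  mesh : IsMesh 𝒯'
  nondegenerate : ∀ F ∈ P, F.Nondegenerate
  wings_subset : ∀ F ∈ P, F.wings ⊆ 𝒯'
  eq_of_wings : ∀ F ∈ P, ∀ F' ∈ P, ∀ T ∈ F.wings, T ∈ F'.wings → F = F'
  mem_wings : ∀ F ∈ P, ∀ T ∈ 𝒯', F.diag ∈ T.edges → T ∈ F.wings
  mem_iff : ∀ S, S ∈ 𝒯 ↔ (S ∈ 𝒯' ∧ ∀ F ∈ P, S ∉ F.wings) ∨ ∃ F ∈ P, S ∈ F.reds

/-- The weights after the replacement of the diagonal `ts` of a parallelogram by the diagonal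
`pq`, in terms of those before. -/
noncomputable def flipWeight (t s p q : Pt d) (u : Pt d →₀ ℝ) : Pt d →₀ ℝ :=
  u + min (u t) (u s) • (single p (1 : ℝ) + single q 1 - single t 1 - single s 1)

theorem flipWeight_comm (t s p q : Pt d) (u : Pt d →₀ ℝ) :
    flipWeight t s p q u = flipWeight s t p q u := by
  rw [flipWeight, flipWeight, min_comm, sub_right_comm]

theorem flipWeight_comm' (t s p q : Pt d) (u : Pt d →₀ ℝ) :
    flipWeight t s p q u = flipWeight t s q p u := by
  rw [flipWeight, flipWeight, add_comm (single p (1 : ℝ))]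

/-- Since p + q = t + s, the smaller weight `w p` can be moved from p and q to t and s without
changing the point. Afterwards p carries nothing, so the point lies in the triangle tsq. As s had no
weight before, the minimum of the new weights at t and s is again `w p`, and `flipWeight` reverses
the move. -/
theorem exists_weight_before_flip {t s p q : Pt d} (hts : t ≠ s) (htp : p ≠ t) (htq : q ≠ t)
    (hsp : p ≠ s) (hsq : q ≠ s) (hpq : p ≠ q) (hm : midpoint ℝ p q = midpoint ℝ t s)
    {w : Pt d →₀ ℝ} (hw : IsWeight {p, q, t} w) (hle : w p ≤ w q) :
    ∃ u, IsWeight {t, s, q} u ∧ point u = point w ∧ flipWeight t s p q u = w := by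
  classical
  have hs : w s = 0 := hw.zero s (by simp [hts.symm, hsp.symm, hsq.symm])
  set u : Pt d →₀ ℝ := w - w p • (single p (1 : ℝ) + single q 1 - single t 1 - single s 1)
    with hu
  have ut : u t = w t + w p := by simp [hu, hts, htp, htq, Ne.symm]
  have us : u s = w p := by simp [hu, hts, hsp, hsq, hs, Ne.symm]
  have up : u p = 0 := by simp [hu, hpq, htp, hsp]
  have uq : u q = w q - w p := by simp [hu, hpq, htq, hsq, Ne.symm]
  have uv : ∀ v, v ≠ t → v ≠ s → v ≠ p → v ≠ q → u v = w v := fun v h1 h2 h3 h4 => by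
    simp [hu, h1, h2, h3, h4]
  refine ⟨u, ⟨fun v => ?_, fun v hv => ?_, ?_⟩, ?_, ?_⟩
  · have := hw.nonneg v; have := hw.nonneg p; have := hw.nonneg t
    by_cases h1 : v = t
    · rw [h1, ut]; positivity
    by_cases h2 : v = s
    · rwa [h2, us]
    by_cases h3 : v = p
    · rw [h3, up]
    by_cases h4 : v = q
    · rw [h4, uq]; linarith
    rwa [uv v h1 h2 h3 h4]
  · simp only [Set.mem_insert_iff, Set.mem_singleton_iff, not_or] at hv
    by_cases h3 : v = p
    · rw [h3, up]
    rw [uv v hv.1 hv.2.1 h3 hv.2.2]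
    exact hw.zero v (by simp [hv, h3])
  · rw [hu, map_sub, map_smul, hw.total_eq]; simp
  · have h1 : p + q - t - s = 0 := by
      rw [midpoint_eq, midpoint_eq] at hm
      have : (2 : ℝ) • ((1 / 2 : ℝ) • p + (1 / 2 : ℝ) • q)
        - (2 : ℝ) • ((1 / 2 : ℝ) • t + (1 / 2 : ℝ) • s) = 0 := by rw [hm, sub_self]
      rw [← this]; module
    rw [hu, map_sub, map_smul]; simp [h1]
  · have hmin : min (u t) (u s) = w p := by
      rw [ut, us]; exact min_eq_right (by linarith [hw.nonneg t])
    rw [flipWeight, hmin, hu, sub_add_cancel]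

/-- A point of a red-son lies in the wing at the end of the diagonal QP where its weight is larger.
-/
theorem Elem.exists_weight_of_reds {F T : Elem d} {a b : Pt d} (hF : F.Nondegenerate)
    (hr : F.ref = s(a, b)) (hT : T ∈ F.reds) {w : Pt d →₀ ℝ} (hw : IsWeight T.verts w) :
    ∃ S ∈ F.wings, ∃ u, IsWeight S.verts u ∧ point u = point w ∧
      flipWeight F.apex (midpoint ℝ a b) (midpoint ℝ a F.apex) (midpoint ℝ b F.apex) u = w := by
  have main : ∀ {a b : Pt d}, F.ref = s(a, b) →
      w (midpoint ℝ a F.apex) ≤ w (midpoint ℝ b F.apex) →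
      ∃ S ∈ F.wings, ∃ u, IsWeight S.verts u ∧ point u = point w ∧
        flipWeight F.apex (midpoint ℝ a b) (midpoint ℝ a F.apex) (midpoint ℝ b F.apex) u = w := by
    intro a b hr hle
    obtain ⟨h1, h2, h3, h4, h5, h6⟩ := hF.quad_ne hr
    have hm := F.mid_redEdge
    rw [redEdge_eq hr, diag_eq hr, mid_mk, mid_mk] at hm
    rw [verts_of_reds hr hT] at hw
    refine ⟨F.wing b, (mem_wings hr).2 (.inr rfl), ?_⟩
    rw [verts_wing hr]
    obtain h | h := apex_of_reds hT <;> rw [h] at hw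
    · exact exists_weight_before_flip h1.symm h2 h3 h4 h5 h6 hm hw hle
    · rw [hr, mid_mk] at hw
      rw [midpoint_comm F.apex] at hm
      obtain ⟨u, hu, hp, hf⟩ := exists_weight_before_flip h1 h4 h5 h2 h3 h6 hm hw hle
      exact ⟨u, by rwa [Set.insert_comm], hp, by rw [flipWeight_comm, hf]⟩
  rcases le_total (w (midpoint ℝ a F.apex)) (w (midpoint ℝ b F.apex)) with hle | hle
  · exact main hr hle
  · obtain ⟨S, hS, u, hu, hp, hf⟩ := main (hr.trans Sym2.eq_swap) hle
    exact ⟨S, hS, u, hu, hp, by rw [flipWeight_comm', midpoint_comm a b, hf]⟩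

/-! ### Flips preserve meshes -/

namespace IsFlip

variable {𝒯 𝒯' : Finset (Elem d)} {P : Set (Elem d)} {F F' T : Elem d}

theorem reds_subset (h : IsFlip 𝒯 𝒯' P) (hF : F ∈ P) : F.reds ⊆ 𝒯 := fun _ hT =>
  (h.mem_iff _).2 (.inr ⟨F, hF, hT⟩)

/-- The other diagonal is an edge of `𝒯'` with the same midpoint, and in a mesh the midpoint
determines the edge. -/
theorem redEdge_notMem_edges (h : IsFlip 𝒯 𝒯' P) (hF : F ∈ P) (hT : T ∈ 𝒯') :
    F.redEdge ∉ T.edges := by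
  intro he
  obtain ⟨a, b, hr⟩ := F.exists_ref
  have hw : F.wing a ∈ F.wings := (Elem.mem_wings hr).2 (.inl rfl)
  exact (h.nondegenerate F hF).diag_ne_redEdge
    (h.mesh.eq_of_mid_eq hT (h.wings_subset F hF hw) he (Elem.ref_mem_edges _) F.mid_redEdge)

theorem notMem_of_reds (h : IsFlip 𝒯 𝒯' P) (hF : F ∈ P) (hT : T ∈ F.reds) : T ∉ 𝒯' :=
  fun hT' => h.redEdge_notMem_edges hF hT' (Elem.redEdge_mem_edges_of_reds hT)

theorem notMem_of_wings (h : IsFlip 𝒯 𝒯' P) (hF : F ∈ P) (hT : T ∈ F.wings) : T ∉ 𝒯 := by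
  intro hT'
  obtain ⟨-, h1⟩ | ⟨F', hF', h1⟩ := (h.mem_iff T).1 hT'
  · exact h1 F hF hT
  · exact h.notMem_of_reds hF' h1 (h.wings_subset F hF hT)

theorem eq_of_diag_eq (h : IsFlip 𝒯 𝒯' P) (hF : F ∈ P) (hF' : F' ∈ P)
    (he : F.diag = F'.diag) : F = F' := by
  obtain ⟨a, b, hr⟩ := F.exists_ref
  have hw : F.wing a ∈ F.wings := (Elem.mem_wings hr).2 (.inl rfl)
  refine h.eq_of_wings F hF F' hF' _ hw (h.mem_wings F' hF' _ (h.wings_subset F hF hw) ?_)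
  rw [← he]; exact Elem.ref_mem_edges _

theorem eq_of_redEdge_eq (h : IsFlip 𝒯 𝒯' P) (hF : F ∈ P) (hF' : F' ∈ P)
    (he : F.redEdge = F'.redEdge) : F = F' := by
  obtain ⟨a, b, hr⟩ := F.exists_ref
  obtain ⟨a', b', hr'⟩ := F'.exists_ref
  refine h.eq_of_diag_eq hF hF' (h.mesh.eq_of_mid_eq
    (h.wings_subset F hF ((Elem.mem_wings hr).2 (.inl rfl)))
    (h.wings_subset F' hF' ((Elem.mem_wings hr').2 (.inl rfl)))
    (Elem.ref_mem_edges _) (Elem.ref_mem_edges _) ?_)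
  rw [← F.mid_redEdge, ← F'.mid_redEdge, he]

theorem eq_of_reds (h : IsFlip 𝒯 𝒯' P) (hF : F ∈ P) (hF' : F' ∈ P) (hT : T ∈ F.reds)
    (hT' : T ∈ F'.reds) : F = F' :=
  h.eq_of_redEdge_eq hF hF' ((Elem.ref_of_reds hT).symm.trans (Elem.ref_of_reds hT'))

theorem side_ne_redEdge (h : IsFlip 𝒯 𝒯' P) (hF : F ∈ P) (hF' : F' ∈ P) (hT : T ∈ F.reds)
    {x : Pt d} (hx : x ∈ F.ref) : s(midpoint ℝ x F.apex, T.apex) ≠ F'.redEdge := fun he =>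
  h.redEdge_notMem_edges hF' (h.wings_subset F hF ⟨x, hx, rfl⟩)
    (he ▸ Elem.side_edge_mem_wing hT x)

/-- The red-sons are the only elements that contain their common reference edge. -/
theorem mem_reds (h : IsFlip 𝒯 𝒯' P) (hF : F ∈ P) (hT : T ∈ 𝒯) (he : F.redEdge ∈ T.edges) :
    T ∈ F.reds := by
  obtain ⟨h1, -⟩ | ⟨F', hF', h1⟩ := (h.mem_iff T).1 hT
  · exact (h.redEdge_notMem_edges hF h1 he).elim
  · by_cases h2 : F.redEdge = F'.redEdge
    · rwa [h.eq_of_redEdge_eq hF hF' h2]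
    · obtain ⟨x, hx, h3⟩ := Elem.side_edge h1 he h2
      exact (h.side_ne_redEdge hF' hF h1 hx h3.symm).elim

/-- An element other than the wings cannot contain both ends of the diagonal, for then the diagonal
would be one of its edges. Hence one of the two weights is zero and nothing is moved. -/
theorem flipWeight_eq_self (h : IsFlip 𝒯 𝒯' P) (hF : F ∈ P) {a b : Pt d}
    (hr : F.ref = s(a, b)) (hT : T ∈ 𝒯') (hTF : T ∉ F.wings) {u : Pt d →₀ ℝ}
    (hu : IsWeight T.verts u) (p q : Pt d) : flipWeight F.apex (midpoint ℝ a b) p q u = u := by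
  have h0 : min (u F.apex) (u (midpoint ℝ a b)) = 0 := by
    by_cases h1 : F.apex ∈ T.verts
    · by_cases h2 : midpoint ℝ a b ∈ T.verts
      · refine (hTF (h.mem_wings F hF T hT ?_)).elim
        rw [Elem.diag_eq hr, (h.mesh.1 T hT).mem_edges_iff]
        exact ⟨h1, h2, ((h.nondegenerate F hF).quad_ne hr).1.symm⟩
      · rw [hu.zero _ h2]; exact min_eq_right (hu.nonneg _)
    · rw [hu.zero _ h1]; exact min_eq_left (hu.nonneg _)
  rw [flipWeight, h0, zero_smul, add_zero]

/-- The mesh after the flips is a mesh. -/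
theorem isMesh (h : IsFlip 𝒯 𝒯' P) : IsMesh 𝒯 := by
  have hnd : ∀ T ∈ 𝒯, T.Nondegenerate := by
    intro T hT
    obtain ⟨h1, -⟩ | ⟨F, hF, h1⟩ := (h.mem_iff T).1 hT
    · exact h.mesh.1 T h1
    · exact (h.nondegenerate F hF).of_reds h1
  -- Equal nodes give `S` the edge QP, so `S` is a red-son of the same `F`; the two red-sons are
  -- told apart by the node c.
  have hred : ∀ {F T S : Elem d}, F ∈ P → T ∈ F.reds → S ∈ 𝒯 → T.verts = S.verts → T = S := by
    intro F T S hF hT hS hv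
    obtain ⟨a, b, hr⟩ := F.exists_ref
    have hFn := h.nondegenerate F hF
    obtain ⟨h1, h2, h3, h4, h5, h6⟩ := hFn.quad_ne hr
    have hS' : S ∈ F.reds := by
      refine h.mem_reds hF hS ?_
      have := Elem.redEdge_mem_edges_of_reds hT
      rw [Elem.redEdge_eq hr] at this ⊢
      rw [(hFn.of_reds hT).mem_edges_iff] at this
      rwa [(hnd S hS).mem_edges_iff, ← hv]
    have hap : ∀ {S T : Elem d}, S = F.upperRed → T = F.lowerRed → S.verts = T.verts → False := by
      rintro _ _ rfl rfl hv
      rw [Elem.verts_of_reds hr (by simp [Elem.reds]),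
        Elem.verts_of_reds hr (by simp [Elem.reds])] at hv
      have := hv.subset (show F.apex ∈ _ by simp [Elem.upperRed])
      simp [Elem.lowerRed, hr, h1.symm, h2.symm, h3.symm] at this
    obtain e | e := hT <;> obtain e' | e' := hS'
    · rw [e, e']
    · exact (hap e e' hv).elim
    · exact (hap e' e hv.symm).elim
    · rw [e, e']
  refine isMesh_of_weights hnd ?_ ?_
  · intro T₁ hT₁ T₂ hT₂ hv
    obtain ⟨h1, -⟩ | ⟨F, hF, h1⟩ := (h.mem_iff T₁).1 hT₁
    · obtain ⟨h2, -⟩ | ⟨F, hF, h2⟩ := (h.mem_iff T₂).1 hT₂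
      · exact h.mesh.eq_of_verts_eq h1 h2 hv
      · exact (hred hF h2 hT₁ hv.symm).symm
    · exact hred hF h1 hT₂ hv
  · intro T₁ hT₁ T₂ hT₂ w₁ w₂ hw₁ hw₂ hp
    obtain ⟨h1, h1'⟩ | ⟨F₁, hF₁, h1⟩ := (h.mem_iff T₁).1 hT₁ <;>
      obtain ⟨h2, h2'⟩ | ⟨F₂, hF₂, h2⟩ := (h.mem_iff T₂).1 hT₂
    · exact h.mesh.weight_unique h1 h2 hw₁ hw₂ hp
    · obtain ⟨a, b, hr⟩ := F₂.exists_ref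
      obtain ⟨S, hS, u, hu, hup, rfl⟩ :=
        Elem.exists_weight_of_reds (h.nondegenerate _ hF₂) hr h2 hw₂
      obtain rfl := h.mesh.weight_unique h1 (h.wings_subset _ hF₂ hS) hw₁ hu (hp.trans hup.symm)
      rw [h.flipWeight_eq_self hF₂ hr h1 (h1' _ hF₂) hw₁]
    · obtain ⟨a, b, hr⟩ := F₁.exists_ref
      obtain ⟨S, hS, u, hu, hup, rfl⟩ :=
        Elem.exists_weight_of_reds (h.nondegenerate _ hF₁) hr h1 hw₁
      obtain rfl := h.mesh.weight_unique (h.wings_subset _ hF₁ hS) h2 hu hw₂ (hup.trans hp)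
      rw [h.flipWeight_eq_self hF₁ hr h2 (h2' _ hF₁) hw₂]
    · obtain ⟨a, b, hr⟩ := F₁.exists_ref
      obtain ⟨S₁, hS₁, u₁, hu₁, hup₁, rfl⟩ :=
        Elem.exists_weight_of_reds (h.nondegenerate _ hF₁) hr h1 hw₁
      have hS₁' := h.wings_subset _ hF₁ hS₁
      by_cases hF : F₁ = F₂
      · subst hF
        obtain ⟨S₂, hS₂, u₂, hu₂, hup₂, rfl⟩ :=
          Elem.exists_weight_of_reds (h.nondegenerate _ hF₁) hr h2 hw₂
        rw [h.mesh.weight_unique hS₁' (h.wings_subset _ hF₁ hS₂) hu₁ hu₂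
          (by rw [hup₁, hp, hup₂])]
      · obtain ⟨a', b', hr'⟩ := F₂.exists_ref
        obtain ⟨S₂, hS₂, u₂, hu₂, hup₂, rfl⟩ :=
          Elem.exists_weight_of_reds (h.nondegenerate _ hF₂) hr' h2 hw₂
        have hS₂' := h.wings_subset _ hF₂ hS₂
        obtain rfl := h.mesh.weight_unique hS₁' hS₂' hu₁ hu₂ (by rw [hup₁, hp, hup₂])
        -- The common weights live on a wing of `F₁`, which is no wing of `F₂`, and vice versa; so
        -- both flips leave them unchanged.
        rw [h.flipWeight_eq_self hF₂ hr' hS₁'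
            (fun hw => hF (h.eq_of_wings _ hF₁ _ hF₂ _ hS₁ hw)) hu₁,
          h.flipWeight_eq_self hF₁ hr hS₂'
            (fun hw => hF (h.eq_of_wings _ hF₁ _ hF₂ _ hw hS₂)) hu₂]

end IsFlip

/-! ### Successors -/

namespace Elem

variable {F T S A : Elem d}

theorem Successor.hull_subset (h : T.Successor S) : S.hull ⊆ T.hull := by
  induction h with
  | refl => exact subset_rfl
  | tail _ h ih =>
    obtain h | h := h
    · exact (hull_subset_of_bisect h).trans ih
    · exact (hull_subset_of_redSons h).trans ih

theorem Successor.trans (h : T.Successor S) (h' : S.Successor A) : T.Successor A :=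
  Relation.ReflTransGen.trans h h'

theorem successor_of_bisect (h : S ∈ T.bisect) : T.Successor S :=
  Relation.ReflTransGen.single (.inl h)

theorem successor_of_redSons (h : S ∈ T.redSons) : T.Successor S :=
  Relation.ReflTransGen.single (.inr h)

theorem successor_of_nvbSons {N : Set (Sym2 (Pt d))} (h : S ∈ T.nvbSons N) :
    T.Successor S := by
  obtain ⟨-, rfl⟩ | ⟨-, S', hS', ⟨-, rfl⟩ | ⟨-, hS⟩⟩ := h
  · exact .refl
  · exact successor_of_bisect hS'
  · exact (successor_of_bisect hS').trans (successor_of_bisect hS)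

theorem successor_of_wings (h : S ∈ F.wings) : F.Successor S := by
  obtain ⟨x, hx, rfl⟩ := h
  refine (successor_of_bisect (S := ⟨mid F.ref, s(x, F.apex), F.gen + 1⟩) ⟨x, hx, rfl⟩).trans
    (successor_of_bisect ⟨F.apex, by simp, ?_⟩)
  rw [wing, diag]; rfl

/-! ### Areas and levels of successors -/

theorem gram_half {E : Type*} [NormedAddCommGroup E] [InnerProductSpace ℝ E] (u v : E)
    (α β γ δ : ℝ) :
    ‖α • u + β • v‖ ^ 2 * ‖γ • u + δ • v‖ ^ 2
        - (inner ℝ (α • u + β • v) (γ • u + δ • v)) ^ 2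
      = (α * δ - β * γ) ^ 2 * (‖u‖ ^ 2 * ‖v‖ ^ 2 - (inner ℝ u v) ^ 2) := by
  simp only [← real_inner_self_eq_norm_sq, inner_add_left, inner_add_right, real_inner_smul_left,
    real_inner_smul_right, real_inner_comm v u]
  ring

theorem area_eq {a b : Pt d} (hr : T.ref = s(a, b)) :
    T.area = 1 / 2 * Real.sqrt (‖a - T.apex‖ ^ 2 * ‖b - T.apex‖ ^ 2
      - (inner ℝ (a - T.apex) (b - T.apex)) ^ 2) := by
  rw [area, hr]; rfl

/-- The area of a triangle whose sides are given in terms of those of another one. -/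
theorem area_eq_mul {a b x y : Pt d} (hr : T.ref = s(a, b)) (hr' : S.ref = s(x, y))
    (α β γ δ r : ℝ) (hx : x - S.apex = α • (a - T.apex) + β • (b - T.apex))
    (hy : y - S.apex = γ • (a - T.apex) + δ • (b - T.apex)) (h0 : 0 ≤ r)
    (hdet : (α * δ - β * γ) ^ 2 = r ^ 2) : S.area = r * T.area := by
  rw [area_eq hr, area_eq hr', hx, hy, gram_half, hdet, Real.sqrt_mul (sq_nonneg r),
    Real.sqrt_sq h0]
  ring

/-- A bisection halves the area and raises the level by one; a red-refinement quarters it and raises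
the level by two. Consequently, successors of one element with equal levels have equal areas. -/
theorem IsSon.area_mul (h : T.IsSon S) : S.area * 2 ^ S.gen = T.area * 2 ^ T.gen := by
  obtain ⟨a, b, hr⟩ := T.exists_ref
  obtain h | h := h
  · obtain rfl | rfl := (mem_bisect hr).1 h
    · rw [area_eq_mul hr rfl (1 / 2) (-1 / 2) (-1 / 2) (-1 / 2) (1 / 2)
        (by rw [midpoint_eq]; module) (by rw [midpoint_eq]; module) (by norm_num) (by norm_num),
        pow_succ]
      ring
    · rw [area_eq_mul hr rfl (-1 / 2) (1 / 2) (-1 / 2) (-1 / 2) (1 / 2)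
        (by rw [midpoint_eq]; module) (by rw [midpoint_eq]; module) (by norm_num) (by norm_num),
        pow_succ]
      ring
  · obtain rfl | rfl | rfl | rfl := (mem_redSons hr).1 h
    · rw [area_eq_mul (S := T.upperRed) hr (redEdge_eq hr) (1 / 2) 0 0 (1 / 2) (1 / 4)
        (by simp only [upperRed, midpoint_eq]; module)
        (by simp only [upperRed, midpoint_eq]; module) (by norm_num) (by norm_num)]
      simp only [upperRed, pow_succ]
      ring
    · rw [area_eq_mul (S := T.lowerRed) hr (redEdge_eq hr) 0 (-1 / 2) (-1 / 2) 0 (1 / 4)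
        (by simp only [lowerRed, hr, mid_mk, midpoint_eq]; module)
        (by simp only [lowerRed, hr, mid_mk, midpoint_eq]; module) (by norm_num) (by norm_num)]
      simp only [lowerRed, pow_succ]
      ring
    · rw [area_eq_mul hr rfl (1 / 2) 0 0 (1 / 2) (1 / 4)
        (by simp only [midpoint_eq]; module) (by simp only [midpoint_eq]; module)
        (by norm_num) (by norm_num)]
      simp only [pow_succ]
      ring
    · rw [area_eq_mul hr rfl 0 (1 / 2) (1 / 2) 0 (1 / 4)
        (by simp only [midpoint_eq]; module) (by simp only [midpoint_eq]; module)
        (by norm_num) (by norm_num)]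
      simp only [pow_succ]
      ring

theorem Successor.area_mul (h : T.Successor S) :
    S.area * 2 ^ S.gen = T.area * 2 ^ T.gen := by
  induction h with
  | refl => rfl
  | tail _ h ih => exact (IsSon.area_mul h).trans ih

theorem IsSon.gen_lt (h : T.IsSon S) : T.gen < S.gen := by
  obtain ⟨a, b, hr⟩ := T.exists_ref
  obtain h | h := h
  · obtain rfl | rfl := (mem_bisect hr).1 h <;> simp
  · obtain rfl | rfl | rfl | rfl := (mem_redSons hr).1 h <;> simp [upperRed, lowerRed]

theorem Successor.gen_lt_or_eq (h : T.Successor S) : T.gen < S.gen ∨ T = S := by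
  induction h with
  | refl => exact .inr rfl
  | tail _ h ih =>
    have := IsSon.gen_lt h
    obtain ih | rfl := ih
    · exact .inl (ih.trans this)
    · exact .inl this

end Elem

/-! ### A criterion for corresponding meshes -/

/-- Distinct elements of a mesh with a common edge meet exactly there, and a triangle does not meet
itself in a segment. This turns the geometric conditions on pairs into combinatorial ones. -/
theorem IsMesh.linked_iff {𝒯 : Finset (Elem d)} (h : IsMesh 𝒯) {φ ψ : Flag d}
    (hφ : φ ∈ flags 𝒯) (hψ : ψ ∈ flags 𝒯) : Linked φ ψ ↔ φ.2 = ψ.2 ∧ φ ≠ ψ := by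
  constructor
  · rintro ⟨h1, h2⟩
    refine ⟨h1, ?_⟩
    rintro rfl
    obtain ⟨a, b, hr⟩ := φ.1.exists_ref
    have hi := (h.1 _ hφ.1).indep hr
    have hv := φ.1.verts_subset_hull
    rw [Set.inter_self] at h2
    rw [Elem.verts_eq hr, h2] at hv
    generalize φ.2 = e at hv
    induction e with | _ x y
    rw [edgeHull_mk] at hv
    exact hi.not_subset_segment hv
  · rintro ⟨h1, h2⟩
    exact ⟨h1, h.inter_eq hφ.1 hψ.1 (fun he => h2 (Prod.ext he h1)) hφ.2 (h1 ▸ hψ.2)⟩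

theorem IsMesh.linked_compatible_iff {𝒯 : Finset (Elem d)} (h : IsMesh 𝒯) {φ ψ : Flag d}
    (hφ : φ ∈ flags 𝒯) (hψ : ψ ∈ flags 𝒯) :
    Linked φ ψ ∧ CompatiblyDivisible φ.1 ψ.1 ↔
      (φ.2 = ψ.2 ∧ φ ≠ ψ) ∧ (φ.2 = φ.1.ref ↔ ψ.2 = ψ.1.ref) := by
  rw [← h.linked_iff hφ hψ]
  refine and_congr_right fun hl => ?_
  constructor
  · rintro ⟨e, he₁, he₂, hI, hc⟩
    obtain rfl : e = φ.2 := (h.1 _ hφ.1).edge_eq he₁ hφ.2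
      (hl.2 ▸ hI ▸ mid_mem_edgeHull e)
    rw [← hl.1]
    obtain ⟨h1, h2⟩ | ⟨h1, h2⟩ := hc
    · simp [h1, h2]
    · simp [h1.symm, h2.symm]
  · intro hc
    refine ⟨φ.2, hφ.2, hl.1 ▸ hψ.2, hl.2, ?_⟩
    rw [← hl.1] at hc
    by_cases h1 : φ.2 = φ.1.ref
    · exact .inl ⟨h1.symm, (hc.1 h1).symm⟩
    · exact .inr ⟨Ne.symm h1, fun h2 => h1 (hc.2 h2.symm)⟩

theorem mk_ref_mem_flags {𝒯 : Finset (Elem d)} {φ : Flag d} (h : φ ∈ flags 𝒯) :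
    (φ.1, φ.1.ref) ∈ flags 𝒯 := ⟨h.1, Elem.ref_mem_edges _⟩

/-- A bijection of the flags which is induced by an injective map of the edges on the second
components, and which preserves levels and ancestors, exhibits corresponding meshes. -/
theorem isCorr_of_edge_map {𝒯₀ 𝒯 𝒯' : Finset (Elem d)} {corr : Flag d → Flag d}
    {ε : Sym2 (Pt d) → Sym2 (Pt d)} (h₀ : IsMesh 𝒯₀)
    (h : IsMesh 𝒯) (h' : IsMesh 𝒯') (hbij : Set.BijOn corr (flags 𝒯) (flags 𝒯'))
    (hε : ∀ φ ∈ flags 𝒯, (corr φ).2 = ε φ.2)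
    (hinj : ∀ φ ∈ flags 𝒯, ∀ ψ ∈ flags 𝒯, ε φ.2 = ε ψ.2 → φ.2 = ψ.2)
    (href : ∀ φ ∈ flags 𝒯, (corr φ).1.ref = ε φ.1.ref)
    (hgen : ∀ φ ∈ flags 𝒯, φ.1.gen = (corr φ).1.gen)
    (hanc : ∀ φ ∈ flags 𝒯, ∃ A ∈ 𝒯₀, A.Successor φ.1 ∧ A.Successor (corr φ).1) :
    IsCorr 1 𝒯₀ 𝒯 𝒯' corr := by
  have hedge : ∀ φ ∈ flags 𝒯, ∀ ψ ∈ flags 𝒯, (corr φ).2 = (corr ψ).2 ↔ φ.2 = ψ.2 := by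
    intro φ hφ ψ hψ
    rw [hε φ hφ, hε ψ hψ]
    exact ⟨hinj φ hφ ψ hψ, fun h => by rw [h]⟩
  have hrefedge : ∀ φ ∈ flags 𝒯, ∀ ψ ∈ flags 𝒯,
      ((corr ψ).2 = (corr φ).1.ref ↔ ψ.2 = φ.1.ref) := by
    intro φ hφ ψ hψ
    rw [hε ψ hψ, href φ hφ]
    exact ⟨hinj ψ hψ _ (mk_ref_mem_flags hφ), fun h => by rw [h]⟩
  have hne : ∀ φ ∈ flags 𝒯, ∀ ψ ∈ flags 𝒯, (corr φ ≠ corr ψ ↔ φ ≠ ψ) := fun φ hφ ψ hψ =>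
    (hbij.injOn.eq_iff hφ hψ).not
  have hlink : ∀ φ ∈ flags 𝒯, ∀ ψ ∈ flags 𝒯, Linked (corr φ) (corr ψ) ↔ Linked φ ψ := by
    intro φ hφ ψ hψ
    rw [h'.linked_iff (hbij.mapsTo hφ) (hbij.mapsTo hψ), h.linked_iff hφ hψ,
      hedge φ hφ ψ hψ, hne φ hφ ψ hψ]
  -- A triangle lies in only one element of the initial mesh, so the common ancestor `B` is the only
  -- possible one for both elements.
  have hanc' : ∀ φ ∈ flags 𝒯, ∀ A ∈ 𝒯₀, A.Successor (corr φ).1 ↔ A.Successor φ.1 := by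
    intro φ hφ A hA
    obtain ⟨B, hB, h1, h2⟩ := hanc φ hφ
    constructor
    · intro h3
      rwa [h₀.eq_of_hull_subset hA hB (h'.1 _ (hbij.mapsTo hφ).1) h3.hull_subset h2.hull_subset]
    · intro h3
      rwa [h₀.eq_of_hull_subset hA hB (h.1 _ hφ.1) h3.hull_subset h1.hull_subset]
  have harea : ∀ φ ∈ flags 𝒯, φ.1.area = (corr φ).1.area := by
    intro φ hφ
    obtain ⟨A, -, h1, h2⟩ := hanc φ hφ
    have h3 := h1.area_mul.trans h2.area_mul.symm
    rw [hgen φ hφ] at h3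
    exact mul_right_cancel₀ (by positivity) h3
  refine ⟨hbij, fun φ hφ => ?_, hgen, hlink, fun φ hφ => hrefedge φ hφ φ hφ, ?_, ?_, ?_, ?_, ?_⟩
  · rw [harea φ hφ, one_mul]; exact ⟨le_rfl, le_rfl⟩
  · intro φ hφ ψ hψ
    have key : ∀ {𝒮 : Finset (Elem d)} {φ ψ : Flag d}, φ ∈ flags 𝒮 → ψ ∈ flags 𝒮 →
        ((φ.2 = ψ.2 ∧ ψ.2 = φ.1.ref ∧ IsRefNeighbour 𝒮 φ.1 ψ.1) ↔
          (φ.2 = ψ.2 ∧ ψ.2 = φ.1.ref ∧ φ ≠ ψ)) := by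
      intro 𝒮 φ ψ hφ hψ
      refine and_congr_right fun h1 => and_congr_right fun h2 => ?_
      constructor
      · rintro ⟨-, h3, -⟩ rfl; exact h3 rfl
      · exact fun h3 => ⟨hψ.1, fun h4 => h3 (Prod.ext h4.symm h1), h2 ▸ hψ.2⟩
    rw [key hφ hψ, key (hbij.mapsTo hφ) (hbij.mapsTo hψ), hedge φ hφ ψ hψ, hrefedge φ hφ ψ hψ,
      hne φ hφ ψ hψ]
  · intro φ hφ ψ hψ
    rw [h'.linked_compatible_iff (hbij.mapsTo hφ) (hbij.mapsTo hψ),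
      h.linked_compatible_iff hφ hψ, hedge φ hφ ψ hψ, hrefedge φ hφ φ hφ, hrefedge ψ hψ ψ hψ,
      hne φ hφ ψ hψ]
  · intro φ hφ ψ hψ A hA
    rw [hlink φ hφ ψ hψ, hanc' φ hφ A hA, hanc' ψ hψ A hA]
  · intro φ hφ ψ hψ h1 h2
    rw [href ψ hψ, hε ψ hψ, href φ hφ, h1, h2]
    exact ⟨rfl, rfl⟩
  · intro φ hφ ψ hψ h1 h2
    have h3 : ψ.2 = φ.1.ref := (hrefedge φ hφ ψ hψ).1 h2
    refine ⟨((hrefedge ψ hψ ψ hψ).1 (by rw [h1, h2])).symm, h3⟩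

/-- A bijection of flags which preserves reference edges yields as many elements. -/
theorem IsCorr.card_eq {C : ℝ} {𝒯₀ 𝒯 𝒯' : Finset (Elem d)} {corr : Flag d → Flag d}
    (h : IsCorr C 𝒯₀ 𝒯 𝒯' corr) : 𝒯'.card = 𝒯.card := by
  have hmem : ∀ T ∈ 𝒯, (T, T.ref) ∈ flags 𝒯 := fun T hT => ⟨hT, T.ref_mem_edges⟩
  symm
  refine Finset.card_bij (fun T _ => (corr (T, T.ref)).1) (fun T hT => ?_) ?_ ?_
  · exact (h.bijOn.mapsTo (hmem T hT)).1
  · intro T₁ h₁ T₂ h₂ he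
    have e₁ := (h.ref_edge _ (hmem T₁ h₁)).2 rfl
    have e₂ := (h.ref_edge _ (hmem T₂ h₂)).2 rfl
    exact congrArg Prod.fst (h.bijOn.injOn (hmem T₁ h₁) (hmem T₂ h₂)
      (Prod.ext he (by rw [e₁, e₂, he])))
  · intro T' hT'
    obtain ⟨φ, hφ, he⟩ := h.bijOn.surjOn (show (T', T'.ref) ∈ flags 𝒯' from
      ⟨hT', T'.ref_mem_edges⟩)
    have e : φ.2 = φ.1.ref := (h.ref_edge φ hφ).1 (by rw [he])
    exact ⟨φ.1, hφ.1, by rw [← e]; exact congrArg Prod.fst he⟩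

/-! ### The correspondence -/

open Classical in
/-- The map of the edges: the reference edges of the red-sons are mapped to the other diagonal. -/
noncomputable def flipEdge (P : Set (Elem d)) (e : Sym2 (Pt d)) : Sym2 (Pt d) :=
  if h : ∃ F ∈ P, e = F.redEdge then h.choose.diag else e

open Classical in
/-- The map of the flags: those of the red-sons are mapped to those of the wings. -/
noncomputable def flipCorr (P : Set (Elem d)) (φ : Flag d) : Flag d :=
  if h : ∃ F ∈ P, φ.1 ∈ F.reds then
    if φ.2 = h.choose.redEdge then
      (h.choose.wing (if φ.1 = h.choose.upperRed then (Quot.out h.choose.ref).1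
        else (Quot.out h.choose.ref).2), h.choose.diag)
    else
      (h.choose.wing (if φ.2 = s(midpoint ℝ (Quot.out h.choose.ref).1 h.choose.apex, φ.1.apex)
        then (Quot.out h.choose.ref).1 else (Quot.out h.choose.ref).2), φ.2)
  else φ

theorem ref_eq_out (F : Elem d) : F.ref = s((Quot.out F.ref).1, (Quot.out F.ref).2) :=
  (Quot.out_eq F.ref).symm

theorem midpoint_left_inj {x y z : Pt d} : midpoint ℝ x z = midpoint ℝ y z ↔ x = y := by
  constructor
  · intro h
    rw [midpoint_eq, midpoint_eq, add_left_inj] at h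
    exact smul_right_injective _ (by norm_num : (1 / 2 : ℝ) ≠ 0) h
  · rintro rfl; rfl

theorem Elem.wing_inj {F : Elem d} {x y : Pt d} : F.wing x = F.wing y ↔ x = y := by
  constructor
  · intro h
    exact midpoint_left_inj.1 (congrArg Elem.apex h)
  · rintro rfl; rfl

namespace IsFlip

variable {𝒯 𝒯' : Finset (Elem d)} {P : Set (Elem d)} {F T : Elem d}

theorem flipEdge_redEdge (h : IsFlip 𝒯 𝒯' P) (hF : F ∈ P) :
    flipEdge P F.redEdge = F.diag := by
  have hex : ∃ F' ∈ P, F.redEdge = F'.redEdge := ⟨F, hF, rfl⟩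
  rw [flipEdge, dif_pos hex, ← h.eq_of_redEdge_eq hF hex.choose_spec.1 hex.choose_spec.2]

theorem flipEdge_of_ne {e : Sym2 (Pt d)} (h : ∀ F ∈ P, e ≠ F.redEdge) : flipEdge P e = e := by
  rw [flipEdge, dif_neg]
  rintro ⟨F, hF, he⟩
  exact h F hF he

theorem flipEdge_of_mem (h : IsFlip 𝒯 𝒯' P) (hT : T ∈ 𝒯') {e : Sym2 (Pt d)} (he : e ∈ T.edges) :
    flipEdge P e = e :=
  flipEdge_of_ne fun _ hF h' => h.redEdge_notMem_edges hF hT (h' ▸ he)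

theorem flipCorr_of_notMem {φ : Flag d} (h : ∀ F ∈ P, φ.1 ∉ F.reds) : flipCorr P φ = φ := by
  rw [flipCorr, dif_neg]
  rintro ⟨F, hF, he⟩
  exact h F hF he

theorem flipCorr_of_mem (h : IsFlip 𝒯 𝒯' P) (hT : T ∈ 𝒯') (e : Sym2 (Pt d)) :
    flipCorr P (T, e) = (T, e) :=
  flipCorr_of_notMem fun _ hF hr => h.notMem_of_reds hF hr hT

-- Which red-son uses which wing here is a free choice; only the two wings must be different. The
-- choice follows the arbitrary order of the ends in `Quot.out`, hence the two possible orders in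
-- `RedSonRule`.
open Classical in
theorem flipCorr_redEdge (h : IsFlip 𝒯 𝒯' P) (hF : F ∈ P) (hT : T ∈ F.reds) :
    flipCorr P (T, F.redEdge) = (F.wing (if T = F.upperRed then (Quot.out F.ref).1
      else (Quot.out F.ref).2), F.diag) := by
  have hex : ∃ F' ∈ P, ((T, F.redEdge) : Flag d).1 ∈ F'.reds := ⟨F, hF, hT⟩
  have hc : hex.choose = F := h.eq_of_reds hex.choose_spec.1 hF hex.choose_spec.2 hT
  rw [flipCorr, dif_pos hex, hc, if_pos rfl]

/-- The sides of the parallelogram survive the flip. Each lies in one red-son and in one wing, so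
the edge stays and only the element is exchanged. -/
theorem flipCorr_side (h : IsFlip 𝒯 𝒯' P) (hF : F ∈ P) (hT : T ∈ F.reds) {x : Pt d}
    (hx : x ∈ F.ref) : flipCorr P (T, s(midpoint ℝ x F.apex, T.apex)) =
      (F.wing x, s(midpoint ℝ x F.apex, T.apex)) := by
  have hex : ∃ F' ∈ P, ((T, s(midpoint ℝ x F.apex, T.apex)) : Flag d).1 ∈ F'.reds :=
    ⟨F, hF, hT⟩
  have hc : hex.choose = F := h.eq_of_reds hex.choose_spec.1 hF hex.choose_spec.2 hT
  rw [flipCorr, dif_pos hex, hc, if_neg (h.side_ne_redEdge hF hF hT hx)]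
  congr 2
  simp only [Sym2.congr_left, midpoint_left_inj]
  rw [ref_eq_out F, Sym2.mem_iff] at hx
  split_ifs with h1
  · exact h1.symm
  · exact (hx.resolve_left h1).symm

/-- The three kinds of flags: those of common elements, those of the red-sons with an edge of a
wing, and those of the red-sons with their reference edge. -/
theorem flag_cases (h : IsFlip 𝒯 𝒯' P) {φ : Flag d} (hφ : φ ∈ flags 𝒯) :
    (φ ∈ flags 𝒯' ∧ (∀ F ∈ P, φ.1 ∉ F.wings) ∧ flipCorr P φ = φ ∧ flipEdge P φ.2 = φ.2) ∨
    (∃ F ∈ P, φ.1 ∈ F.reds ∧ ∃ x ∈ F.ref, φ.2 = s(midpoint ℝ x F.apex, φ.1.apex) ∧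
      flipCorr P φ = (F.wing x, φ.2) ∧ flipEdge P φ.2 = φ.2) ∨
    (∃ F ∈ P, φ.1 ∈ F.reds ∧ φ.2 = F.redEdge ∧ (∃ x ∈ F.ref, flipCorr P φ = (F.wing x, F.diag)) ∧
      flipEdge P φ.2 = F.diag) := by
  obtain ⟨T, e⟩ := φ
  obtain ⟨hT, he⟩ := hφ
  dsimp only at hT he ⊢
  obtain ⟨h1, h2⟩ | ⟨F, hF, h1⟩ := (h.mem_iff T).1 hT
  · exact .inl ⟨⟨h1, he⟩, h2, h.flipCorr_of_mem h1 e, h.flipEdge_of_mem h1 he⟩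
  · right
    by_cases h2 : e = F.redEdge
    · right
      subst h2
      refine ⟨F, hF, h1, rfl, ⟨_, ?_, h.flipCorr_redEdge hF h1⟩, h.flipEdge_redEdge hF⟩
      split_ifs
      · exact Sym2.out_fst_mem _
      · exact Sym2.out_snd_mem _
    · left
      obtain ⟨x, hx, rfl⟩ := Elem.side_edge h1 he h2
      exact ⟨F, hF, h1, x, hx, rfl, h.flipCorr_side hF h1 hx,
        flipEdge_of_ne fun F' hF' => h.side_ne_redEdge hF hF' h1 hx⟩

theorem flipCorr_snd (h : IsFlip 𝒯 𝒯' P) {φ : Flag d} (hφ : φ ∈ flags 𝒯) :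
    (flipCorr P φ).2 = flipEdge P φ.2 := by
  obtain ⟨-, -, h1, h2⟩ | ⟨F, hF, -, x, hx, -, h1, h2⟩ | ⟨F, hF, -, -, ⟨x, hx, h1⟩, h2⟩ :=
    h.flag_cases hφ <;> rw [h1, h2]

theorem flipEdge_ref (h : IsFlip 𝒯 𝒯' P) {φ : Flag d} (hφ : φ ∈ flags 𝒯) :
    (flipCorr P φ).1.ref = flipEdge P φ.1.ref := by
  obtain ⟨h0, -, h1, -⟩ | ⟨F, hF, h3, x, hx, -, h1, h2⟩ | ⟨F, hF, h3, -, ⟨x, hx, h1⟩, h2⟩ :=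
    h.flag_cases hφ
  · rw [h1, h.flipEdge_of_mem h0.1 (Elem.ref_mem_edges _)]
  all_goals rw [h1, Elem.ref_of_reds h3, h.flipEdge_redEdge hF]; rfl

/-- The diagonal cK is no edge of `𝒯` itself. A common element with this edge would be a wing; a
side of some parallelogram equal to cK would make a wing of that one a wing of `F`, so it would be a
side of the same parallelogram, and such a side ends in Q or P. -/
theorem flipEdge_eq_diag (h : IsFlip 𝒯 𝒯' P) (hF : F ∈ P) {φ : Flag d} (hφ : φ ∈ flags 𝒯)
    (he : flipEdge P φ.2 = F.diag) : φ.2 = F.redEdge := by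
  obtain ⟨h0, h3, h1, h2⟩ | ⟨F', hF', h3, x, hx, h4, h1, h2⟩ | ⟨F', hF', h3, h4, -, h2⟩ :=
    h.flag_cases hφ
  · rw [h2] at he
    exact (h3 F hF (h.mem_wings F hF _ h0.1 (he ▸ h0.2))).elim
  · rw [h2, h4] at he
    have hw := h.wings_subset F' hF' ⟨x, hx, rfl⟩
    have hFF : F' = F := h.eq_of_wings _ hF' _ hF _ ⟨x, hx, rfl⟩
      (h.mem_wings F hF _ hw (he ▸ Elem.side_edge_mem_wing h3 x))
    subst hFF
    obtain ⟨y, hr⟩ := Elem.exists_ref_of_mem hx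
    obtain ⟨-, h5, -, h6, -⟩ := (h.nondegenerate F' hF').quad_ne hr
    rw [Elem.diag_eq hr] at he
    obtain ⟨h7, -⟩ | ⟨h7, -⟩ := Sym2.eq_iff.1 he
    · exact (h5 h7).elim
    · exact (h6 h7).elim
  · rw [h2] at he
    rw [h4, h.eq_of_diag_eq hF' hF he]

theorem flipEdge_inj (h : IsFlip 𝒯 𝒯' P) {φ ψ : Flag d} (hφ : φ ∈ flags 𝒯)
    (hψ : ψ ∈ flags 𝒯) (he : flipEdge P φ.2 = flipEdge P ψ.2) : φ.2 = ψ.2 := by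
  by_cases h1 : ∃ F ∈ P, φ.2 = F.redEdge
  · obtain ⟨F, hF, h1⟩ := h1
    rw [h1, h.flipEdge_eq_diag hF hψ (by rw [← he, h1, h.flipEdge_redEdge hF])]
  · by_cases h2 : ∃ F ∈ P, ψ.2 = F.redEdge
    · obtain ⟨F, hF, h2⟩ := h2
      rw [h2, h.flipEdge_eq_diag hF hφ (by rw [he, h2, h.flipEdge_redEdge hF])]
    · push Not at h1 h2
      rwa [flipEdge_of_ne h1, flipEdge_of_ne h2] at he

theorem flipCorr_mem_flags (h : IsFlip 𝒯 𝒯' P) {φ : Flag d} (hφ : φ ∈ flags 𝒯) :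
    flipCorr P φ ∈ flags 𝒯' := by
  obtain ⟨h0, -, h1, -⟩ | ⟨F, hF, h3, x, hx, h4, h1, h2⟩ | ⟨F, hF, h3, -, ⟨x, hx, h1⟩, h2⟩ :=
    h.flag_cases hφ <;> rw [h1]
  · exact h0
  · exact ⟨h.wings_subset F hF ⟨x, hx, rfl⟩, by rw [h4]; exact Elem.side_edge_mem_wing h3 x⟩
  · exact ⟨h.wings_subset F hF ⟨x, hx, rfl⟩, Elem.ref_mem_edges _⟩

theorem _root_.NVB.Elem.Nondegenerate.lowerRed_ne_upperRed (h : F.Nondegenerate) : F.lowerRed ≠ F.upperRed := by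
  obtain ⟨a, b, hr⟩ := F.exists_ref
  intro he
  have : mid F.ref = F.apex := congrArg Elem.apex he
  rw [hr, mid_mk] at this
  exact (h.quad_ne hr).1 this

/-- The edge is recovered by injectivity of the edge map. On a side of the parallelogram the end c
or K then identifies the red-son; on the diagonal the wing identifies it. -/
theorem injOn_flipCorr (h : IsFlip 𝒯 𝒯' P) : Set.InjOn (flipCorr P) (flags 𝒯) := by
  classical
  intro φ hφ ψ hψ he
  have h2 : φ.2 = ψ.2 := h.flipEdge_inj hφ hψ (by rw [← h.flipCorr_snd hφ, he, h.flipCorr_snd hψ])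
  refine Prod.ext ?_ h2
  have hmix : ∀ {φ ψ : Flag d}, φ ∈ flags 𝒯 → ψ ∈ flags 𝒯 → flipCorr P φ = flipCorr P ψ →
      (∀ F ∈ P, φ.1 ∉ F.wings) → flipCorr P φ = φ → φ.1 = ψ.1 := by
    intro φ ψ hφ hψ he h3 h4
    obtain ⟨-, -, h5, -⟩ | ⟨F, hF, -, x, hx, -, h5, -⟩ | ⟨F, hF, -, -, ⟨x, hx, h5⟩, -⟩ :=
      h.flag_cases hψ
    · rw [h4, h5] at he; rw [he]
    all_goals
      rw [h4, h5] at he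
      exact (h3 F hF (by rw [he]; exact ⟨x, hx, rfl⟩)).elim
  obtain ⟨-, h3, h4, -⟩ | hφ' := h.flag_cases hφ
  · exact hmix hφ hψ he h3 h4
  obtain ⟨-, h3, h4, -⟩ | hψ' := h.flag_cases hψ
  · exact (hmix hψ hφ he.symm h3 h4).symm
  obtain ⟨F, hF, h3, x, hx, h4, h5, -⟩ | ⟨F, hF, h3, h4, ⟨x, hx, h5⟩, -⟩ := hφ'
  · obtain ⟨F', hF', h3', x', hx', h4', h5', -⟩ | ⟨F', hF', h3', h4', ⟨x', hx', h5'⟩, -⟩ := hψ'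
    · have hw : F.wing x = F'.wing x' := by
        rw [h5, h5'] at he; exact congrArg Prod.fst he
      obtain rfl := h.eq_of_wings _ hF _ hF' (F.wing x) ⟨x, hx, rfl⟩ (hw ▸ ⟨x', hx', rfl⟩)
      obtain rfl := Elem.wing_inj.1 hw
      rw [h4, h4', Sym2.congr_right] at h2
      obtain ⟨y, hr⟩ := Elem.exists_ref_of_mem hx
      obtain e | e := h3 <;> obtain e' | e' := h3' <;> rw [e, e'] at h2 ⊢
      · exact ((h.nondegenerate F hF).quad_ne hr).1 (by
          simpa [Elem.upperRed, Elem.lowerRed, hr] using h2.symm) |>.elim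
      · exact ((h.nondegenerate F hF).quad_ne hr).1 (by
          simpa [Elem.upperRed, Elem.lowerRed, hr] using h2) |>.elim
    · exact (h.side_ne_redEdge hF hF' h3 hx (by rw [← h4, h2, h4'])).elim
  · obtain ⟨F', hF', h3', x', hx', h4', h5', -⟩ | ⟨F', hF', h3', h4', ⟨x', hx', h5'⟩, -⟩ := hψ'
    · exact (h.side_ne_redEdge hF' hF h3' hx' (by rw [← h4', ← h2, h4])).elim
    · obtain rfl := h.eq_of_redEdge_eq hF hF' (by rw [← h4, h2, h4'])
      have e1 : φ = (φ.1, F.redEdge) := Prod.ext rfl h4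
      have e2 : ψ = (ψ.1, F.redEdge) := Prod.ext rfl h4'
      have hn := h.nondegenerate F hF
      rw [e1, e2, h.flipCorr_redEdge hF h3, h.flipCorr_redEdge hF h3', Prod.mk.injEq,
        Elem.wing_inj] at he
      have hne := (hn.indep (ref_eq_out F)).ne
      obtain e | e := h3 <;> obtain e' | e' := h3' <;> rw [e, e'] at he ⊢
      · rw [if_pos rfl, if_neg hn.lowerRed_ne_upperRed] at he
        exact (hne he.1).elim
      · rw [if_pos rfl, if_neg hn.lowerRed_ne_upperRed] at he
        exact (hne he.1.symm).elim

theorem surjOn_flipCorr (h : IsFlip 𝒯 𝒯' P) :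
    Set.SurjOn (flipCorr P) (flags 𝒯) (flags 𝒯') := by
  classical
  rintro ⟨T, e⟩ ⟨hT, he⟩
  dsimp only at hT he
  by_cases h1 : ∃ F ∈ P, T ∈ F.wings
  · obtain ⟨F, hF, x, hx, rfl⟩ := h1
    have hn := h.nondegenerate F hF
    have hup : F.upperRed ∈ F.reds := .inl rfl
    have hlo : F.lowerRed ∈ F.reds := .inr rfl
    rw [Elem.edges_eq (T := F.wing x) (a := F.apex) (b := mid F.ref) rfl] at he
    obtain rfl | rfl | rfl := he
    · have hx' := hx
      rw [ref_eq_out F, Sym2.mem_iff] at hx'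
      obtain rfl | rfl := hx'
      · exact ⟨(F.upperRed, F.redEdge), ⟨h.reds_subset hF hup, Elem.redEdge_mem_edges_of_reds hup⟩,
          by rw [h.flipCorr_redEdge hF hup, if_pos rfl]; rfl⟩
      · exact ⟨(F.lowerRed, F.redEdge), ⟨h.reds_subset hF hlo, Elem.redEdge_mem_edges_of_reds hlo⟩,
          by rw [h.flipCorr_redEdge hF hlo, if_neg hn.lowerRed_ne_upperRed]; rfl⟩
    · refine ⟨(F.upperRed, s(midpoint ℝ x F.apex, F.upperRed.apex)), ⟨h.reds_subset hF hup, ?_⟩, ?_⟩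
      · refine .inr ⟨_, ?_, rfl⟩
        exact Sym2.mem_map.2 ⟨x, hx, rfl⟩
      · rw [h.flipCorr_side hF hup hx, Sym2.eq_swap]; rfl
    · refine ⟨(F.lowerRed, s(midpoint ℝ x F.apex, F.lowerRed.apex)), ⟨h.reds_subset hF hlo, ?_⟩, ?_⟩
      · refine .inr ⟨_, ?_, rfl⟩
        exact Sym2.mem_map.2 ⟨x, hx, rfl⟩
      · rw [h.flipCorr_side hF hlo hx, Sym2.eq_swap]; rfl
  · push Not at h1
    exact ⟨(T, e), ⟨(h.mem_iff T).2 (.inl ⟨hT, h1⟩), he⟩, h.flipCorr_of_mem hT e⟩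

theorem bijOn_flipCorr (h : IsFlip 𝒯 𝒯' P) : Set.BijOn (flipCorr P) (flags 𝒯) (flags 𝒯') :=
  ⟨fun _ hφ => h.flipCorr_mem_flags hφ, h.injOn_flipCorr, h.surjOn_flipCorr⟩

/-- Meshes which differ by flips are corresponding. -/
theorem isCorr (h : IsFlip 𝒯 𝒯' P) {𝒯₀ : Finset (Elem d)} (h₀ : IsMesh 𝒯₀)
    (hP : ∀ F ∈ P, ∃ A ∈ 𝒯₀, A.Successor F) (hanc : ∀ T ∈ 𝒯', ∃ A ∈ 𝒯₀, A.Successor T) :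
    IsCorr 1 𝒯₀ 𝒯 𝒯' (flipCorr P) := by
  refine isCorr_of_edge_map h₀ h.isMesh h.mesh h.bijOn_flipCorr (fun φ hφ => h.flipCorr_snd hφ)
    (fun φ hφ ψ hψ => h.flipEdge_inj hφ hψ) (fun φ hφ => h.flipEdge_ref hφ) ?_ ?_
  · intro φ hφ
    obtain ⟨h0, -, h1, -⟩ | ⟨F, hF, h3, x, hx, h4, h1, h2⟩ | ⟨F, hF, h3, -, ⟨x, hx, h1⟩, h2⟩ :=
      h.flag_cases hφ <;> rw [h1]
    all_goals rw [Elem.gen_of_reds h3]; rfl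
  · intro φ hφ
    have key : ∀ F ∈ P, φ.1 ∈ F.reds → ∀ x ∈ F.ref, ∃ A ∈ 𝒯₀, A.Successor φ.1 ∧
        A.Successor (F.wing x) := by
      intro F hF h3 x hx
      obtain ⟨A, hA, hs⟩ := hP F hF
      exact ⟨A, hA, hs.trans (Elem.successor_of_redSons (Elem.reds_subset_redSons h3)),
        hs.trans (Elem.successor_of_wings ⟨x, hx, rfl⟩)⟩
    obtain ⟨h0, -, h1, -⟩ | ⟨F, hF, h3, x, hx, h4, h1, h2⟩ | ⟨F, hF, h3, -, ⟨x, hx, h1⟩, h2⟩ :=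
      h.flag_cases hφ <;> rw [h1]
    · obtain ⟨A, hA, hs⟩ := hanc _ h0.1
      exact ⟨A, hA, hs, hs⟩
    · exact key F hF h3 x hx
    · exact key F hF h3 x hx

/-- The triangles X and Y are the wings of `F`. This makes sense even if `F`, being a red-son
itself, never occurs in a mesh of the bisection sequence. -/
theorem redSonRule (h : IsFlip 𝒯 𝒯' P) (hF : F ∈ P) {a b : Pt d} (hr : F.ref = s(a, b)) :
    RedSonRule (flipCorr P) F a b F.apex (mid F.ref) (midpoint ℝ a F.apex)
      (midpoint ℝ b F.apex) := by
  classical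
  have hn := h.nondegenerate F hF
  have hup : F.upperRed ∈ F.reds := .inl rfl
  have hlo : F.lowerRed ∈ F.reds := .inr rfl
  have ha : a ∈ F.ref := by simp [hr]
  have hb : b ∈ F.ref := by simp [hr]
  have e₁ : ∀ x : Pt d, s(F.apex, midpoint ℝ x F.apex) =
      s(midpoint ℝ x F.apex, F.upperRed.apex) := fun x => Sym2.eq_swap
  have e₂ : ∀ x : Pt d, s(mid F.ref, midpoint ℝ x F.apex) =
      s(midpoint ℝ x F.apex, F.lowerRed.apex) := fun x => Sym2.eq_swap
  have hw : ∀ x : Pt d, (⟨midpoint ℝ x F.apex, s(F.apex, mid F.ref), F.gen + 2⟩ : Elem d) =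
      F.wing x := fun x => rfl
  have hd : s(F.apex, mid F.ref) = F.diag := rfl
  refine ⟨?_, ?_, ?_, ?_, ?_⟩
  · rw [e₁, h.flipCorr_side hF hup ha]; rfl
  · rw [e₁, h.flipCorr_side hF hup hb]; rfl
  · rw [e₂, h.flipCorr_side hF hlo ha]; rfl
  · rw [e₂, h.flipCorr_side hF hlo hb]; rfl
  · rw [← Elem.redEdge_eq hr, h.flipCorr_redEdge hF hup, h.flipCorr_redEdge hF hlo, if_pos rfl,
      if_neg hn.lowerRed_ne_upperRed, hw, hw, hd]
    have := hr.symm.trans (ref_eq_out F)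
    obtain ⟨h1, h2⟩ | ⟨h1, h2⟩ := Sym2.eq_iff.1 this
    · left; rw [← h1, ← h2]; exact ⟨rfl, rfl⟩
    · right; rw [← h1, ← h2]; exact ⟨rfl, rfl⟩

end IsFlip

/-! ### One refinement step -/

namespace Elem

variable {F T S : Elem d} {N N' : Set (Sym2 (Pt d))} {R : Set (Elem d)}

theorem nvbSons_congr (h : ∀ e ∈ T.edges, (e ∈ N ↔ e ∈ N')) : T.nvbSons N = T.nvbSons N' := by
  ext S
  rw [mem_nvbSons, mem_nvbSons, h _ T.ref_mem_edges]
  refine or_congr_right (and_congr_right fun _ => exists_congr fun S' => and_congr_right ?_)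
  rintro ⟨x, hx, rfl⟩
  rw [h _ (.inr ⟨x, hx, rfl⟩)]

theorem mem_nvbSons_self (h : T.ref ∉ N) : S ∈ T.nvbSons N ↔ S = T := by
  simp [mem_nvbSons, h]

/-- The bisections of the red-sons and those of the wings are the same. -/
theorem exists_reds_bisect_iff :
    (∃ T ∈ F.reds, S ∈ T.bisect) ↔ ∃ T ∈ F.wings, S ∈ T.bisect := by
  constructor
  -- Each son is spanned by the centre of the parallelogram and one of its sides, and each side
  -- belongs to one red-son and one wing.
  · rintro ⟨T, hT, z, hz, rfl⟩
    rw [ref_of_reds hT] at hz ⊢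
    obtain ⟨x, hx, rfl⟩ := Sym2.mem_map.1 hz
    refine ⟨F.wing x, ⟨x, hx, rfl⟩, T.apex, ?_, ?_⟩
    · obtain h | h := apex_of_reds hT <;> rw [h] <;> simp [wing, diag]
    · rw [gen_of_reds hT, mid_redEdge, Sym2.eq_swap]; rfl
  · rintro ⟨_, ⟨x, hx, rfl⟩, y, hy, rfl⟩
    have key : ∀ T ∈ F.reds, (⟨mid (F.wing x).ref, s(T.apex, (F.wing x).apex),
        (F.wing x).gen + 1⟩ : Elem d) ∈ T.bisect := by
      intro T hT
      refine ⟨midpoint ℝ x F.apex, ?_, ?_⟩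
      · rw [ref_of_reds hT]; exact Sym2.mem_map.2 ⟨x, hx, rfl⟩
      · rw [gen_of_reds hT, ref_of_reds hT, mid_redEdge, Sym2.eq_swap]; rfl
    obtain rfl | rfl := Sym2.mem_iff.1 (show y ∈ s(F.apex, mid F.ref) from hy)
    · exact ⟨F.upperRed, .inl rfl, key _ (.inl rfl)⟩
    · exact ⟨F.lowerRed, .inr rfl, key _ (.inr rfl)⟩

theorem ref_of_wings (h : T ∈ F.wings) : T.ref = F.diag := by
  obtain ⟨x, -, rfl⟩ := h; rfl

theorem gen_of_wings (h : T ∈ F.wings) : T.gen = F.gen + 2 := by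
  obtain ⟨x, -, rfl⟩ := h; rfl

/-- The sons of the red-sons and those of the wings are the same if the diagonals are marked. -/
theorem exists_reds_nvbSons_iff (hN : F.redEdge ∈ N) (hN' : F.diag ∈ N')
    (hside : ∀ T ∈ F.reds, ∀ x ∈ F.ref, s(midpoint ℝ x F.apex, T.apex) ∈ N ↔
      s(midpoint ℝ x F.apex, T.apex) ∈ N') :
    (∃ T ∈ F.reds, S ∈ T.nvbSons N) ↔ ∃ T ∈ F.wings, S ∈ T.nvbSons N' := by
  have hside' : ∀ T ∈ F.reds, ∀ S' ∈ T.bisect, (S'.ref ∈ N ↔ S'.ref ∈ N') := by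
    rintro T hT S' ⟨z, hz, rfl⟩
    rw [ref_of_reds hT] at hz
    obtain ⟨x, hx, rfl⟩ := Sym2.mem_map.1 hz
    exact hside T hT x hx
  constructor
  · rintro ⟨T, hT, ⟨h1, -⟩ | ⟨-, S', hS', h⟩⟩
    · exact (h1 (ref_of_reds hT ▸ hN)).elim
    · obtain ⟨T', hT', hS''⟩ := exists_reds_bisect_iff.1 ⟨T, hT, hS'⟩
      rw [hside' T hT S' hS'] at h
      exact ⟨T', hT', .inr ⟨ref_of_wings hT' ▸ hN', S', hS'', h⟩⟩
  · rintro ⟨T', hT', ⟨h1, -⟩ | ⟨-, S', hS', h⟩⟩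
    · exact (h1 (ref_of_wings hT' ▸ hN')).elim
    · obtain ⟨T, hT, hS''⟩ := exists_reds_bisect_iff.2 ⟨T', hT', hS'⟩
      rw [← hside' T hT S' hS''] at h
      exact ⟨T, hT, .inr ⟨ref_of_reds hT ▸ hN, S', hS'', h⟩⟩

theorem wings_subset_nvbSons (h : F.edges ⊆ N) : F.wings ⊆ F.nvbSons N := by
  rintro _ ⟨x, hx, rfl⟩
  refine .inr ⟨h F.ref_mem_edges, ⟨mid F.ref, s(x, F.apex), F.gen + 1⟩, ⟨x, hx, rfl⟩, .inr
    ⟨h (.inr ⟨x, hx, rfl⟩), F.apex, by simp, ?_⟩⟩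
  rw [wing, diag]; rfl

theorem mem_nvbSons_of_edges_subset {a b : Pt d} (hr : F.ref = s(a, b)) (h : F.edges ⊆ N) :
    S ∈ F.nvbSons N ↔ S ∈ F.wings ∨
      S = ⟨midpoint ℝ a F.apex, s(a, midpoint ℝ a b), F.gen + 2⟩ ∨
      S = ⟨midpoint ℝ b F.apex, s(b, midpoint ℝ a b), F.gen + 2⟩ := by
  have hm : F.ref ∈ N := h F.ref_mem_edges
  have ha : s(a, F.apex) ∈ N := h (by simp [edges_eq hr])
  have hb : s(b, F.apex) ∈ N := h (by simp [edges_eq hr])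
  have hx : ∀ x : Pt d, S ∈ (⟨midpoint ℝ a b, s(x, F.apex), F.gen + 1⟩ : Elem d).bisect ↔
      S = ⟨midpoint ℝ x F.apex, s(x, midpoint ℝ a b), F.gen + 2⟩ ∨
      S = ⟨midpoint ℝ x F.apex, s(F.apex, midpoint ℝ a b), F.gen + 2⟩ := fun x =>
    mem_bisect (T := ⟨midpoint ℝ a b, s(x, F.apex), F.gen + 1⟩) rfl
  simp only [mem_nvbSons, hm, not_true_eq_false, false_and, true_and, false_or, mem_bisect hr,
    or_and_right, exists_or, exists_eq_left, ha, hb, mem_wings hr, hx, wing,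
    diag_eq hr]
  tauto

theorem mem_redSons_iff {a b : Pt d} (hr : F.ref = s(a, b)) :
    S ∈ F.redSons ↔ S ∈ F.reds ∨
      S = ⟨midpoint ℝ a F.apex, s(a, midpoint ℝ a b), F.gen + 2⟩ ∨
      S = ⟨midpoint ℝ b F.apex, s(b, midpoint ℝ a b), F.gen + 2⟩ := by
  rw [mem_redSons hr, reds]
  simp [or_assoc]

theorem Nondegenerate.corner_diag_notMem (hF : F.Nondegenerate) {a b : Pt d}
    (hr : F.ref = s(a, b)) (g : ℕ) : F.diag ∉
      (⟨midpoint ℝ a F.apex, s(a, midpoint ℝ a b), g⟩ : Elem d).edges := by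
  intro h
  have := mem_verts_of_mem_edges h (x := F.apex) (by simp [diag])
  rw [verts_eq rfl] at this
  obtain ⟨h1, h2, -⟩ := hF.quad_ne hr
  simp [h1.symm, h2.symm, (hF.indep hr).ne₁₃.symm] at this

theorem Nondegenerate.diag_notMem_edges_of_corner (hF : F.Nondegenerate) {a b : Pt d}
    (hr : F.ref = s(a, b)) (hS : S = ⟨midpoint ℝ a F.apex, s(a, midpoint ℝ a b), F.gen + 2⟩ ∨
      S = ⟨midpoint ℝ b F.apex, s(b, midpoint ℝ a b), F.gen + 2⟩) : F.diag ∉ S.edges := by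
  obtain rfl | rfl := hS
  · exact hF.corner_diag_notMem hr _
  · rw [midpoint_comm a b]
    exact hF.corner_diag_notMem (hr.trans Sym2.eq_swap) _

theorem Nondegenerate.mem_wings_of_diag_mem (hF : F.Nondegenerate) (h : F.edges ⊆ N)
    (hS : S ∈ F.nvbSons N) (hd : F.diag ∈ S.edges) : S ∈ F.wings := by
  obtain ⟨a, b, hr⟩ := F.exists_ref
  obtain h1 | h1 := (mem_nvbSons_of_edges_subset hr h).1 hS
  · exact h1
  · exact (hF.diag_notMem_edges_of_corner hr h1 hd).elim

theorem hull_subset_of_sons (h : S ∈ T.sons N R) : S.hull ⊆ T.hull := by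
  obtain ⟨-, -, h⟩ | ⟨-, h⟩ := h
  · exact hull_subset_of_redSons h
  · exact hull_subset_of_nvbSons h

theorem successor_of_sons (h : S ∈ T.sons N R) : T.Successor S := by
  obtain ⟨-, -, h⟩ | ⟨-, h⟩ := h
  · exact successor_of_redSons h
  · exact successor_of_nvbSons h

theorem sons_empty : T.sons N ∅ = T.nvbSons N := by
  ext S; simp [sons]

theorem hull_subset_of_wings (h : T ∈ F.wings) : T.hull ⊆ F.hull :=
  (successor_of_wings h).hull_subset

theorem Nondegenerate.of_wings (hF : F.Nondegenerate) (h : T ∈ F.wings) : T.Nondegenerate :=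
  hF.of_nvbSons (wings_subset_nvbSons (N := Set.univ) (Set.subset_univ _) h)

theorem ref_notMem_of_mem_sons_self (h : T ∈ T.sons N R) : T.ref ∉ N := by
  obtain ⟨-, -, h⟩ | ⟨-, ⟨h, -⟩ | ⟨-, S', hS', ⟨-, h⟩ | ⟨-, h⟩⟩⟩ := h
  · exact (IsSon.gen_lt (.inr h)).false.elim
  · exact h
  · exact ((IsSon.gen_lt (.inl hS')).trans_eq (congrArg Elem.gen h.symm)).false.elim
  · exact ((IsSon.gen_lt (.inl hS')).trans (IsSon.gen_lt (.inl h))).false.elim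

theorem Nondegenerate.upperRed_notMem_nvbSons (hF : F.Nondegenerate) :
    F.upperRed ∉ F.nvbSons N := by
  obtain ⟨a, b, hr⟩ := F.exists_ref
  rintro (⟨-, h⟩ | ⟨-, S', hS', ⟨-, h⟩ | ⟨-, h⟩⟩)
  · have := congrArg Elem.gen h; simp [upperRed] at this
  · obtain ⟨x, -, rfl⟩ := hS'
    have := congrArg Elem.gen h; simp [upperRed] at this
  · obtain ⟨h1, h2, h3, -⟩ := hF.quad_ne hr
    obtain rfl | rfl := (mem_bisect hr).1 hS' <;> obtain ⟨y, -, h⟩ := h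
    · exact h2 (congrArg Elem.apex h).symm
    · exact h3 (congrArg Elem.apex h).symm

theorem finite_nvbSons (N : Set (Sym2 (Pt d))) (T : Elem d) : (T.nvbSons N).Finite := by
  have hb : ∀ T : Elem d, T.bisect.Finite := by
    intro T
    obtain ⟨a, b, hr⟩ := T.exists_ref
    exact (Set.toFinite {(⟨midpoint ℝ a b, s(a, T.apex), T.gen + 1⟩ : Elem d),
      ⟨midpoint ℝ a b, s(b, T.apex), T.gen + 1⟩}).subset fun S hS => by
        simpa using (mem_bisect hr).1 hS
  refine (((Set.finite_singleton T).union (hb T)).union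
    ((hb T).biUnion fun S _ => hb S)).subset ?_
  rintro S (⟨-, rfl⟩ | ⟨-, S', hS', ⟨-, rfl⟩ | ⟨-, h⟩⟩)
  · exact .inl (.inl rfl)
  · exact .inl (.inr hS')
  · exact .inr (Set.mem_biUnion hS' h)

end Elem

theorem exists_nvb_refinement (𝒯 : Finset (Elem d)) (N : Set (Sym2 (Pt d))) :
    ∃ 𝒯' : Finset (Elem d), ∀ S, S ∈ 𝒯' ↔ ∃ T ∈ 𝒯, S ∈ T.nvbSons N := by
  have hf : (⋃ T ∈ 𝒯, T.nvbSons N).Finite :=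
    𝒯.finite_toSet.biUnion fun T _ => T.finite_nvbSons N
  exact ⟨hf.toFinset, fun S => by simp⟩

/-- The centre of the parallelogram has the positive weights 1/4, 1/4, 1/2 at the nodes of `F`. As
an interior point it lies in no other element. -/
theorem IsMesh.eq_of_mid_diag_mem {𝒯 : Finset (Elem d)} (h : IsMesh 𝒯) {F T : Elem d}
    (hF : F ∈ 𝒯) (hT : T ∈ 𝒯) (hm : mid F.diag ∈ T.hull) : T = F := by
  classical
  obtain ⟨a, b, hr⟩ := F.exists_ref
  have hi := (h.1 F hF).indep hr
  have hab := hi.ne; have hac := hi.ne₁₃; have hbc := hi.ne₂₃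
  set w := single a (1 / 4 : ℝ) + single b (1 / 4 : ℝ) + single F.apex (1 / 2 : ℝ) with hw
  have hwF : IsWeight F.verts w := by
    rw [Elem.verts_eq hr]
    refine ⟨fun v => ?_, fun v hv => ?_, ?_⟩
    · simp only [hw, Finsupp.coe_add, Pi.add_apply, Finsupp.single_apply]
      split_ifs <;> norm_num
    · simp only [Set.mem_insert_iff, Set.mem_singleton_iff, not_or] at hv
      simp [hw, hv]
    · simp only [hw, map_add, total_single]; norm_num
  have hwp : point w = mid F.diag := by
    rw [Elem.diag_eq hr]
    simp only [hw, map_add, point_single, mid_mk, midpoint_eq]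
    module
  obtain ⟨u, hu, hup⟩ := Elem.mem_hull_iff.1 hm
  obtain rfl := h.weight_unique hT hF hu hwF (hup.trans hwp.symm)
  have hsub : F.verts ⊆ T.verts := by
    intro v hv
    by_contra hvT
    have h0 := hu.zero v hvT
    rw [Elem.verts_eq hr] at hv
    obtain rfl | rfl | rfl := hv <;> simp [hw, hab, hac, hbc, hab.symm, hac.symm, hbc.symm] at h0
  exact h.eq_of_hull_subset hT hF (h.1 F hF) (convexHull_mono hsub) subset_rfl

/-- Red-refinement is the refinement by three bisections followed by flips. -/
theorem IsMesh.isFlip_sons {𝒯 𝒯₁ 𝒯₂ : Finset (Elem d)} {N : Set (Sym2 (Pt d))}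
    {R : Set (Elem d)} (h : IsMesh 𝒯) (hN : ∀ T ∈ 𝒯, ∀ e ∈ T.edges, e ∈ N → T.ref ∈ N)
    (h₁ : ∀ S, S ∈ 𝒯₁ ↔ ∃ T ∈ 𝒯, S ∈ T.nvbSons N)
    (h₂ : ∀ S, S ∈ 𝒯₂ ↔ ∃ T ∈ 𝒯, S ∈ T.sons N R) :
    IsFlip 𝒯₂ 𝒯₁ {F | F ∈ 𝒯 ∧ F.edges ⊆ N ∧ F ∈ R} := by
  -- A wing is non-degenerate, so only one element of the mesh can contain it.
  have hfather : ∀ {F T S : Elem d}, F ∈ 𝒯 → T ∈ 𝒯 → S ∈ F.wings → S ∈ T.nvbSons N → T = F :=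
    fun {F T S} hF hT hS hS' => h.eq_of_hull_subset hT hF ((h.1 F hF).of_wings hS)
      (Elem.hull_subset_of_nvbSons hS') (Elem.hull_subset_of_wings hS)
  refine ⟨h.nvbSons hN h₁, fun F hF => h.1 F hF.1, ?_, ?_, ?_, ?_⟩
  · exact fun F hF S hS => (h₁ S).2 ⟨F, hF.1, Elem.wings_subset_nvbSons hF.2.1 hS⟩
  · exact fun F hF F' hF' T hT hT' =>
      hfather hF'.1 hF.1 hT' (Elem.wings_subset_nvbSons hF.2.1 hT)
  · intro F hF T hT hd
    obtain ⟨T₀, hT₀, hT⟩ := (h₁ T).1 hT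
    obtain rfl := h.eq_of_mid_diag_mem hF.1 hT₀ (Elem.hull_subset_of_nvbSons hT
      (edgeHull_subset_hull hd (mid_mem_edgeHull _)))
    exact (h.1 T₀ hT₀).mem_wings_of_diag_mem hF.2.1 hT hd
  · intro S
    rw [h₂, h₁]
    constructor
    · rintro ⟨T, hT, ⟨hTN, hTR, hS⟩ | ⟨hnot, hS⟩⟩
      · obtain ⟨a, b, hr⟩ := T.exists_ref
        obtain hS | hS := (Elem.mem_redSons_iff hr).1 hS
        · exact .inr ⟨T, ⟨hT, hTN, hTR⟩, hS⟩
        · have hS' := (Elem.mem_nvbSons_of_edges_subset hr hTN).2 (.inr hS)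
          refine .inl ⟨⟨T, hT, hS'⟩, fun F hF hSF => ?_⟩
          obtain rfl := hfather hF.1 hT hSF hS'
          exact (h.1 _ hT).diag_notMem_edges_of_corner hr hS (Elem.diag_mem_edges_of_wings hSF)
      · refine .inl ⟨⟨T, hT, hS⟩, fun F hF hSF => hnot ?_⟩
        obtain rfl := hfather hF.1 hT hSF hS
        exact hF.2
    · rintro (⟨⟨T, hT, hS⟩, hnot⟩ | ⟨F, hF, hS⟩)
      · refine ⟨T, hT, ?_⟩
        by_cases hTR : T.edges ⊆ N ∧ T ∈ R
        · obtain ⟨a, b, hr⟩ := T.exists_ref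
          refine .inl ⟨hTR.1, hTR.2, (Elem.mem_redSons_iff hr).2 (.inr ?_)⟩
          exact ((Elem.mem_nvbSons_of_edges_subset hr hTR.1).1 hS).resolve_left
            (hnot T ⟨hT, hTR⟩)
        · exact .inr ⟨hTR, hS⟩
      · exact ⟨F, hF.1, .inl ⟨hF.2.1, hF.2.2, Elem.reds_subset_redSons hS⟩⟩

/-! ### Flips under marking, bisection and composition -/

namespace IsFlip

variable {𝒯 𝒯' 𝒯₁ 𝒯₁' 𝒯₂ : Finset (Elem d)} {P P' : Set (Elem d)} {N : Set (Sym2 (Pt d))}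

theorem flipEdge_mem_image_iff (h : IsFlip 𝒯 𝒯' P) (hN : ∀ e ∈ N, ∃ T ∈ 𝒯, e ∈ T.edges)
    {T : Elem d} (hT : T ∈ 𝒯) {e : Sym2 (Pt d)} (he : e ∈ T.edges) :
    flipEdge P e ∈ flipEdge P '' N ↔ e ∈ N := by
  constructor
  · rintro ⟨e', he', heq⟩
    obtain ⟨T', hT', hm⟩ := hN e' he'
    have : e' = e := h.flipEdge_inj (φ := (T', e')) (ψ := (T, e)) ⟨hT', hm⟩ ⟨hT, he⟩ heq
    rwa [← this]
  · exact fun h => ⟨e, h, rfl⟩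

/-- The closure rule speaks only of pairs of an element and an edge and of reference edges. The
bijection of these pairs transports both by the edge map. -/
theorem markStep_image (h : IsFlip 𝒯 𝒯' P) (hN : ∀ e ∈ N, ∃ T ∈ 𝒯, e ∈ T.edges) :
    markStep 𝒯' (flipEdge P '' N) = flipEdge P '' markStep 𝒯 N := by
  ext e
  constructor
  · rintro (⟨e₁, he₁, rfl⟩ | ⟨T', hT', rfl, _, ⟨e₁, he₁, rfl⟩, hm⟩)
    · exact ⟨e₁, .inl he₁, rfl⟩
    · obtain ⟨φ, hφ, heq⟩ := h.surjOn_flipCorr (show (T', flipEdge P e₁) ∈ flags 𝒯' from ⟨hT', hm⟩)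
      have h2 : flipEdge P φ.2 ∈ flipEdge P '' N := by
        rw [← h.flipCorr_snd hφ, heq]; exact ⟨e₁, he₁, rfl⟩
      rw [h.flipEdge_mem_image_iff hN hφ.1 hφ.2] at h2
      exact ⟨φ.1.ref, .inr ⟨φ.1, hφ.1, rfl, φ.2, h2, hφ.2⟩, by rw [← h.flipEdge_ref hφ, heq]⟩
  · rintro ⟨e₁, he₁ | ⟨T, hT, rfl, e₂, he₂, hm⟩, rfl⟩
    · exact .inl ⟨e₁, he₁, rfl⟩
    · have hφ : (T, e₂) ∈ flags 𝒯 := ⟨hT, hm⟩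
      have hφ' := h.flipCorr_mem_flags hφ
      refine .inr ⟨_, hφ'.1, (h.flipEdge_ref hφ).symm, _, ⟨e₂, he₂, rfl⟩, ?_⟩
      rw [show flipEdge P e₂ = _ from (h.flipCorr_snd hφ).symm]
      exact hφ'.2

theorem markStep_subset (hN : ∀ e ∈ N, ∃ T ∈ 𝒯, e ∈ T.edges) :
    ∀ e ∈ markStep 𝒯 N, ∃ T ∈ 𝒯, e ∈ T.edges := by
  rintro e (he | ⟨T, hT, rfl, -⟩)
  · exact hN e he
  · exact ⟨T, hT, T.ref_mem_edges⟩

theorem iterate_markStep (h : IsFlip 𝒯 𝒯' P) (k : ℕ) (hN : ∀ e ∈ N, ∃ T ∈ 𝒯, e ∈ T.edges) :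
    (markStep 𝒯')^[k] (flipEdge P '' N) = flipEdge P '' (markStep 𝒯)^[k] N ∧
      ∀ e ∈ (markStep 𝒯)^[k] N, ∃ T ∈ 𝒯, e ∈ T.edges := by
  induction k with
  | zero => exact ⟨rfl, hN⟩
  | succ k ih =>
    rw [Function.iterate_succ_apply', Function.iterate_succ_apply', ih.1, h.markStep_image ih.2]
    exact ⟨rfl, markStep_subset ih.2⟩

theorem isMarkClosure_image (h : IsFlip 𝒯 𝒯' P) {N₀ : Set (Sym2 (Pt d))}
    (hN₀ : ∀ e ∈ N₀, ∃ T ∈ 𝒯, e ∈ T.edges) (hN : IsMarkClosure 𝒯 N₀ N) :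
    IsMarkClosure 𝒯' (flipEdge P '' N₀) (flipEdge P '' N) ∧ ∀ e ∈ N, ∃ T ∈ 𝒯, e ∈ T.edges := by
  obtain ⟨k, rfl, h2⟩ := hN
  obtain ⟨h3, h4⟩ := h.iterate_markStep k hN₀
  exact ⟨⟨k, h3, by rw [h.markStep_image h4, h2]⟩, h4⟩

theorem ref_mem_of_markStep_eq (hN : markStep 𝒯 N = N) :
    ∀ T ∈ 𝒯, ∀ e ∈ T.edges, e ∈ N → T.ref ∈ N := by
  intro T hT e he hm
  rw [← hN]
  exact .inr ⟨T, hT, rfl, e, hm, he⟩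

/-- Refinement by bisections is compatible with flips. -/
theorem nvbSons (h : IsFlip 𝒯 𝒯' P) (hN : ∀ e ∈ N, ∃ T ∈ 𝒯, e ∈ T.edges)
    (hcl : ∀ T ∈ 𝒯', ∀ e ∈ T.edges, e ∈ flipEdge P '' N → T.ref ∈ flipEdge P '' N)
    (h₁ : ∀ S, S ∈ 𝒯₁ ↔ ∃ T ∈ 𝒯, S ∈ T.nvbSons N)
    (h₁' : ∀ S, S ∈ 𝒯₁' ↔ ∃ T ∈ 𝒯', S ∈ T.nvbSons (flipEdge P '' N)) :
    IsFlip 𝒯₁ 𝒯₁' {F | F ∈ P ∧ F.redEdge ∉ N} := by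
  -- The two diagonals of a parallelogram are marked simultaneously in their meshes. Together with
  -- the equal marks on the sides, this makes red-sons and wings refine in parallel.
  have hdiag : ∀ F ∈ P, (F.diag ∈ flipEdge P '' N ↔ F.redEdge ∈ N) := by
    intro F hF
    rw [← h.flipEdge_redEdge hF]
    exact h.flipEdge_mem_image_iff hN (h.reds_subset hF (.inl rfl)) (Elem.ref_mem_edges F.upperRed)
  have hside : ∀ F ∈ P, ∀ T ∈ F.reds, ∀ x ∈ F.ref, s(midpoint ℝ x F.apex, T.apex) ∈ N ↔
      s(midpoint ℝ x F.apex, T.apex) ∈ flipEdge P '' N := by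
    intro F hF T hT x hx
    have hm : s(midpoint ℝ x F.apex, T.apex) ∈ T.edges := by
      refine .inr ⟨_, ?_, rfl⟩
      rw [Elem.ref_of_reds hT]; exact Sym2.mem_map.2 ⟨x, hx, rfl⟩
    rw [← h.flipEdge_mem_image_iff hN (h.reds_subset hF hT) hm,
      flipEdge_of_ne fun F' hF' => h.side_ne_redEdge hF hF' hT hx]
  have hsame : ∀ T ∈ 𝒯, T ∈ 𝒯' → T.nvbSons N = T.nvbSons (flipEdge P '' N) := by
    intro T hT hT'
    refine Elem.nvbSons_congr fun e he => ?_
    rw [← h.flipEdge_mem_image_iff hN hT he, h.flipEdge_of_mem hT' he]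
  have hwing : ∀ F ∈ P, F.redEdge ∉ N → ∀ T ∈ F.wings, ∀ S,
      S ∈ T.nvbSons (flipEdge P '' N) ↔ S = T := by
    intro F hF hFN T hT S
    exact Elem.mem_nvbSons_self (by rwa [Elem.ref_of_wings hT, hdiag F hF])
  -- a wing whose reference edge is not marked is its own father
  have hfather : ∀ F ∈ P, F.redEdge ∉ N → ∀ S ∈ F.wings, ∀ T ∈ 𝒯',
      S ∈ T.nvbSons (flipEdge P '' N) → T = S := by
    intro F hF hFN S hS T hT hST
    have hS' := h.wings_subset F hF hS
    exact h.mesh.eq_of_hull_subset hT hS' (h.mesh.1 S hS') (Elem.hull_subset_of_nvbSons hST)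
      subset_rfl
  refine ⟨h.mesh.nvbSons hcl h₁', fun F hF => h.nondegenerate F hF.1, ?_,
    fun F hF F' hF' => h.eq_of_wings F hF.1 F' hF'.1, ?_, ?_⟩
  · exact fun F hF T hT => (h₁' T).2 ⟨T, h.wings_subset F hF.1 hT,
      (hwing F hF.1 hF.2 T hT T).2 rfl⟩
  · intro F hF T hT hd
    obtain ⟨T₀, hT₀, hT⟩ := (h₁' T).1 hT
    obtain ⟨a, b, hr⟩ := F.exists_ref
    have hT₀F : T₀ ∈ F.wings := by
      refine h.mem_wings F hF.1 T₀ hT₀ (h.mesh.mem_edges_of_mid_mem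
        (h.wings_subset F hF.1 ((Elem.mem_wings hr).2 (.inl rfl))) hT₀ (Elem.ref_mem_edges _) ?_)
      exact Elem.hull_subset_of_nvbSons hT (edgeHull_subset_hull hd (mid_mem_edgeHull _))
    rwa [(hwing F hF.1 hF.2 T₀ hT₀F T).1 hT]
  · intro S
    rw [h₁, h₁']
    constructor
    · rintro ⟨T, hT, hS⟩
      obtain ⟨hT', hTn⟩ | ⟨F, hF, hTF⟩ := (h.mem_iff T).1 hT
      · rw [hsame T hT hT'] at hS
        refine .inl ⟨⟨T, hT', hS⟩, fun F hF hSF => hTn F hF.1 ?_⟩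
        rwa [hfather F hF.1 hF.2 S hSF T hT' hS]
      -- If the diagonal is marked, the flip dissolves and the son is also a son of a wing;
      -- otherwise the red-son stays as it is.
      · by_cases hFN : F.redEdge ∈ N
        · obtain ⟨T', hT', hS'⟩ := (Elem.exists_reds_nvbSons_iff hFN ((hdiag F hF).2 hFN)
            (hside F hF)).1 ⟨T, hTF, hS⟩
          have hT'' := h.wings_subset F hF hT'
          refine .inl ⟨⟨T', hT'', hS'⟩, fun F' hF' hSF' => hF'.2 ?_⟩
          rw [hfather F' hF'.1 hF'.2 S hSF' T' hT'' hS'] at hT'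
          rwa [← h.eq_of_wings F hF F' hF'.1 S hT' hSF']
        · rw [Elem.mem_nvbSons_self (by rwa [Elem.ref_of_reds hTF])] at hS
          exact .inr ⟨F, ⟨hF, hFN⟩, hS ▸ hTF⟩
    · rintro (⟨⟨T, hT, hS⟩, hnot⟩ | ⟨F, hF, hS⟩)
      · by_cases hw : ∃ F ∈ P, T ∈ F.wings
        · obtain ⟨F, hF, hTF⟩ := hw
          by_cases hFN : F.redEdge ∈ N
          · obtain ⟨T', hT', hS'⟩ := (Elem.exists_reds_nvbSons_iff hFN ((hdiag F hF).2 hFN)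
              (hside F hF)).2 ⟨T, hTF, hS⟩
            exact ⟨T', h.reds_subset hF hT', hS'⟩
          · obtain rfl := (hwing F hF hFN T hTF S).1 hS
            exact (hnot F ⟨hF, hFN⟩ hTF).elim
        · push Not at hw
          have hT' := (h.mem_iff T).2 (.inl ⟨hT, hw⟩)
          exact ⟨T, hT', by rwa [hsame T hT' hT]⟩
      · exact ⟨S, h.reds_subset hF.1 hS,
          (Elem.mem_nvbSons_self (by rw [Elem.ref_of_reds hS]; exact hF.2)).2 rfl⟩

/-- Flips of independent pairs can be composed. -/
theorem comp (h₁ : IsFlip 𝒯₁ 𝒯' P) (h₂ : IsFlip 𝒯₂ 𝒯₁ P')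
    (hd : ∀ F ∈ P', ∀ F' ∈ P, ∀ T ∈ F.wings, T ∉ F'.reds) : IsFlip 𝒯₂ 𝒯' (P ∪ P') := by
  have hsub : ∀ F ∈ P', ∀ T ∈ F.wings, T ∈ 𝒯' := by
    intro F hF T hT
    obtain ⟨h, -⟩ | ⟨F', hF', h⟩ := (h₁.mem_iff T).1 (h₂.wings_subset F hF hT)
    · exact h
    · exact (hd F hF F' hF' T hT h).elim
  have hdisj : ∀ F ∈ P', ∀ F' ∈ P, ∀ T ∈ F.wings, T ∉ F'.wings := fun F hF F' hF' T hT hT' =>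
    h₁.notMem_of_wings hF' hT' (h₂.wings_subset F hF hT)
  refine ⟨h₁.mesh, ?_, ?_, ?_, ?_, ?_⟩
  · rintro F (hF | hF)
    exacts [h₁.nondegenerate F hF, h₂.nondegenerate F hF]
  · rintro F (hF | hF)
    exacts [h₁.wings_subset F hF, hsub F hF]
  · rintro F (hF | hF) F' (hF' | hF') T hT hT'
    · exact h₁.eq_of_wings F hF F' hF' T hT hT'
    · exact (hdisj F' hF' F hF T hT' hT).elim
    · exact (hdisj F hF F' hF' T hT hT').elim
    · exact h₂.eq_of_wings F hF F' hF' T hT hT'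
  · rintro F (hF | hF) T hT he
    · exact h₁.mem_wings F hF T hT he
    · by_cases hw : ∃ F' ∈ P, T ∈ F'.wings
      · exfalso
        obtain ⟨F', hF', x, hx, rfl⟩ := hw
        -- A side of the old parallelogram is also an edge of a red-son present in `𝒯₁`; if it were
        -- the new diagonal, this red-son would be a wing of `F`.
        have hred : ∀ T' ∈ F'.reds, F.diag ≠ s(midpoint ℝ x F'.apex, T'.apex) := by
          intro T' hT' heq
          refine hd F hF F' hF' T' (h₂.mem_wings F hF T' (h₁.reds_subset hF' hT') ?_) hT'
          rw [heq]
          refine .inr ⟨_, ?_, rfl⟩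
          rw [Elem.ref_of_reds hT']; exact Sym2.mem_map.2 ⟨x, hx, rfl⟩
        rw [Elem.edges_eq (T := F'.wing x) (a := F'.apex) (b := mid F'.ref) rfl] at he
        obtain he | he | he := he
        · obtain ⟨a, b, hr⟩ := F.exists_ref
          have hw : F.wing a ∈ F.wings := (Elem.mem_wings hr).2 (.inl rfl)
          exact hdisj F hF F' hF' _ hw (h₁.mem_wings F' hF' _ (hsub F hF _ hw)
            (show s(F'.apex, mid F'.ref) ∈ _ from he ▸ Elem.ref_mem_edges _))
        · exact hred _ (.inl rfl) (he.trans Sym2.eq_swap)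
        · exact hred _ (.inr rfl) (he.trans Sym2.eq_swap)
      · push Not at hw
        exact h₂.mem_wings F hF T ((h₁.mem_iff T).2 (.inl ⟨hT, hw⟩)) he
  · intro S
    rw [h₂.mem_iff, h₁.mem_iff]
    constructor
    · rintro (⟨⟨h3, h4⟩ | ⟨F, hF, h3⟩, h5⟩ | ⟨F, hF, h3⟩)
      · exact .inl ⟨h3, fun F hF => hF.elim (h4 F) (h5 F)⟩
      · exact .inr ⟨F, .inl hF, h3⟩
      · exact .inr ⟨F, .inr hF, h3⟩
    · rintro (⟨h3, h4⟩ | ⟨F, hF | hF, h3⟩)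
      · exact .inl ⟨.inl ⟨h3, fun F hF => h4 F (.inl hF)⟩, fun F hF => h4 F (.inr hF)⟩
      · exact .inl ⟨.inr ⟨F, hF, h3⟩, fun F' hF' h5 => hd F' hF' F hF S h5 h3⟩
      · exact .inr ⟨F, hF, h3⟩

end IsFlip

/-- Each refinement step can be imitated by bisections. -/
theorem IsFlip.step {𝒯 𝒯' 𝒯₁ M : Finset (Elem d)} {P : Set (Elem d)} {N₀ : Set (Sym2 (Pt d))}
    (h : IsFlip 𝒯 𝒯' P) (href : RefineNVBred 𝒯 M N₀ 𝒯₁) :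
    ∃ (𝒯₁' M' : Finset (Elem d)) (N₀' : Set (Sym2 (Pt d))) (P₁ : Set (Elem d)),
      RefineNVB3 𝒯' M' N₀' 𝒯₁' ∧ M'.card ≤ 2 * M.card ∧ IsFlip 𝒯₁ 𝒯₁' P₁ ∧ P₁ ⊆ P ∪ 𝒯 ∧
      (∀ F ∈ P, ∀ T ∈ F.reds, T ∈ 𝒯₁ → F ∈ P₁) ∧ ∀ F ∈ 𝒯, F.upperRed ∈ 𝒯₁ → F ∈ P₁ := by
  classical
  obtain ⟨R, hM, hN₀, N, hcl, h₂⟩ := href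
  have hN₀' : ∀ e ∈ N₀, ∃ T ∈ 𝒯, e ∈ T.edges := fun e he =>
    let ⟨T, hT, hm⟩ := hN₀ e he
    ⟨T, hM hT, hm⟩
  obtain ⟨hcl', hN⟩ := h.isMarkClosure_image hN₀' hcl
  have hm := h.isMesh
  have hc : ∀ T ∈ 𝒯, ∀ e ∈ T.edges, e ∈ N → T.ref ∈ N :=
    ref_mem_of_markStep_eq hcl.choose_spec.2
  obtain ⟨𝒯m, h₁⟩ := exists_nvb_refinement 𝒯 N
  obtain ⟨𝒯₁', h₁'⟩ := exists_nvb_refinement 𝒯' (flipEdge P '' N)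
  have s₁ := h.nvbSons hN (ref_mem_of_markStep_eq hcl'.choose_spec.2) h₁ h₁'
  have s₂ := hm.isFlip_sons hc h₁ h₂
  -- If a wing of `F` were an old red-son, it would be an element of `𝒯` contained in `F`, hence `F`
  -- itself, but its level exceeds that of `F` by two.
  have s₃ := s₁.comp s₂ (by
    rintro F ⟨hF, -, -⟩ F' ⟨hF', -⟩ T hT hT'
    obtain rfl := hm.eq_of_hull_subset (h.reds_subset hF' hT') hF ((hm.1 F hF).of_wings hT)
      subset_rfl (Elem.hull_subset_of_wings hT)
    have := Elem.gen_of_wings hT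
    omega)
  -- The two edges of a marked element other than its reference edge determine the elements to be
  -- marked: its two wings if it is a flipped red-son, itself otherwise. The image of its reference
  -- edge needs no third element, as it is the reference edge of either one.
  let node (i : Pt d × Pt d → Pt d) (T : Elem d) : Flag d :=
    (T, s(i (Quot.out T.ref), T.apex))
  have hnode : ∀ T ∈ M, node Prod.fst T ∈ flags 𝒯 ∧ node Prod.snd T ∈ flags 𝒯 := fun T hT =>
    ⟨⟨hM hT, .inr ⟨_, Sym2.out_fst_mem _, rfl⟩⟩, ⟨hM hT, .inr ⟨_, Sym2.out_snd_mem _, rfl⟩⟩⟩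
  refine ⟨𝒯₁', M.image (fun T => (flipCorr P (node Prod.fst T)).1) ∪
    M.image (fun T => (flipCorr P (node Prod.snd T)).1), flipEdge P '' N₀, _, ⟨?_, ?_, ?_⟩, ?_,
    s₃, ?_, ?_, ?_⟩
  · intro S hS
    obtain hS | hS := Finset.mem_union.1 hS <;> obtain ⟨T, hT, rfl⟩ := Finset.mem_image.1 hS
    · exact (h.flipCorr_mem_flags (hnode T hT).1).1
    · exact (h.flipCorr_mem_flags (hnode T hT).2).1
  · rintro _ ⟨e, he, rfl⟩
    obtain ⟨T, hT, he⟩ := hN₀ e he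
    have h1 := (hnode T hT).1
    have h2 := (hnode T hT).2
    have m1 : (flipCorr P (node Prod.fst T)).1 ∈ M.image
        (fun T => (flipCorr P (node Prod.fst T)).1) := Finset.mem_image_of_mem _ hT
    have m2 : (flipCorr P (node Prod.snd T)).1 ∈ M.image
        (fun T => (flipCorr P (node Prod.snd T)).1) := Finset.mem_image_of_mem _ hT
    rw [Elem.edges_eq (ref_eq_out T), ← ref_eq_out T] at he
    obtain rfl | rfl | rfl := he
    · exact ⟨_, Finset.mem_union_left _ m1, by
        rw [show T.ref = (node Prod.fst T).1.ref from rfl, ← h.flipEdge_ref h1]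
        exact Elem.ref_mem_edges _⟩
    · exact ⟨_, Finset.mem_union_left _ m1, h.flipCorr_snd h1 ▸ (h.flipCorr_mem_flags h1).2⟩
    · exact ⟨_, Finset.mem_union_right _ m2, h.flipCorr_snd h2 ▸ (h.flipCorr_mem_flags h2).2⟩
  · exact ⟨_, hcl', fun S => by simp only [h₁', Elem.sons_empty]⟩
  · refine (Finset.card_union_le _ _).trans ?_
    rw [two_mul]
    exact Nat.add_le_add Finset.card_image_le Finset.card_image_le
  · rintro F (hF | hF)
    · exact .inl hF.1
    · exact .inr hF.1
  -- A red-son that survives the step has an unmarked reference edge, so its flip survives.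
  · intro F hF T hT hT₁
    refine .inl ⟨hF, ?_⟩
    obtain ⟨T₀, hT₀, hs⟩ := (h₂ T).1 hT₁
    have hT' := h.reds_subset hF hT
    obtain rfl := hm.eq_of_hull_subset hT₀ hT' (hm.1 T hT') (Elem.hull_subset_of_sons hs)
      subset_rfl
    have := Elem.ref_notMem_of_mem_sons_self hs
    rwa [Elem.ref_of_reds hT] at this
  -- The upper red-son cannot arise by bisections of `F`, so its presence shows that `F` was refined
  -- red in this step.
  · intro F hF hU
    have hFn := hm.1 F hF
    obtain ⟨T₀, hT₀, hs⟩ := (h₂ _).1 hU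
    have hU' : F.upperRed ∈ F.reds := .inl rfl
    obtain rfl := hm.eq_of_hull_subset hT₀ hF (hFn.of_reds hU') (Elem.hull_subset_of_sons hs)
      (Elem.hull_subset_of_redSons (Elem.reds_subset_redSons hU'))
    obtain ⟨h3, h4, -⟩ | ⟨-, h3⟩ := hs
    · exact .inr ⟨hF, h3, h4⟩
    · exact (hFn.upperRed_notMem_nvbSons h3).elim

theorem RefineWith.exists_father {R : Set (Elem d)} {𝒯 M 𝒯' : Finset (Elem d)}
    {N₀ : Set (Sym2 (Pt d))} (h : RefineWith R 𝒯 M N₀ 𝒯') {S : Elem d} (hS : S ∈ 𝒯') :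
    ∃ T ∈ 𝒯, T.Successor S := by
  obtain ⟨-, -, N, -, h⟩ := h
  obtain ⟨T, hT, hs⟩ := (h S).1 hS
  exact ⟨T, hT, Elem.successor_of_sons hs⟩

theorem exists_ancestor {𝒯 : ℕ → Finset (Elem d)}
    (h : ∀ l, ∀ S ∈ 𝒯 (l + 1), ∃ T ∈ 𝒯 l, T.Successor S) {j l : ℕ} (hjl : j ≤ l) :
    ∀ S ∈ 𝒯 l, ∃ T ∈ 𝒯 j, T.Successor S := by
  induction l, hjl using Nat.le_induction with
  | base => exact fun S hS => ⟨S, hS, .refl⟩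
  | succ l _ ih =>
    intro S hS
    obtain ⟨T, hT, hs⟩ := h l S hS
    obtain ⟨A, hA, hs'⟩ := ih T hT
    exact ⟨A, hA, hs'.trans hs⟩

/-- The flags of a red-son correspond to flags of two different elements. -/
theorem IsFlip.flipCorr_eq_self_of_const {𝒯 𝒯' : Finset (Elem d)} {P : Set (Elem d)}
    (h : IsFlip 𝒯 𝒯' P) {F G : Elem d} (hF : F ∈ 𝒯) {a b : Pt d} (hr : F.ref = s(a, b))
    (h₁ : (flipCorr P (F, s(a, F.apex))).1 = G) (h₂ : (flipCorr P (F, s(b, F.apex))).1 = G)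
    (e : Sym2 (Pt d)) : flipCorr P (F, e) = (F, e) := by
  obtain ⟨hF', -⟩ | ⟨F', hF', hFr⟩ := (h.mem_iff F).1 hF
  · exact h.flipCorr_of_mem hF' e
  · exfalso
    have hne := ((h.isMesh.1 F hF).indep hr).ne
    rw [Elem.ref_of_reds hFr] at hr
    obtain ⟨x, hx, rfl⟩ := Sym2.mem_map.1 (show a ∈ F'.redEdge by rw [hr]; simp)
    obtain ⟨y, hy, rfl⟩ := Sym2.mem_map.1 (show b ∈ F'.redEdge by rw [hr]; simp)
    rw [h.flipCorr_side hF' hFr hx] at h₁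
    rw [h.flipCorr_side hF' hFr hy] at h₂
    rw [Elem.wing_inj.1 (h₁.trans h₂.symm)] at hne
    exact hne rfl

end NVB

/-! ### The two sequences of meshes -/

theorem lemma14 :
    ∃ C : ℝ, 0 < C ∧
      ∀ (d : ℕ) (𝒯 M : ℕ → Finset (NVB.Elem d)) (N₀ : ℕ → Set (Sym2 (NVB.Pt d))),
        NVB.IsMesh (𝒯 0) → (∀ T ∈ 𝒯 0, T.gen = 0) →
        (∀ l, NVB.RefineNVBred (𝒯 l) (M l) (N₀ l) (𝒯 (l + 1))) →
        ∃ (𝒯' M' : ℕ → Finset (NVB.Elem d)) (N₀' : ℕ → Set (Sym2 (NVB.Pt d)))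
          (corr : ℕ → NVB.Flag d → NVB.Flag d),
          𝒯' 0 = 𝒯 0 ∧
          (∀ l, NVB.IsMesh (𝒯' l)) ∧
          (∀ l, NVB.RefineNVB3 (𝒯' l) (M' l) (N₀' l) (𝒯' (l + 1))) ∧
          (∀ l, NVB.IsCorr C (𝒯 0) (𝒯 l) (𝒯' l) (corr l)) ∧
          (∀ l, (𝒯' l).card = (𝒯 l).card) ∧
          (∀ l, (M' l).card ≤ 2 * (M l).card) ∧
          -- the rule for every element of the `l`-th mesh that is a red-son
          (∀ k l, k < l → ∀ F ∈ 𝒯 k, F.redSons ⊆ ↑(𝒯 (k + 1)) →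
            F.upperRed ∈ 𝒯 l ∨ F.lowerRed ∈ 𝒯 l →
            F.upperRed ∈ 𝒯 l ∧ F.lowerRed ∈ 𝒯 l ∧
            ∀ a b, F.ref = s(a, b) → ∃ c m q p, NVB.RedSonRule (corr l) F a b c m q p) ∧
          -- if all edges of a red-refined element correspond to edges of one single element `G`,
          -- then its red-sons are mapped to two of the sons of `G` by three bisections
          (∀ l, ∀ F ∈ 𝒯 l, F.redSons ⊆ ↑(𝒯 (l + 1)) → ∀ G ∈ 𝒯' l, ∀ a b x y,
            F.ref = s(a, b) → G.ref = s(x, y) →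
            corr l (F, F.ref) = (G, G.ref) →
            corr l (F, s(a, F.apex)) = (G, s(x, G.apex)) →
            corr l (F, s(b, F.apex)) = (G, s(y, G.apex)) →
            NVB.RedSonRule (corr (l + 1)) F a b G.apex (NVB.mid G.ref)
              (midpoint ℝ x G.apex) (midpoint ℝ y G.apex)) := by
  refine ⟨1, one_pos, fun d 𝒯 M N₀ h₀ _ href => ?_⟩
  have step : ∀ l (s : Finset (NVB.Elem d) × Set (NVB.Elem d)), NVB.IsFlip (𝒯 l) s.1 s.2 →
      ∃ (s' : Finset (NVB.Elem d) × Set (NVB.Elem d)) (M' : Finset (NVB.Elem d))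
        (N₀' : Set (Sym2 (NVB.Pt d))), NVB.RefineNVB3 s.1 M' N₀' s'.1 ∧
        M'.card ≤ 2 * (M l).card ∧ NVB.IsFlip (𝒯 (l + 1)) s'.1 s'.2 ∧ s'.2 ⊆ s.2 ∪ 𝒯 l ∧
        (∀ F ∈ s.2, ∀ T ∈ F.reds, T ∈ 𝒯 (l + 1) → F ∈ s'.2) ∧
        ∀ F ∈ 𝒯 l, F.upperRed ∈ 𝒯 (l + 1) → F ∈ s'.2 := by
    intro l s hs
    obtain ⟨𝒯₁', M', N₀', P₁, h⟩ := hs.step (href l)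
    exact ⟨(𝒯₁', P₁), M', N₀', h⟩
  choose! next M' N₀' hnext using step
  -- The set of flips is carried along with the bisection mesh; at the start it is empty.
  let s : ℕ → Finset (NVB.Elem d) × Set (NVB.Elem d) := fun l =>
    Nat.rec (𝒯 0, ∅) (fun l s => next l s) l
  have hs : ∀ l, NVB.IsFlip (𝒯 l) (s l).1 (s l).2 := by
    intro l
    induction l with
    | zero => exact ⟨h₀, by simp [s], by simp [s], by simp [s], by simp [s], by simp [s]⟩
    | succ l ih => exact (hnext l (s l) ih).2.2.1
  have hn := fun l => hnext l (s l) (hs l)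
  have hanc : ∀ {j l}, j ≤ l → ∀ S ∈ 𝒯 l, ∃ T ∈ 𝒯 j, T.Successor S := fun hjl =>
    NVB.exists_ancestor (fun l S hS => (href l).choose_spec.exists_father hS) hjl
  have hanc' : ∀ l, ∀ S ∈ (s l).1, ∃ T ∈ 𝒯 0, T.Successor S := fun l =>
    NVB.exists_ancestor (𝒯 := fun l => (s l).1) (fun l S hS => (hn l).1.exists_father hS)
      (Nat.zero_le l)
  have hP : ∀ l, ∀ F ∈ (s l).2, ∃ A ∈ 𝒯 0, A.Successor F := by
    intro l
    induction l with
    | zero => intro F hF; exact hF.elim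
    | succ l ih =>
      intro F hF
      obtain hF | hF := (hn l).2.2.2.1 hF
      · exact ih F hF
      · exact hanc (Nat.zero_le l) F hF
  have hcorr : ∀ l, NVB.IsCorr 1 (𝒯 0) (𝒯 l) (s l).1 (NVB.flipCorr (s l).2) := fun l =>
    (hs l).isCorr h₀ (hP l) (hanc' l)
  have hnew : ∀ l, ∀ F ∈ 𝒯 l, F.redSons ⊆ ↑(𝒯 (l + 1)) → F ∈ (s (l + 1)).2 :=
    fun l F hF hsub => (hn l).2.2.2.2.2 F hF (hsub (NVB.Elem.reds_subset_redSons (.inl rfl)))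
  have hrule : ∀ k, ∀ F ∈ 𝒯 k, F.redSons ⊆ ↑(𝒯 (k + 1)) → ∀ l, k + 1 ≤ l → ∀ T ∈ F.reds,
      T ∈ 𝒯 l → F ∈ (s l).2 := by
    intro k F hF hsub l hkl
    induction l, hkl using Nat.le_induction with
    | base => exact fun T _ _ => hnew k F hF hsub
    | succ l hkl ih =>
      intro T hT hTl
      obtain ⟨T₁, hT₁, hs₁⟩ := (href l).choose_spec.exists_father hTl
      obtain ⟨T₂, hT₂, hs₂⟩ := hanc hkl T₁ hT₁
      have hm := (hs (k + 1)).isMesh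
      have hTk : T ∈ 𝒯 (k + 1) := hsub (NVB.Elem.reds_subset_redSons hT)
      obtain rfl := hm.eq_of_hull_subset hT₂ hTk (hm.1 T hTk) (hs₂.trans hs₁).hull_subset
        subset_rfl
      -- `T₁` lies between the red-son and the same red-son in a chain of successors; levels
      -- strictly increase along proper successors, so it was present all the time.
      have : T₁ = T₂ := by
        have h1 := hs₁.gen_lt_or_eq
        have h2 := hs₂.gen_lt_or_eq
        obtain h1 | h1 := h1
        · obtain h2 | h2 := h2
          · omega
          · exact h2.symm
        · exact h1
      subst this
      exact (hn l).2.2.2.2.1 F (ih T₁ hT hT₁) T₁ hT hTl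
  refine ⟨fun l => (s l).1, fun l => M' l (s l), fun l => N₀' l (s l),
    fun l => NVB.flipCorr (s l).2, rfl, fun l => (hs l).mesh, fun l => (hn l).1, hcorr,
    fun l => (hcorr l).card_eq, fun l => (hn l).2.1, ?_, ?_⟩
  · intro k l hkl F hF hsub hUL
    have hFl : F ∈ (s l).2 := by
      obtain h | h := hUL
      · exact hrule k F hF hsub l hkl _ (.inl rfl) h
      · exact hrule k F hF hsub l hkl _ (.inr rfl) h
    exact ⟨(hs l).reds_subset hFl (.inl rfl), (hs l).reds_subset hFl (.inr rfl),
      fun a b hr => ⟨_, _, _, _, (hs l).redSonRule hFl hr⟩⟩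
  · intro l F hF hsub G _ a b x y hr hr' h1 h2 h3
    dsimp only at h1 h2 h3
    -- A flipped red-son would send its two sides to different wings. Hence `F` is not flipped, the
    -- correspondence fixes its pairs, and `G` is `F`.
    have hself := (hs l).flipCorr_eq_self_of_const (G := G) hF hr (by rw [h2]) (by rw [h3])
    rw [hself] at h1 h2 h3
    obtain rfl : F = G := congrArg Prod.fst h1
    obtain rfl : a = x := Sym2.congr_left.1 (Prod.ext_iff.1 h2).2
    obtain rfl : b = y := Sym2.congr_left.1 (Prod.ext_iff.1 h3).2
    exact (hs (l + 1)).redSonRule (hnew l F hF hsub) hr
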